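/- **Conventions.** Let $X$ be a topological space; all chains have real coefficients. A (possibly infinite) singular $n$-chain $c=\sum_\sigma a_\sigma\sigma$ is *compactly finite* if every compact subset of $X$ meets the images $\sigma(\Delta^n)$ of only finitely many $\sigma$ with $a_\sigma\neq 0$. These chains form a complex $C^{\mathrm{cf}}_\bullet(X)$ with homology $H^{\mathrm{cf}}_*(X)$. Put $\|c\|=\sum_\sigma|a_\sigma|\in[0,\infty]$, and for $h\in H^{\mathrm{cf}}_n(X)$ let $\|h\|=\inf\|c\|$ over all cycles $c$ representing $h$. Let $\mathcal U=\{U_i\}_{i\in I}$ be a family of subsets of $X$. It is *star finite* if for every $i\in I$ the intersection $U_i\cap U_j$ is non-empty for only finitely many $j\in I$. It is a *proper covering* of $X$ if the interiors of the $U_i$ cover $X$ and the closures of the $U_i$ are compact. A space is *$l_1$-acyclic* (also called boundedly acyclic) if its bounded real singular cohomology is isomorphic to that of a point. A covering $\mathcal U$ is *$l_1$-acyclic* if every non-empty intersection of finitely many (at least one) members of $\mathcal U$ is $l_1$-acyclic. Let $\mathcal U$ be a star finite proper covering and let $N$ be its nerve, with vertices ordered by a linear order on $I$. For a $p$-simplex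 $\sigma$ of $N$ let $|\sigma|=\bigcap_{i\in\sigma}U_i$, and let $N_p$ be the set of $p$-simplices. Let $H^{\mathrm{inf}}_*(N)$ be the homology of the complex $C^{\mathrm{inf}}_\bullet(N)$ of infinite simplicial chains of $N$. Let $t_\bullet$ be the total complex of the double complex $\prod_{\sigma\in N_p}C_q(|\sigma|)$ ($p,q\ge 0$), where $C_q$ denotes finite singular chains. The augmentations $C_0(|\sigma|)\to\mathbf R$ induce a chain map $\lambda\colon t_\bullet\to C^{\mathrm{inf}}_\bullet(N)$, and the summation $(c_i)_i\mapsto\sum_i c_i$ of the components $c_i\in C_n(U_i)$ of bidegree $(p,q)=(0,n)$ induces a chain map $\tau\colon t_\bullet\to C^{\mathrm{cf}}_\bullet(X)$. The map $\tau_*$ induced in homology is an isomorphism, and the *Leray homomorphism* is $l_{\mathcal U}=\lambda_*\circ\tau_*^{-1}\colon H^{\mathrm{cf}}_*(X)\to H^{\mathrm{inf}}_*(N)$. **Theorem.** Let $\mathcal U$ be a star finite proper covering of $X$ that is countable and $l_1$-acyclic. If, for some $n\ge 0$, a homology class $h\in H^{\mathrm{cf}}_n(X)$ belongs to the kernel of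 $l_{\mathcal U}$, then $\|h\|=0$. -/

import Mathlib

set_option linter.unusedSectionVars false

noncomputable section

namespace LerayCF

/-! ## Homology of a sequence of linear maps -/

section Homology

variable {C : ℕ → Type*} [∀ n, AddCommGroup (C n)] [∀ n, Module ℝ (C n)]
  {C' : ℕ → Type*} [∀ n, AddCommGroup (C' n)] [∀ n, Module ℝ (C' n)]

/-- The `n`-cycles of a chain complex `⋯ → C 1 → C 0 → 0`. -/
def cycles (d : ∀ n, C (n + 1) →ₗ[ℝ] C n) : ∀ n, Submodule ℝ (C n)
  | 0 => ⊤
  | n + 1 => LinearMap.ker (d n)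

/-- The homology `ker / im` of a chain complex in degree `n`. -/
abbrev Homology (d : ∀ n, C (n + 1) →ₗ[ℝ] C n) (n : ℕ) : Type _ :=
  cycles d n ⧸ (LinearMap.range (d n)).submoduleOf (cycles d n)

theorem exists_ne_zero_of_finsum {α : Type*} {f : α → ℝ} (h : ∑ᶠ a, f a ≠ 0) : ∃ a, f a ≠ 0 := by
  by_contra! h'
  exact h (by simp [h'])

theorem map_mem_cycles {d : ∀ n, C (n + 1) →ₗ[ℝ] C n} {d' : ∀ n, C' (n + 1) →ₗ[ℝ] C' n}
    (f : ∀ n, C n →ₗ[ℝ] C' n) (hf : ∀ n x, f n (d n x) = d' n (f (n + 1) x)) :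
    ∀ (n : ℕ) (x : C n), x ∈ cycles d n → f n x ∈ cycles d' n
  | 0, _, _ => Submodule.mem_top
  | n + 1, x, hx => by
    change d' n (f (n + 1) x) = 0
    rw [← hf, show d n x = 0 from hx, map_zero]

/-- The map induced in homology by a chain map. -/
def homologyMap {d : ∀ n, C (n + 1) →ₗ[ℝ] C n} {d' : ∀ n, C' (n + 1) →ₗ[ℝ] C' n}
    (f : ∀ n, C n →ₗ[ℝ] C' n) (hf : ∀ n x, f n (d n x) = d' n (f (n + 1) x)) (n : ℕ) :
    Homology d n →ₗ[ℝ] Homology d' n :=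
  Submodule.mapQ _ _ ((f n).restrict (map_mem_cycles f hf n)) (by
    rintro ⟨x, hx⟩ ⟨y, hy⟩
    refine ⟨f (n + 1) y, ?_⟩
    rw [← hf, hy]
    rfl)

/-- The `n`-coboundaries of a cochain complex `0 → C 0 → C 1 → ⋯`. -/
def coboundaries (d : ∀ n, C n →ₗ[ℝ] C (n + 1)) : ∀ n, Submodule ℝ (C n)
  | 0 => ⊥
  | n + 1 => LinearMap.range (d n)

/-- The cohomology `ker / im` of a cochain complex in degree `n`. -/
abbrev Cohomology (d : ∀ n, C n →ₗ[ℝ] C (n + 1)) (n : ℕ) : Type _ :=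
  LinearMap.ker (d n) ⧸ (coboundaries d n).submoduleOf (LinearMap.ker (d n))

end Homology

/-! ## Singular simplices and infinite singular chains -/

section Singular

variable {X : Type*} [TopologicalSpace X]

/-- The set of singular `n`-simplices of `X`. -/
abbrev Sing (n : ℕ) (X : Type*) [TopologicalSpace X] : Type _ :=
  C(stdSimplex ℝ (Fin (n + 1)), X)

/-- The `i`-th face of a singular simplex. -/
def face {n : ℕ} (i : Fin (n + 2)) (s : Sing (n + 1) X) : Sing n X :=
  s.comp ⟨stdSimplex.map (Fin.succAbove i), stdSimplex.continuous_map _⟩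

theorem range_face {n : ℕ} (i : Fin (n + 2)) (s : Sing (n + 1) X) :
    Set.range (face i s) ⊆ Set.range s := by
  rintro _ ⟨x, rfl⟩
  exact ⟨_, rfl⟩

theorem range_nonempty {n : ℕ} (s : Sing n X) : (Set.range s).Nonempty :=
  ⟨_, ⟨stdSimplex.vertex 0, rfl⟩⟩

/-- The coefficient of `t` in the boundary `∑ i, (-1) ^ i • face i s` of `s`. -/
def singInc {n : ℕ} (s : Sing (n + 1) X) (t : Sing n X) : ℝ :=
  ∑ i : Fin (n + 2), {i | face i s = t}.indicator (fun i => (-1 : ℝ) ^ (i : ℕ)) i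

theorem range_subset_of_singInc {n : ℕ} {s : Sing (n + 1) X} {t : Sing n X}
    (h : singInc s t ≠ 0) : Set.range t ⊆ Set.range s := by
  obtain ⟨i, -, hi⟩ := Finset.exists_ne_zero_of_sum_ne_zero h
  have : i ∈ {i | face i s = t} := Set.mem_of_indicator_ne_zero hi
  have : face i s = t := this
  exact this ▸ range_face i s

/-- An infinite singular chain (a family of real coefficients) is compactly finite if every compact
set meets the images of only finitely many singular simplices with non-zero coefficient. -/
def IsCompactlyFinite {n : ℕ} (c : Sing n X → ℝ) : Prop :=
  ∀ Z : Set X, IsCompact Z → {s | c s ≠ 0 ∧ (Set.range s ∩ Z).Nonempty}.Finite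

/-- The space of compactly finite singular `n`-chains of `X` with real coefficients. -/
def CfChain (n : ℕ) (X : Type*) [TopologicalSpace X] : Submodule ℝ (Sing n X → ℝ) where
  carrier := {c | IsCompactlyFinite c}
  zero_mem' Z _ := by simp
  add_mem' {a b} ha hb Z hZ := by
    refine ((ha Z hZ).union (hb Z hZ)).subset ?_
    rintro s ⟨h1, h2⟩
    by_cases h : a s = 0
    · exact Or.inr ⟨fun h' => h1 (by simp [h, h']), h2⟩
    · exact Or.inl ⟨h, h2⟩
  smul_mem' r a ha Z hZ := by
    refine (ha Z hZ).subset ?_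
    rintro s ⟨h1, h2⟩
    exact ⟨fun h => h1 (by simp [h]), h2⟩

theorem finite_cofaces {n : ℕ} (c : CfChain (n + 1) X) (t : Sing n X) :
    {s | singInc s t ≠ 0 ∧ c.1 s ≠ 0}.Finite := by
  refine (c.2 (Set.range t) (isCompact_range t.continuous)).subset ?_
  rintro s ⟨h1, h2⟩
  obtain ⟨x, hx⟩ := range_nonempty t
  exact ⟨h2, x, range_subset_of_singInc h1 hx, hx⟩

/-- The boundary of a compactly finite chain; the coefficient in front of each singular simplex is
a finite sum. -/
def cfBdry (X : Type*) [TopologicalSpace X] (n : ℕ) : CfChain (n + 1) X →ₗ[ℝ] CfChain n X where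
  toFun c := ⟨fun t => ∑ᶠ s, singInc s t * c.1 s, fun Z hZ => by
    classical
    refine ((c.2 Z hZ).biUnion (t := fun s => Set.range fun i => face i s)
      fun s _ => Set.finite_range _).subset ?_
    rintro t ⟨h1, h2⟩
    obtain ⟨s, hs⟩ := exists_ne_zero_of_finsum h1
    have hi := left_ne_zero_of_mul hs
    refine Set.mem_biUnion (x := s) ⟨right_ne_zero_of_mul hs,
      h2.mono (Set.inter_subset_inter_left _ (range_subset_of_singInc hi))⟩ ?_
    obtain ⟨i, -, hi⟩ := Finset.exists_ne_zero_of_sum_ne_zero hi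
    have h3 : i ∈ {i | face i s = t} := Set.mem_of_indicator_ne_zero hi
    exact ⟨i, h3⟩⟩
  map_add' a b := by
    ext t
    change ∑ᶠ s, singInc s t * (a.1 s + b.1 s)
      = (∑ᶠ s, singInc s t * a.1 s) + ∑ᶠ s, singInc s t * b.1 s
    rw [← finsum_add_distrib]
    · simp only [mul_add]
    · exact (finite_cofaces a t).subset fun s hs =>
        ⟨left_ne_zero_of_mul hs, right_ne_zero_of_mul hs⟩
    · exact (finite_cofaces b t).subset fun s hs =>
        ⟨left_ne_zero_of_mul hs, right_ne_zero_of_mul hs⟩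
  map_smul' r a := by
    ext t
    change ∑ᶠ s, singInc s t * (r * a.1 s) = r * ∑ᶠ s, singInc s t * a.1 s
    rw [← smul_eq_mul r, smul_finsum]
    simp only [smul_eq_mul, mul_left_comm]

/-- The homology `H_n^cf(X)` based on compactly finite singular chains. -/
abbrev CfHomology (X : Type*) [TopologicalSpace X] (n : ℕ) : Type _ :=
  Homology (C := fun n => CfChain n X) (cfBdry X) n

/-- The `l₁`-norm of an infinite singular chain, possibly infinite. -/
def l1Norm {n : ℕ} (c : Sing n X → ℝ) : ENNReal := ∑' s, ‖c s‖ₑ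

/-- The `l₁`-norm of a compactly finite homology class: the infimum of the norms of the cycles
representing it. -/
def cfNorm {n : ℕ} (h : CfHomology X n) : ENNReal :=
  ⨅ (z : cycles (C := fun n => CfChain n X) (cfBdry X) n) (_ : Submodule.Quotient.mk z = h), l1Norm z.1.1

/-- The boundary of a finite singular chain. -/
def finBdry (X : Type*) [TopologicalSpace X] (n : ℕ) : (Sing (n + 1) X →₀ ℝ) →ₗ[ℝ] (Sing n X →₀ ℝ) :=
  Finsupp.lsum ℝ fun s => ∑ i : Fin (n + 2), (-1 : ℝ) ^ (i : ℕ) • Finsupp.lsingle (face i s)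

theorem finBdry_apply {n : ℕ} (c : Sing (n + 1) X →₀ ℝ) (t : Sing n X) :
    finBdry X n c t = ∑ᶠ s, singInc s t * c s := by
  classical
  rw [finsum_eq_sum_of_support_subset (s := c.support) _
    (fun s hs => by simpa using right_ne_zero_of_mul hs)]
  simp only [finBdry, Finsupp.lsum_apply, Finsupp.sum, Finsupp.finsetSum_apply, singInc,
    LinearMap.sum_apply, LinearMap.smul_apply, Finsupp.lsingle_apply, Finsupp.smul_apply,
    Finset.sum_mul]
  refine Finset.sum_congr rfl fun s _ => Finset.sum_congr rfl fun i _ => ?_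
  by_cases h : face i s = t <;> simp [h, Set.indicator]

end Singular

/-! ## Bounded cohomology and acyclicity -/

section Bounded

/-- The space of bounded real singular `n`-cochains of `Y`. -/
def BddCochain (Y : Type*) [TopologicalSpace Y] (n : ℕ) : Submodule ℝ (Sing n Y → ℝ) where
  carrier := {f | ∃ K : ℝ, ∀ s, |f s| ≤ K}
  zero_mem' := ⟨0, by simp⟩
  add_mem' := by
    rintro f g ⟨K, hK⟩ ⟨L, hL⟩
    exact ⟨K + L, fun s => (abs_add_le _ _).trans (add_le_add (hK s) (hL s))⟩
  smul_mem' := by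
    rintro r f ⟨K, hK⟩
    refine ⟨|r| * K, fun s => ?_⟩
    rw [Pi.smul_apply, smul_eq_mul, abs_mul]
    exact mul_le_mul_of_nonneg_left (hK s) (abs_nonneg r)

/-- The coboundary of a bounded cochain. -/
def bddCobdry (Y : Type*) [TopologicalSpace Y] (n : ℕ) :
    BddCochain Y n →ₗ[ℝ] BddCochain Y (n + 1) where
  toFun f := ⟨fun s => ∑ i : Fin (n + 2), (-1 : ℝ) ^ (i : ℕ) * f.1 (face i s), by
    obtain ⟨K, hK⟩ := f.2
    refine ⟨∑ _i : Fin (n + 2), K, fun s => (Finset.abs_sum_le_sum_abs _ _).trans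
      (Finset.sum_le_sum fun i _ => ?_)⟩
    rw [abs_mul, abs_pow, abs_neg, abs_one, one_pow, one_mul]
    exact hK _⟩
  map_add' f g := by
    ext s
    simp [mul_add, Finset.sum_add_distrib]
  map_smul' r f := by
    ext s
    simp [Finset.mul_sum, mul_left_comm]

/-- The bounded cohomology `H_b^n(Y; ℝ)`. -/
abbrev BddCohomology (Y : Type*) [TopologicalSpace Y] (n : ℕ) : Type _ :=
  Cohomology (bddCobdry Y) n

/-- A space is `l₁`-acyclic (that is, boundedly acyclic) if its bounded cohomology is isomorphic to
the bounded cohomology of a point. -/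
def IsL1Acyclic (Y : Type*) [TopologicalSpace Y] : Prop :=
  ∀ n : ℕ, Nonempty (BddCohomology Y n ≃ₗ[ℝ] BddCohomology Unit n)

end Bounded

/-! ## Coverings and nerves -/

section Covering

variable {X : Type*} [TopologicalSpace X] {ι : Type*}

/-- Each member of the family meets only finitely many members. -/
def IsStarFinite (U : ι → Set X) : Prop :=
  ∀ i, {j | (U i ∩ U j).Nonempty}.Finite

/-- The interiors of the members cover the space, and their closures are compact. -/
def IsProperCovering (U : ι → Set X) : Prop :=
  (⋃ i, interior (U i)) = Set.univ ∧ ∀ i, IsCompact (closure (U i))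

/-- A covering is `l₁`-acyclic if all non-empty finite intersections of its members are. -/
def IsL1AcyclicCovering (U : ι → Set X) : Prop :=
  ∀ σ : Finset ι, σ.Nonempty → (⋂ i ∈ σ, U i).Nonempty → IsL1Acyclic ↥(⋂ i ∈ σ, U i)

/-- The set of `p`-dimensional simplices of the nerve of a family. -/
def Nerve (U : ι → Set X) (p : ℕ) : Type _ :=
  {σ : Finset ι // σ.card = p + 1 ∧ (⋂ i ∈ σ, U i).Nonempty}

/-- The intersection `|σ|` of the members that are the vertices of `σ`. -/
def Nerve.carrier {U : ι → Set X} {p : ℕ} (σ : Nerve U p) : Set X := ⋂ i ∈ σ.1, U i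

theorem Nerve.subset_of_mem {U : ι → Set X} {p : ℕ} (σ : Nerve U p) {i : ι} (hi : i ∈ σ.1) :
    σ.carrier ⊆ U i := Set.biInter_subset_of_mem hi

theorem Nerve.nonempty {U : ι → Set X} {p : ℕ} (σ : Nerve U p) : ∃ i, i ∈ σ.1 :=
  Finset.card_pos.1 (by rw [σ.2.1]; omega)

theorem finite_meeting {U : ι → Set X} (hU : IsStarFinite U) (i : ι) (p : ℕ) :
    {σ : Nerve U p | (U i ∩ σ.carrier).Nonempty}.Finite := by
  classical
  refine Set.Finite.of_finite_image (f := Subtype.val) ?_ Subtype.val_injective.injOn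
  refine ((hU i).toFinset.powerset.finite_toSet).subset ?_
  rintro _ ⟨σ, ⟨x, hx, hσ⟩, rfl⟩
  simp only [Finset.coe_powerset, Set.mem_preimage, Set.mem_powerset_iff, Set.Finite.coe_toFinset]
  exact fun j hj => ⟨x, hx, σ.subset_of_mem hj hσ⟩

theorem finite_mem {U : ι → Set X} (hU : IsStarFinite U) (x : X) (p : ℕ) :
    {σ : Nerve U p | x ∈ σ.carrier}.Finite := by
  by_cases h : ∃ i, x ∈ U i
  · obtain ⟨i, hi⟩ := h
    exact (finite_meeting hU i p).subset fun σ hσ => ⟨x, hi, hσ⟩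
  · refine Set.finite_empty.subset fun σ hσ => h ?_
    obtain ⟨i, hi⟩ := σ.nonempty
    exact ⟨i, σ.subset_of_mem hi hσ⟩

variable [LinearOrder ι]

/-- The incidence number of two finite sets of vertices: it is `(-1) ^ a` if `ρ` is obtained from
`σ` by deleting the vertex in position `a` (counted from `0`), and `0` otherwise. -/
def nerveInc (σ ρ : Finset ι) : ℝ :=
  ∑ j ∈ σ, if σ.erase j = ρ then (-1 : ℝ) ^ (σ.filter (· < j)).card else 0

theorem subset_of_nerveInc {σ ρ : Finset ι} (h : nerveInc σ ρ ≠ 0) : ρ ⊆ σ := by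
  obtain ⟨j, -, hj⟩ := Finset.exists_ne_zero_of_sum_ne_zero h
  have : σ.erase j = ρ := by
    by_contra h'
    exact hj (if_neg h')
  exact this ▸ Finset.erase_subset _ _

theorem carrier_subset_of_nerveInc {U : ι → Set X} {p q : ℕ} {σ : Nerve U p} {ρ : Nerve U q}
    (h : nerveInc σ.1 ρ.1 ≠ 0) : σ.carrier ⊆ ρ.carrier :=
  Set.biInter_subset_biInter_left (subset_of_nerveInc h)

theorem finite_nerveInc {U : ι → Set X} (hU : IsStarFinite U) {p : ℕ} (ρ : Nerve U p) :
    {σ : Nerve U (p + 1) | nerveInc σ.1 ρ.1 ≠ 0}.Finite := by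
  obtain ⟨i, hi⟩ := ρ.nonempty
  refine (finite_meeting hU i (p + 1)).subset fun σ hσ => ?_
  obtain ⟨x, hx⟩ := σ.2.2
  exact ⟨x, ρ.subset_of_mem hi (carrier_subset_of_nerveInc hσ hx), hx⟩

variable {M : Type*} [AddCommGroup M] [Module ℝ M]

/-- The boundary of infinite chains of the nerve with coefficients in `M`, with respect to the
given order of the vertices. All the sums are finite because the nerve is star finite. -/
def nerveBdry (U : ι → Set X) (hU : IsStarFinite U) (M : Type*) [AddCommGroup M] [Module ℝ M]
    (p : ℕ) : (Nerve U (p + 1) → M) →ₗ[ℝ] (Nerve U p → M) where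
  toFun c ρ := ∑ᶠ σ, nerveInc σ.1 ρ.1 • c σ
  map_add' a b := by
    ext ρ
    rw [Pi.add_apply, ← finsum_add_distrib]
    · simp only [Pi.add_apply, smul_add]
    · exact (finite_nerveInc hU ρ).subset fun s hs => left_ne_zero_of_smul hs
    · exact (finite_nerveInc hU ρ).subset fun s hs => left_ne_zero_of_smul hs
  map_smul' r a := by
    ext ρ
    change ∑ᶠ σ, nerveInc σ.1 ρ.1 • r • a σ = r • ∑ᶠ σ, nerveInc σ.1 ρ.1 • a σ
    rw [smul_finsum]
    exact finsum_congr fun σ => smul_comm _ _ _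

theorem nerveBdry_apply {U : ι → Set X} (hU : IsStarFinite U) {p : ℕ} (c : Nerve U (p + 1) → M)
    (ρ : Nerve U p) :
    nerveBdry U hU M p c ρ = ∑ σ ∈ (finite_nerveInc hU ρ).toFinset, nerveInc σ.1 ρ.1 • c σ :=
  finsum_eq_sum_of_support_subset _ fun σ hσ => by
    simpa using left_ne_zero_of_smul hσ

theorem map_nerveBdry {U : ι → Set X} (hU : IsStarFinite U) {M' : Type*} [AddCommGroup M']
    [Module ℝ M'] (f : M →ₗ[ℝ] M') {p : ℕ} (c : Nerve U (p + 1) → M) (ρ : Nerve U p) :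
    f (nerveBdry U hU M p c ρ) = nerveBdry U hU M' p (fun σ => f (c σ)) ρ := by
  simp only [nerveBdry_apply, map_sum, map_smul]

/-- The homology `H_n^inf(N)` of the nerve based on infinite simplicial chains. -/
abbrev NerveHomology (U : ι → Set X) (hU : IsStarFinite U) (n : ℕ) : Type _ :=
  Homology (C := fun n => Nerve U n → ℝ) (nerveBdry U hU ℝ) n

/-! ## The double complex of a covering and its total complex -/

/-- Families of finite singular chains of `X` indexed by simplices of the nerve, in all bidegrees
`(p, q)`. -/
abbrev Bigraded (U : ι → Set X) : Type _ := ∀ p q : ℕ, Nerve U p → (Sing q X →₀ ℝ)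

/-- The total differential, with components `δ_p` and `(-1) ^ p • ∂_q`. -/
def bigradedD (U : ι → Set X) (hU : IsStarFinite U) : Bigraded U →ₗ[ℝ] Bigraded U where
  toFun x p q σ := nerveBdry U hU _ p (x (p + 1) q) σ + (-1 : ℝ) ^ p • finBdry X q (x p (q + 1) σ)
  map_add' a b := by
    funext p q σ
    simp only [Pi.add_apply, map_add, smul_add]
    abel
  map_smul' r a := by
    funext p q σ
    simp only [Pi.smul_apply, map_smul, smul_add, RingHom.id_apply, smul_comm r]

/-- The degree `n` part `⨁_{p + q = n} ∏_{σ ∈ N_p} C_q(|σ|)` of the total complex of the double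
complex of the covering. Finite singular chains of a subspace `|σ|` are the finite singular chains
of `X` all whose singular simplices have image contained in `|σ|`. -/
def Tot (U : ι → Set X) (n : ℕ) : Submodule ℝ (Bigraded U) where
  carrier := {x | (∀ p q, p + q ≠ n → x p q = 0) ∧
    ∀ p q σ s, x p q σ s ≠ 0 → Set.range s ⊆ σ.carrier}
  zero_mem' := ⟨fun _ _ _ => rfl, fun _ _ _ _ h => absurd rfl h⟩
  add_mem' {a b} ha hb := by
    refine ⟨fun p q h => by simp [ha.1 p q h, hb.1 p q h], fun p q σ s h => ?_⟩
    by_cases h' : a p q σ s = 0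
    · exact hb.2 p q σ s fun h'' => h (by simp [h', h''])
    · exact ha.2 p q σ s h'
  smul_mem' r a ha := by
    refine ⟨fun p q h => by simp [ha.1 p q h], fun p q σ s h => ?_⟩
    exact ha.2 p q σ s fun h' => h (by simp [h'])

theorem bigradedD_mem {U : ι → Set X} (hU : IsStarFinite U) (n : ℕ) :
    ∀ x ∈ Tot U (n + 1), bigradedD U hU x ∈ Tot U n := by
  intro x hx
  refine ⟨fun p q h => ?_, fun p q σ s h => ?_⟩
  · funext σ
    change nerveBdry U hU _ p (x (p + 1) q) σ + (-1 : ℝ) ^ p • finBdry X q (x p (q + 1) σ) = 0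
    rw [hx.1 (p + 1) q (by omega), hx.1 p (q + 1) (by omega)]
    simp
  · change (nerveBdry U hU _ p (x (p + 1) q) σ
      + (-1 : ℝ) ^ p • finBdry X q (x p (q + 1) σ)) s ≠ 0 at h
    by_cases h' : finBdry X q (x p (q + 1) σ) s = 0
    · have h2 : (nerveBdry U hU _ p (x (p + 1) q) σ) s ≠ 0 := fun h'' => h (by simp [h', h''])
      rw [nerveBdry_apply, Finsupp.finsetSum_apply] at h2
      obtain ⟨τ, -, hτ⟩ := Finset.exists_ne_zero_of_sum_ne_zero h2
      exact (hx.2 (p + 1) q τ s (right_ne_zero_of_mul hτ)).trans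
        (carrier_subset_of_nerveInc (left_ne_zero_of_mul hτ))
    · rw [finBdry_apply] at h'
      obtain ⟨t, ht⟩ := exists_ne_zero_of_finsum h'
      exact (range_subset_of_singInc (left_ne_zero_of_mul ht)).trans
        (hx.2 p (q + 1) σ t (right_ne_zero_of_mul ht))

/-- The differential of the total complex. -/
def totD (U : ι → Set X) (hU : IsStarFinite U) (n : ℕ) : Tot U (n + 1) →ₗ[ℝ] Tot U n :=
  (bigradedD U hU).restrict (bigradedD_mem hU n)

/-- The homology of the total complex. -/
abbrev TotHomology (U : ι → Set X) (hU : IsStarFinite U) (n : ℕ) : Type _ :=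
  Homology (C := fun n => Tot U n) (totD U hU) n

/-! ## The two edge maps of the total complex -/

/-- The augmentation of finite singular chains: the sum of the coefficients. -/
def augmentation (q : ℕ) (X : Type*) [TopologicalSpace X] : (Sing q X →₀ ℝ) →ₗ[ℝ] ℝ :=
  Finsupp.lsum ℝ fun _ => LinearMap.id

theorem augmentation_single {q : ℕ} {X : Type*} [TopologicalSpace X] (s : Sing q X) (r : ℝ) :
    augmentation q X (Finsupp.single s r) = r := by
  simp [augmentation]

theorem augmentation_finBdry (c : Sing 1 X →₀ ℝ) : augmentation 0 X (finBdry X 0 c) = 0 := by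
  suffices h : (augmentation 0 X).comp (finBdry X 0) = 0 from LinearMap.congr_fun h c
  ext s
  simp [finBdry, Fin.sum_univ_two, augmentation_single]

/-- The chain map `λ` from the total complex to infinite simplicial chains of the nerve, induced by
the augmentations `C_0(|σ|) → ℝ`. -/
def toNerve (U : ι → Set X) (n : ℕ) : Tot U n →ₗ[ℝ] (Nerve U n → ℝ) where
  toFun x σ := augmentation 0 X (x.1 n 0 σ)
  map_add' a b := by
    funext σ
    exact map_add (augmentation 0 X) _ _
  map_smul' r a := by
    funext σ
    exact map_smul (augmentation 0 X) _ _

theorem toNerve_comm (U : ι → Set X) (hU : IsStarFinite U) (n : ℕ) (x : Tot U (n + 1)) :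
    toNerve U n (totD U hU n x) = nerveBdry U hU ℝ n (toNerve U (n + 1) x) := by
  funext σ
  change augmentation 0 X (nerveBdry U hU _ n (x.1 (n + 1) 0) σ
    + (-1 : ℝ) ^ n • finBdry X 0 (x.1 n 1 σ)) = _
  rw [map_add, map_smul, augmentation_finBdry, smul_zero, add_zero, map_nerveBdry]
  rfl

theorem finite_vertices {U : ι → Set X} (hU : IsStarFinite U) {n : ℕ} (x : Tot U n) (p q : ℕ)
    (s : Sing q X) : {σ : Nerve U p | x.1 p q σ s ≠ 0}.Finite := by
  obtain ⟨y, hy⟩ := range_nonempty s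
  exact (finite_mem hU y p).subset fun σ hσ => x.2.2 p q σ s hσ hy

/-- The chain map `τ` from the total complex to compactly finite singular chains of `X`: the chain
`x` goes to the sum `∑_i x_i` of its components `x_i ∈ C_n(U i)` in bidegree `(0, n)`. -/
def toCf (U : ι → Set X) (hU : IsStarFinite U) (hP : IsProperCovering U) (n : ℕ) :
    Tot U n →ₗ[ℝ] CfChain n X where
  toFun x := ⟨fun s => ∑ᶠ σ, x.1 0 n σ s, fun Z hZ => by
    have hfin : {σ : Nerve U 0 | (Z ∩ σ.carrier).Nonempty}.Finite := by
      obtain ⟨t, ht⟩ := hZ.elim_finite_subcover (fun i => interior (U i))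
        (fun _ => isOpen_interior) (by rw [hP.1]; exact Set.subset_univ _)
      refine ((t.finite_toSet).biUnion fun i _ => finite_meeting hU i 0).subset ?_
      rintro σ ⟨y, hy, hσ⟩
      obtain ⟨i, hi, hyi⟩ := Set.mem_iUnion₂.1 (ht hy)
      exact Set.mem_biUnion (Finset.mem_coe.2 hi) ⟨y, interior_subset hyi, hσ⟩
    refine (hfin.biUnion (t := fun σ => ((x.1 0 n σ).support : Set (Sing n X)))
      fun σ _ => Finset.finite_toSet _).subset ?_
    rintro s ⟨h1, y, hys, hyZ⟩
    obtain ⟨σ, hσ⟩ := exists_ne_zero_of_finsum h1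
    exact Set.mem_biUnion (x := σ) ⟨y, hyZ, x.2.2 0 n σ s hσ hys⟩ (by simpa using hσ)⟩
  map_add' a b := by
    ext s
    exact finsum_add_distrib (finite_vertices hU a 0 n s) (finite_vertices hU b 0 n s)
  map_smul' r a := by
    ext s
    exact (smul_finsum r fun σ => a.1 0 n σ s).symm

theorem sum_nerveInc {U : ι → Set X} (σ : Nerve U 1) (S : Finset (Nerve U 0))
    (hS : ∀ ρ : Nerve U 0, σ.carrier ⊆ ρ.carrier → ρ ∈ S) :
    ∑ ρ ∈ S, nerveInc σ.1 ρ.1 = 0 := by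
  classical
  obtain ⟨y, hy⟩ := σ.2.2
  have hv : ∀ j ∈ σ.1, ∃ ρ ∈ S, σ.1.erase j = ρ.1 := fun j hj => by
    have hy' : y ∈ ⋂ i ∈ σ.1.erase j, U i :=
      Set.biInter_subset_biInter_left (Finset.erase_subset j σ.1) hy
    exact ⟨⟨σ.1.erase j, by rw [Finset.card_erase_of_mem hj, σ.2.1], y, hy'⟩,
      hS _ (Set.biInter_subset_biInter_left (Finset.erase_subset j σ.1)), rfl⟩
  have h1 : ∑ ρ ∈ S, nerveInc σ.1 ρ.1 = ∑ j ∈ σ.1, (-1 : ℝ) ^ (σ.1.filter (· < j)).card := by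
    simp only [nerveInc]
    rw [Finset.sum_comm]
    refine Finset.sum_congr rfl fun j hj => ?_
    obtain ⟨ρ, hρ, he⟩ := hv j hj
    rw [Finset.sum_eq_single_of_mem ρ hρ, if_pos he]
    intro ρ' _ hne
    exact if_neg fun h => hne (Subtype.ext (h.symm.trans he))
  rw [h1]
  obtain ⟨a, b, hab, he⟩ := Finset.card_eq_two.1 σ.2.1
  rw [he, Finset.sum_pair hab]
  rcases lt_or_gt_of_ne hab with h | h
  · simp [Finset.filter_insert, Finset.filter_singleton, h, not_lt.2 h.le]
  · simp [Finset.filter_insert, Finset.filter_singleton, h, not_lt.2 h.le]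

theorem toCf_comm (U : ι → Set X) (hU : IsStarFinite U) (hP : IsProperCovering U) (n : ℕ)
    (x : Tot U (n + 1)) :
    toCf U hU hP n (totD U hU n x) = cfBdry X n (toCf U hU hP (n + 1) x) := by
  classical
  ext s
  change ∑ᶠ ρ, (nerveBdry U hU _ 0 (x.1 1 n) ρ + (-1 : ℝ) ^ 0 • finBdry X n (x.1 0 (n + 1) ρ)) s
    = ∑ᶠ t, singInc t s * ∑ᶠ ρ, x.1 0 (n + 1) ρ t
  obtain ⟨y, hy⟩ := range_nonempty s
  set S : Finset (Nerve U 0) := (finite_mem hU y 0).toFinset with hS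
  set S1 : Finset (Nerve U 1) := (finite_mem hU y 1).toFinset with hS1
  have hN : ∀ ρ : Nerve U 0, nerveBdry U hU _ 0 (x.1 1 n) ρ s
      = ∑ σ ∈ S1, nerveInc σ.1 ρ.1 * x.1 1 n σ s := fun ρ => by
    rw [nerveBdry_apply, Finsupp.finsetSum_apply]
    simp only [Finsupp.smul_apply, smul_eq_mul]
    rw [← finsum_eq_sum_of_support_subset (s := (finite_nerveInc hU ρ).toFinset),
      ← finsum_eq_sum_of_support_subset (s := S1)]
    · intro σ hσ
      simpa [hS1] using x.2.2 1 n σ s (right_ne_zero_of_mul hσ) hy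
    · intro σ hσ
      simpa using left_ne_zero_of_mul hσ
  have hF : ∀ ρ : Nerve U 0, finBdry X n (x.1 0 (n + 1) ρ) s ≠ 0 → ρ ∈ S := fun ρ h => by
    rw [finBdry_apply] at h
    obtain ⟨t, ht⟩ := exists_ne_zero_of_finsum h
    simpa [hS] using x.2.2 0 (n + 1) ρ t (right_ne_zero_of_mul ht)
      (range_subset_of_singInc (left_ne_zero_of_mul ht) hy)
  have hNS : ∀ ρ : Nerve U 0, nerveBdry U hU _ 0 (x.1 1 n) ρ s ≠ 0 → ρ ∈ S := fun ρ h => by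
    rw [hN] at h
    obtain ⟨σ, -, hσ⟩ := Finset.exists_ne_zero_of_sum_ne_zero h
    simpa [hS] using carrier_subset_of_nerveInc (left_ne_zero_of_mul hσ)
      (x.2.2 1 n σ s (right_ne_zero_of_mul hσ) hy)
  have hR : ∀ t, singInc t s * ∑ᶠ ρ, x.1 0 (n + 1) ρ t
      = ∑ ρ ∈ S, singInc t s * x.1 0 (n + 1) ρ t := fun t => by
    by_cases h : singInc t s = 0
    · simp [h]
    rw [finsum_eq_sum_of_support_subset (s := S), Finset.mul_sum]
    intro ρ hρ
    simpa [hS] using x.2.2 0 (n + 1) ρ t hρ (range_subset_of_singInc h hy)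
  rw [finsum_congr hR, finsum_sum_comm]
  · rw [finsum_eq_sum_of_support_subset (s := S)]
    · simp only [Finsupp.add_apply, pow_zero, one_smul, Finset.sum_add_distrib, hN,
        finBdry_apply]
      rw [Finset.sum_comm, add_eq_right]
      refine Finset.sum_eq_zero fun σ hσ => ?_
      rw [← Finset.sum_mul, sum_nerveInc, zero_mul]
      intro ρ hρ
      have : y ∈ σ.carrier := by simpa [hS1] using hσ
      simpa [hS] using hρ this
    · intro ρ hρ
      by_contra hc
      have h1 := not_not.1 (mt (hF ρ) hc)
      have h2 := not_not.1 (mt (hNS ρ) hc)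
      exact hρ (by simp [h1, h2])
  · intro ρ _
    refine (x.1 0 (n + 1) ρ).support.finite_toSet.subset fun t ht => ?_
    simpa using right_ne_zero_of_mul ht

/-! ## The Leray homomorphism -/

/-- The inverse of a bijective linear map (and `0` for a map which is not bijective). -/
def linearInverse {V W : Type*} [AddCommGroup V] [Module ℝ V] [AddCommGroup W] [Module ℝ W]
    (f : V →ₗ[ℝ] W) : W →ₗ[ℝ] V :=
  open Classical in
  if hf : Function.Bijective f then (LinearEquiv.ofBijective f hf).symm.toLinearMap else 0

/-- The Leray homomorphism `λ_* ∘ τ_*⁻¹ : H_n^cf(X) → H_n^inf(N)` of a star finite proper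
covering. -/
def leray (U : ι → Set X) (hU : IsStarFinite U) (hP : IsProperCovering U) (n : ℕ) :
    CfHomology X n →ₗ[ℝ] NerveHomology U hU n :=
  (homologyMap (C := fun n => Tot U n) (C' := fun n => Nerve U n → ℝ)
      (toNerve U) (toNerve_comm U hU) n).comp
    (linearInverse (homologyMap (C := fun n => Tot U n) (C' := fun n => CfChain n X)
      (toCf U hU hP) (toCf_comm U hU hP) n))

end Covering

end LerayCF

end

set_option linter.unusedSectionVars false

noncomputable section

namespace LerayCF

/-! ## Boundary operators square to zero -/

section Squares

/-! Since `τ` is a quasi-isomorphism, a class in the kernel of the Leray homomorphism is represented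
by `τ x`, where `x` is a cycle of the total complex and `λ x` bounds in the nerve. As `λ` is
surjective on chains (put a weighted point into each `|σ|`), subtracting a total boundary makes `λ
x` vanish identically (`exists_toNerve_eq`).

The components of `x` are then made small one after the other along the antidiagonal
(`exists_small_component`). In bidegree `(n, 0)` every component has augmentation zero, and in an
acyclic `|σ|` such a chain is arbitrarily close to a boundary. If the components in bidegree `(p +
1, q)` are small, the cycle equation says that those in bidegree `(p, q + 1)` have small vertical
boundary, and in an acyclic space a chain with small boundary is close to a boundary, with a
constant depending on the space. No uniformity of these constants is needed: tolerances may vary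
with the simplex, each simplex has finitely many faces, and star finiteness bounds the contributions
to each face. At `(0, n)` the tolerances are chosen with total sum at most `ε`, by countability, and
the `l₁`-norm of `τ x` is at most the sum of the norms of these components.

The analytic input (`IsL1Acyclic.exists_approx`) is duality: by Hahn–Banach, the distance of `c` to
the boundaries is detected by a bounded cocycle `f` of norm at most one. Acyclicity and the open
mapping theorem give `f = dg` with `g` bounded by `K`, hence `f c = g (∂c) ≤ K * ‖∂c‖`.

That `τ` induces isomorphisms (`bijective_homologyMap_toCf`) has two halves. The kernel of `τ` is
acyclic because the rows are contracted by cones whose apex is a member containing the given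
singular simplex. The image of `τ` consists of the chains of simplices lying in single members, and
arbitrary chains are moved there by barycentric subdivision. The number of subdivisions varies with
the simplex; the resulting homotopy never leaves the image of a simplex, so it extends to compactly
finite chains. -/

/-- The cancellation behind `∂ ∘ ∂ = 0` for alternating sums of faces. -/
theorem sum_alternating_eq_zero {M : Type*} [AddCommGroup M] [Module ℝ M] {n : ℕ}
    (a : Fin (n + 3) → Fin (n + 2) → M)
    (ha : ∀ i j : Fin (n + 2), j ≤ i → a i.succ j = a j.castSucc i) :
    ∑ i : Fin (n + 3), ∑ j : Fin (n + 2), ((-1 : ℝ) ^ (i : ℕ) * (-1 : ℝ) ^ (j : ℕ)) • a i j = 0 := by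
  classical
  rw [← Finset.sum_product']
  -- The involution exchanges `(i, j)` with `j < i` and `(j, i - 1)`. Paired terms have equal values
  -- and opposite signs.
  let g : Fin (n + 3) × Fin (n + 2) → Fin (n + 3) × Fin (n + 2) := fun x =>
    if h : (x.2 : ℕ) < x.1 then (x.2.castSucc, ⟨(x.1 : ℕ) - 1, by omega⟩)
    else (x.2.succ, ⟨(x.1 : ℕ), by omega⟩)
  refine Finset.sum_involution (fun x _ => g x) ?_ ?_ (fun _ _ => by simp) ?_
  · rintro ⟨i, j⟩ -
    by_cases h : (j : ℕ) < i
    · obtain ⟨k, rfl⟩ : ∃ k : Fin (n + 2), i = k.succ := ⟨⟨(i : ℕ) - 1, by omega⟩, by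
        ext; simp; omega⟩
      have hg : g (k.succ, j) = (j.castSucc, k) := (dif_pos h).trans (by simp)
      rw [hg]
      simp only [Fin.val_succ, Fin.val_castSucc] at h ⊢
      rw [ha k j (Fin.le_def.2 (by omega)), ← add_smul, pow_succ]
      rw [show (-1 : ℝ) ^ (k : ℕ) * -1 * (-1) ^ (j : ℕ) + (-1) ^ (j : ℕ) * (-1) ^ (k : ℕ) = 0 by
        ring, zero_smul]
    · obtain ⟨k, rfl⟩ : ∃ k : Fin (n + 2), i = k.castSucc := ⟨⟨(i : ℕ), by omega⟩, rfl⟩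
      have hg : g (k.castSucc, j) = (j.succ, k) := (dif_neg h).trans (by simp)
      rw [hg]
      simp only [Fin.val_succ, Fin.val_castSucc] at h ⊢
      rw [ha j k (Fin.le_def.2 (by omega)), ← add_smul, pow_succ]
      rw [show (-1 : ℝ) ^ (k : ℕ) * (-1) ^ (j : ℕ) + (-1) ^ (j : ℕ) * -1 * (-1) ^ (k : ℕ) = 0 by
        ring, zero_smul]
  · rintro ⟨i, j⟩ - - h
    simp only [g] at h
    split_ifs at h with h'
    · have := congrArg (fun x : Fin (n + 3) × Fin (n + 2) => (x.1 : ℕ)) h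
      simp only [Fin.val_castSucc] at this
      omega
    · have := congrArg (fun x : Fin (n + 3) × Fin (n + 2) => (x.1 : ℕ)) h
      simp only [Fin.val_succ] at this
      omega
  · rintro ⟨i, j⟩ -
    simp only [g]
    by_cases h : (j : ℕ) < i
    · have h' : ¬ ((i : ℕ) - 1 < j) := by omega
      simp [h, h']
      ext; simp; omega
    · simp [h, not_lt.1 h]

theorem succAbove_comp_succAbove {n : ℕ} {i j : Fin (n + 2)} (h : j ≤ i) :
    i.succ.succAbove ∘ j.succAbove = j.castSucc.succAbove ∘ i.succAbove := by
  funext k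
  rw [Fin.le_def] at h
  ext
  simp only [Function.comp, Fin.succAbove, Fin.lt_def]
  split_ifs <;> simp_all <;> omega

variable {X : Type*} [TopologicalSpace X]

theorem face_face {n : ℕ} {i j : Fin (n + 2)} (h : j ≤ i) (s : Sing (n + 2) X) :
    face j (face i.succ s) = face i (face j.castSucc s) := by
  ext x
  simp only [face, ContinuousMap.comp_apply, ContinuousMap.coe_mk, stdSimplex.map_comp_apply]
  rw [succAbove_comp_succAbove h]

theorem finBdry_single {n : ℕ} (s : Sing (n + 1) X) (r : ℝ) :
    finBdry X n (Finsupp.single s r)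
      = ∑ i : Fin (n + 2), (-1 : ℝ) ^ (i : ℕ) • Finsupp.single (face i s) r := by
  simp [finBdry]

theorem finBdry_finBdry {n : ℕ} (c : Sing (n + 2) X →₀ ℝ) :
    finBdry X n (finBdry X (n + 1) c) = 0 := by
  suffices h : (finBdry X n).comp (finBdry X (n + 1)) = 0 from LinearMap.congr_fun h c
  refine Finsupp.lhom_ext fun s r => ?_
  simp only [LinearMap.comp_apply, finBdry_single, map_sum, map_smul, LinearMap.zero_apply,
    Finset.smul_sum, smul_smul]
  exact sum_alternating_eq_zero (fun i j => Finsupp.single (face j (face i s)) r)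
    fun i j h => by rw [face_face h]

end Squares

/-! ## Operators which do not enlarge the images of simplices -/

section Carried

variable {X : Type*} [TopologicalSpace X] {n m k : ℕ}

/-- A linear map of finite singular chains is carried if it sends every singular simplex to a
chain in the image of this simplex. -/
def Carried (F : (Sing n X →₀ ℝ) →ₗ[ℝ] (Sing m X →₀ ℝ)) : Prop :=
  ∀ s t, F (Finsupp.single s 1) t ≠ 0 → Set.range t ⊆ Set.range s

theorem Carried.exists_of_apply_ne_zero {F : (Sing n X →₀ ℝ) →ₗ[ℝ] (Sing m X →₀ ℝ)}
    (hF : Carried F) {c : Sing n X →₀ ℝ} {t : Sing m X} (h : F c t ≠ 0) :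
    ∃ s, c s ≠ 0 ∧ F (Finsupp.single s 1) t ≠ 0 ∧ Set.range t ⊆ Set.range s := by
  have h1 : F c t = ∑ s ∈ c.support, c s * F (Finsupp.single s 1) t := by
    conv_lhs => rw [← Finsupp.sum_single c]
    rw [Finsupp.sum, map_sum, Finsupp.finsetSum_apply]
    refine Finset.sum_congr rfl fun s _ => ?_
    rw [← smul_eq_mul, ← Finsupp.smul_apply, ← map_smul, Finsupp.smul_single_one]
  rw [h1] at h
  obtain ⟨s, -, hs⟩ := Finset.exists_ne_zero_of_sum_ne_zero h
  exact ⟨s, left_ne_zero_of_mul hs, right_ne_zero_of_mul hs, hF s t (right_ne_zero_of_mul hs)⟩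

/-- The value of a carried map at `t` depends only on the coefficients of the simplices whose
images contain the image of `t`. -/
theorem Carried.apply_congr {F : (Sing n X →₀ ℝ) →ₗ[ℝ] (Sing m X →₀ ℝ)} (hF : Carried F)
    {c c' : Sing n X →₀ ℝ} {t : Sing m X} (h : ∀ s : Sing n X, Set.range t ⊆ Set.range s → c s = c' s) :
    F c t = F c' t := by
  by_contra hne
  have : F (c - c') t ≠ 0 := by
    rw [map_sub, Finsupp.sub_apply]
    exact sub_ne_zero.2 hne
  obtain ⟨s, hs, -, hst⟩ := hF.exists_of_apply_ne_zero this
  exact hs (by rw [Finsupp.sub_apply, h s hst, sub_self])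

theorem carried_finBdry : Carried (finBdry X n) := fun s t h => by
  rw [finBdry_apply] at h
  obtain ⟨s', hs⟩ := exists_ne_zero_of_finsum h
  have : s = s' := by
    by_contra hne
    exact right_ne_zero_of_mul hs (Finsupp.single_eq_of_ne (Ne.symm hne))
  subst this
  exact range_subset_of_singInc (left_ne_zero_of_mul hs)

theorem Carried.comp {G : (Sing m X →₀ ℝ) →ₗ[ℝ] (Sing k X →₀ ℝ)}
    {F : (Sing n X →₀ ℝ) →ₗ[ℝ] (Sing m X →₀ ℝ)} (hG : Carried G) (hF : Carried F) :
    Carried (G.comp F) := fun s t h => by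
  obtain ⟨u, hu, -, htu⟩ := hG.exists_of_apply_ne_zero h
  exact htu.trans (hF s u hu)

/-- The restriction of a compactly finite chain to the simplices meeting a compact set. -/
def cfRestrict (c : CfChain n X) {Z : Set X} (hZ : IsCompact Z) : Sing n X →₀ ℝ :=
  open Classical in
  Finsupp.onFinset (c.2 Z hZ).toFinset
    (fun s => if (Set.range s ∩ Z).Nonempty then c.1 s else 0) fun s hs => by
      by_cases h : (Set.range s ∩ Z).Nonempty
      · simpa [h] using hs
      · simp [h] at hs

theorem cfRestrict_apply (c : CfChain n X) {Z : Set X} (hZ : IsCompact Z) {s : Sing n X}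
    (hs : (Set.range s ∩ Z).Nonempty) : cfRestrict c hZ s = c.1 s := by
  simp [cfRestrict, hs]

theorem cfRestrict_eq_zero (c : CfChain n X) {Z : Set X} (hZ : IsCompact Z) {s : Sing n X}
    (hs : ¬ (Set.range s ∩ Z).Nonempty) : cfRestrict c hZ s = 0 := by
  simp [cfRestrict, hs]

theorem cfRestrict_add (a b : CfChain n X) {Z : Set X} (hZ : IsCompact Z) :
    cfRestrict (a + b) hZ = cfRestrict a hZ + cfRestrict b hZ := by
  ext s
  by_cases h : (Set.range s ∩ Z).Nonempty <;>
  simp [cfRestrict_apply, cfRestrict_eq_zero, h]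

theorem cfRestrict_smul (r : ℝ) (a : CfChain n X) {Z : Set X} (hZ : IsCompact Z) :
    cfRestrict (r • a) hZ = r • cfRestrict a hZ := by
  ext s
  by_cases h : (Set.range s ∩ Z).Nonempty <;>
  simp [cfRestrict_apply, cfRestrict_eq_zero, h]

theorem isCompact_range_sing (s : Sing n X) : IsCompact (Set.range s) :=
  isCompact_range s.continuous

/-- The restrictions to a compact set meeting `t` compute the value of a carried map at `t`. -/
theorem Carried.apply_cfRestrict {F : (Sing n X →₀ ℝ) →ₗ[ℝ] (Sing m X →₀ ℝ)} (hF : Carried F)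
    (c : CfChain n X) {t : Sing m X} {Z : Set X} (hZ : IsCompact Z)
    (h : (Set.range t ∩ Z).Nonempty) :
    F (cfRestrict c (isCompact_range_sing t)) t = F (cfRestrict c hZ) t :=
  hF.apply_congr fun s hs => by
    rw [cfRestrict_apply c hZ (h.mono (Set.inter_subset_inter_left _ hs)), cfRestrict_apply]
    rw [Set.inter_eq_right.2 hs]
    exact range_nonempty t

/-- The extension of a carried map to compactly finite chains. -/
def cfExt (F : (Sing n X →₀ ℝ) →ₗ[ℝ] (Sing m X →₀ ℝ)) (hF : Carried F) :
    CfChain n X →ₗ[ℝ] CfChain m X where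
  toFun c := ⟨fun t => F (cfRestrict c (isCompact_range_sing t)) t, fun Z hZ => by
    refine (F (cfRestrict c hZ)).support.finite_toSet.subset ?_
    rintro t ⟨ht, htZ⟩
    beta_reduce at ht
    rw [hF.apply_cfRestrict c hZ htZ] at ht
    simpa using ht⟩
  map_add' a b := by
    ext t
    simp [cfRestrict_add]
  map_smul' r a := by
    ext t
    simp [cfRestrict_smul]

theorem cfExt_apply {F : (Sing n X →₀ ℝ) →ₗ[ℝ] (Sing m X →₀ ℝ)} (hF : Carried F)
    (c : CfChain n X) {t : Sing m X} {Z : Set X} (hZ : IsCompact Z)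
    (h : (Set.range t ∩ Z).Nonempty) : (cfExt F hF c).1 t = F (cfRestrict c hZ) t :=
  hF.apply_cfRestrict c hZ h

theorem range_inter_range_nonempty (t : Sing m X) : (Set.range t ∩ Set.range t).Nonempty := by
  rw [Set.inter_self]
  exact range_nonempty t

/-- The coefficient at `u` depends only on simplices whose images contain that of `u`, so the chain
may be cut down to the finitely many simplices meeting this image. Compatibility with composition
transports identities between operators on finite chains, such as `∂∂ = 0` and the subdivision
homotopy, to compactly finite chains. -/
theorem cfExt_comp {G : (Sing m X →₀ ℝ) →ₗ[ℝ] (Sing k X →₀ ℝ)}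
    {F : (Sing n X →₀ ℝ) →ₗ[ℝ] (Sing m X →₀ ℝ)} (hG : Carried G) (hF : Carried F)
    (c : CfChain n X) : cfExt (G.comp F) (hG.comp hF) c = cfExt G hG (cfExt F hF c) := by
  ext u
  have hu := range_inter_range_nonempty u
  rw [cfExt_apply _ _ (isCompact_range_sing u) hu, cfExt_apply _ _ (isCompact_range_sing u) hu]
  refine hG.apply_congr fun t ht => ?_
  have ht' : (Set.range t ∩ Set.range u).Nonempty :=
    hu.mono (Set.inter_subset_inter_left _ ht)
  rw [cfRestrict_apply _ _ ht', cfExt_apply hF c (isCompact_range_sing u) ht']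

theorem cfExt_finBdry (c : CfChain (n + 1) X) :
    cfExt (finBdry X n) carried_finBdry c = cfBdry X n c := by
  ext t
  change finBdry X n _ t = ∑ᶠ s, singInc s t * c.1 s
  rw [finBdry_apply]
  refine finsum_congr fun s => ?_
  by_cases h : singInc s t = 0
  · simp [h]
  · rw [cfRestrict_apply]
    exact (range_inter_range_nonempty t).mono
      (Set.inter_subset_inter_left _ (range_subset_of_singInc h))

theorem cfBdry_cfBdry (c : CfChain (n + 2) X) : cfBdry X n (cfBdry X (n + 1) c) = 0 := by
  rw [← cfExt_finBdry, ← cfExt_finBdry, ← cfExt_comp]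
  ext t
  exact DFunLike.congr_fun (finBdry_finBdry _) t

end Carried

/-! ## Representatives of homology and cohomology classes -/

section Representatives

variable {C : ℕ → Type*} [∀ n, AddCommGroup (C n)] [∀ n, Module ℝ (C n)]

theorem subsingleton_cohomology_iff (d : ∀ n, C n →ₗ[ℝ] C (n + 1)) (n : ℕ) :
    Subsingleton (Cohomology d (n + 1)) ↔ ∀ x, d (n + 1) x = 0 → ∃ y, d n y = x := by
  rw [Submodule.Quotient.subsingleton_iff, eq_top_iff]
  exact ⟨fun h x hx => h (show (⟨x, hx⟩ : LinearMap.ker (d (n + 1))) ∈ ⊤ from trivial),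
    fun h x _ => h x.1 x.2⟩

/-- The cohomology in degree `0` is the space of cocycles. -/
def cohomologyZeroEquiv (d : ∀ n, C n →ₗ[ℝ] C (n + 1)) :
    Cohomology d 0 ≃ₗ[ℝ] LinearMap.ker (d 0) :=
  Submodule.quotEquivOfEqBot _ (Submodule.ker_subtype _)

theorem exists_homology_mk_eq {d : ∀ n, C (n + 1) →ₗ[ℝ] C n} {n : ℕ} (h : Homology d n) :
    ∃ x : cycles d n, (Submodule.Quotient.mk x : Homology d n) = h :=
  Submodule.Quotient.mk_surjective _ h

theorem homology_mk_eq_iff {d : ∀ n, C (n + 1) →ₗ[ℝ] C n} {n : ℕ} (x y : cycles d n) :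
    (Submodule.Quotient.mk x : Homology d n) = Submodule.Quotient.mk y ↔
      ∃ w, d n w = x.1 - y.1 := by
  rw [Submodule.Quotient.eq]
  rfl

theorem homology_mk_eq_zero_iff {d : ∀ n, C (n + 1) →ₗ[ℝ] C n} {n : ℕ} (x : cycles d n) :
    (Submodule.Quotient.mk x : Homology d n) = 0 ↔ ∃ w, d n w = x.1 := by
  rw [Submodule.Quotient.mk_eq_zero]
  rfl

theorem boundary_mem_cycles {d : ∀ n, C (n + 1) →ₗ[ℝ] C n}
    (hd : ∀ n x, d n (d (n + 1) x) = 0) : ∀ (n : ℕ) (x : C (n + 1)), d n x ∈ cycles d n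
  | 0, _ => Submodule.mem_top
  | n + 1, x => hd n x

theorem sub_boundary_mem_cycles {d : ∀ n, C (n + 1) →ₗ[ℝ] C n}
    (hd : ∀ n x, d n (d (n + 1) x) = 0) {n : ℕ} {x : C n} (hx : x ∈ cycles d n) (w : C (n + 1)) :
    x - d n w ∈ cycles d n :=
  Submodule.sub_mem _ hx (boundary_mem_cycles hd n w)

variable {C' : ℕ → Type*} [∀ n, AddCommGroup (C' n)] [∀ n, Module ℝ (C' n)]

theorem homologyMap_mk_eq_mk_iff {d : ∀ n, C (n + 1) →ₗ[ℝ] C n}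
    {d' : ∀ n, C' (n + 1) →ₗ[ℝ] C' n} (f : ∀ n, C n →ₗ[ℝ] C' n)
    (hf : ∀ n x, f n (d n x) = d' n (f (n + 1) x)) {n : ℕ} (x : cycles d n) (y : cycles d' n) :
    homologyMap f hf n (Submodule.Quotient.mk x) = Submodule.Quotient.mk y ↔
      ∃ w, d' n w = f n x.1 - y.1 :=
  homology_mk_eq_iff ⟨f n x.1, map_mem_cycles f hf n x.1 x.2⟩ y

theorem homologyMap_mk_eq_zero_iff {d : ∀ n, C (n + 1) →ₗ[ℝ] C n}
    {d' : ∀ n, C' (n + 1) →ₗ[ℝ] C' n} (f : ∀ n, C n →ₗ[ℝ] C' n)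
    (hf : ∀ n x, f n (d n x) = d' n (f (n + 1) x)) {n : ℕ} (x : cycles d n) :
    homologyMap f hf n (Submodule.Quotient.mk x) = 0 ↔ ∃ w, d' n w = f n x.1 :=
  homology_mk_eq_zero_iff ⟨f n x.1, map_mem_cycles f hf n x.1 x.2⟩

theorem homologyMap_bijective {d : ∀ n, C (n + 1) →ₗ[ℝ] C n}
    {d' : ∀ n, C' (n + 1) →ₗ[ℝ] C' n} (f : ∀ n, C n →ₗ[ℝ] C' n)
    (hf : ∀ n x, f n (d n x) = d' n (f (n + 1) x)) {n : ℕ}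
    (hinj : ∀ x ∈ cycles d n, ∀ c, d' n c = f n x → ∃ w, d n w = x)
    (hsurj : ∀ c ∈ cycles d' n, ∃ x ∈ cycles d n, ∃ w, d' n w = f n x - c) :
    Function.Bijective (homologyMap f hf n) := by
  constructor
  · rw [injective_iff_map_eq_zero]
    intro a ha
    obtain ⟨x, rfl⟩ := exists_homology_mk_eq a
    obtain ⟨c, hc⟩ := (homologyMap_mk_eq_zero_iff f hf x).1 ha
    exact (homology_mk_eq_zero_iff x).2 (hinj x.1 x.2 c hc)
  · intro h
    obtain ⟨c, rfl⟩ := exists_homology_mk_eq h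
    obtain ⟨x, hx, hw⟩ := hsurj c.1 c.2
    exact ⟨Submodule.Quotient.mk ⟨x, hx⟩, (homologyMap_mk_eq_mk_iff f hf ⟨x, hx⟩ c).2 hw⟩

variable {C'' : ℕ → Type*} [∀ n, AddCommGroup (C'' n)] [∀ n, Module ℝ (C'' n)]

/-- Representatives of the classes in the kernel of `g_* ∘ f_*⁻¹`. -/
theorem exists_cycle_of_linearInverse_eq_zero {d : ∀ n, C (n + 1) →ₗ[ℝ] C n}
    {d' : ∀ n, C' (n + 1) →ₗ[ℝ] C' n} {d'' : ∀ n, C'' (n + 1) →ₗ[ℝ] C'' n}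
    (f : ∀ n, C n →ₗ[ℝ] C' n) (hf : ∀ n x, f n (d n x) = d' n (f (n + 1) x))
    (g : ∀ n, C n →ₗ[ℝ] C'' n) (hg : ∀ n x, g n (d n x) = d'' n (g (n + 1) x)) {n : ℕ}
    (hbij : Function.Bijective (homologyMap f hf n)) {h : Homology d' n}
    (h0 : homologyMap g hg n (linearInverse (homologyMap f hf n) h) = 0) :
    ∃ x : cycles d n, (∃ y, d'' n y = g n x.1) ∧
      ∀ z : cycles d' n, (∃ w, d' n w = f n x.1 - z.1) → Submodule.Quotient.mk z = h := by
  have hinv : linearInverse (homologyMap f hf n)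
      = (LinearEquiv.ofBijective _ hbij).symm.toLinearMap := dif_pos hbij
  obtain ⟨a, rfl⟩ := hbij.2 h
  rw [hinv] at h0
  have h1 : homologyMap g hg n a = 0 :=
    (congrArg _ ((LinearEquiv.ofBijective _ hbij).symm_apply_apply a)).symm.trans h0
  obtain ⟨x, rfl⟩ := exists_homology_mk_eq a
  exact ⟨x, (homologyMap_mk_eq_zero_iff g hg x).1 h1,
    fun z hz => ((homologyMap_mk_eq_mk_iff f hf x z).2 hz).symm⟩

end Representatives

/-! ## The `l₁`-norm of finite chains -/

section FinNorm

variable {α β : Type*}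

/-- The `l₁`-norm of a finite chain. -/
def finNorm (c : α →₀ ℝ) : ℝ := ∑ a ∈ c.support, |c a|

theorem finNorm_eq_sum {c : α →₀ ℝ} {S : Finset α} (h : c.support ⊆ S) :
    finNorm c = ∑ a ∈ S, |c a| :=
  Finset.sum_subset h fun a _ ha => by simp [Finsupp.notMem_support_iff.1 ha]

theorem finNorm_nonneg (c : α →₀ ℝ) : 0 ≤ finNorm c :=
  Finset.sum_nonneg fun _ _ => abs_nonneg _

@[simp]
theorem finNorm_zero : finNorm (0 : α →₀ ℝ) = 0 := by simp [finNorm]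

theorem finNorm_add_le (c c' : α →₀ ℝ) : finNorm (c + c') ≤ finNorm c + finNorm c' := by
  classical
  rw [finNorm_eq_sum (S := c.support ∪ c'.support) Finsupp.support_add,
    finNorm_eq_sum (S := c.support ∪ c'.support) Finset.subset_union_left,
    finNorm_eq_sum (c := c') (S := c.support ∪ c'.support) Finset.subset_union_right,
    ← Finset.sum_add_distrib]
  exact Finset.sum_le_sum fun a _ => abs_add_le _ _

theorem finNorm_smul (r : ℝ) (c : α →₀ ℝ) : finNorm (r • c) = |r| * finNorm c := by
  rw [finNorm_eq_sum (S := c.support) Finsupp.support_smul, finNorm, Finset.mul_sum]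
  exact Finset.sum_congr rfl fun a _ => by simp [abs_mul]

theorem finNorm_neg (c : α →₀ ℝ) : finNorm (-c) = finNorm c := by
  simpa using finNorm_smul (-1) c

theorem finNorm_single (a : α) (r : ℝ) : finNorm (Finsupp.single a r) = |r| := by
  classical
  rw [finNorm_eq_sum (S := {a}) Finsupp.support_single_subset]
  simp

theorem finNorm_sum_le (S : Finset β) (c : β → α →₀ ℝ) :
    finNorm (∑ b ∈ S, c b) ≤ ∑ b ∈ S, finNorm (c b) := by
  classical
  induction S using Finset.induction_on with
  | empty => simp
  | insert b S hb ih =>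
    rw [Finset.sum_insert hb, Finset.sum_insert hb]
    exact (finNorm_add_le _ _).trans (by gcongr)

theorem finNorm_mapDomain {f : α → β} (hf : Function.Injective f) (c : α →₀ ℝ) :
    finNorm (c.mapDomain f) = finNorm c := by
  classical
  rw [finNorm, Finsupp.mapDomain_support_of_injective hf, Finset.sum_image hf.injOn, finNorm]
  exact Finset.sum_congr rfl fun a _ => by rw [Finsupp.mapDomain_apply hf]

theorem abs_linearCombination_le {f : α → ℝ} {K : ℝ} (hf : ∀ a, |f a| ≤ K) (c : α →₀ ℝ) :
    |Finsupp.linearCombination ℝ f c| ≤ K * finNorm c := by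
  rw [Finsupp.linearCombination_apply, Finsupp.sum, finNorm, Finset.mul_sum]
  refine (Finset.abs_sum_le_sum_abs _ _).trans (Finset.sum_le_sum fun a _ => ?_)
  rw [smul_eq_mul, abs_mul, mul_comm]
  exact mul_le_mul_of_nonneg_right (hf a) (abs_nonneg _)

/-- The distance from a finite chain to the image of a linear map. -/
def distRange {W : Type*} [AddCommGroup W] [Module ℝ W] (d : W →ₗ[ℝ] (α →₀ ℝ)) (c : α →₀ ℝ) : ℝ :=
  ⨅ w, finNorm (c - d w)

section DistRange

variable {W : Type*} [AddCommGroup W] [Module ℝ W] (d : W →ₗ[ℝ] (α →₀ ℝ))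

theorem distRange_le (c : α →₀ ℝ) (w : W) : distRange d c ≤ finNorm (c - d w) :=
  ciInf_le ⟨0, by rintro _ ⟨w, rfl⟩; exact finNorm_nonneg _⟩ w

theorem distRange_nonneg (c : α →₀ ℝ) : 0 ≤ distRange d c :=
  le_ciInf fun _ => finNorm_nonneg _

theorem exists_finNorm_lt {c : α →₀ ℝ} {r : ℝ} (h : distRange d c < r) :
    ∃ w, finNorm (c - d w) < r := exists_lt_of_ciInf_lt h

theorem distRange_add_le (a b : α →₀ ℝ) : distRange d (a + b) ≤ distRange d a + distRange d b := by
  refine le_of_forall_pos_le_add fun η hη => ?_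
  obtain ⟨v, hv⟩ := exists_finNorm_lt d (lt_add_of_pos_right (distRange d a) (half_pos hη))
  obtain ⟨w, hw⟩ := exists_finNorm_lt d (lt_add_of_pos_right (distRange d b) (half_pos hη))
  have h1 := distRange_le d (a + b) (v + w)
  have h2 := finNorm_add_le (a - d v) (b - d w)
  rw [show a - d v + (b - d w) = a + b - d (v + w) by rw [map_add]; abel] at h2
  linarith

/-- Rescaling an approximant gives one inequality, and the same inequality for `r⁻¹` gives the
other. With subadditivity this makes the distance sublinear, as Hahn–Banach requires. -/
theorem distRange_smul {r : ℝ} (hr : r ≠ 0) (a : α →₀ ℝ) :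
    distRange d (r • a) = |r| * distRange d a := by
  have key : ∀ (r : ℝ) (a : α →₀ ℝ), r ≠ 0 → |r| * distRange d a ≤ distRange d (r • a) := by
    intro r a hr
    refine le_ciInf fun w => ?_
    have h := distRange_le d a (r⁻¹ • w)
    have h2 : finNorm (r • a - d w) = |r| * finNorm (a - d (r⁻¹ • w)) := by
      rw [← finNorm_smul, smul_sub, map_smul, smul_inv_smul₀ hr]
    rw [h2]
    exact mul_le_mul_of_nonneg_left h (abs_nonneg r)
  refine le_antisymm ?_ (key r a hr)
  have h := key r⁻¹ (r • a) (inv_ne_zero hr)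
  rwa [inv_smul_smul₀ hr, abs_inv, inv_mul_le_iff₀ (abs_pos.2 hr)] at h

/-- The distance to the image of a linear map is attained by a bounded functional vanishing on
this image. -/
theorem exists_functional (c : α →₀ ℝ) :
    ∃ f : α → ℝ, (∀ a, |f a| ≤ 1) ∧ (∀ w, Finsupp.linearCombination ℝ f (d w) = 0) ∧
      distRange d c ≤ Finsupp.linearCombination ℝ f c := by
  have h0 : distRange d 0 = 0 :=
    le_antisymm (by simpa using distRange_le d 0 0) (distRange_nonneg d 0)
  by_cases hc : c = 0
  · exact ⟨0, by simp, by simp, by simp [hc, h0]⟩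
  -- Hahn–Banach extends `r • c ↦ r * distRange d c` from the line spanned by `c`, keeping it
  -- dominated by the distance.
  obtain ⟨g, hg1, hg2⟩ := exists_extension_of_le_sublinear
    (LinearPMap.mkSpanSingleton (K := ℝ) c (distRange d c) hc) (distRange d)
    (fun r hr x => by rw [distRange_smul d hr.ne', abs_of_pos hr]) (distRange_add_le d) (by
      rintro ⟨x, hx⟩
      obtain ⟨r, rfl⟩ := Submodule.mem_span_singleton.1 hx
      rw [LinearPMap.mkSpanSingleton'_apply, smul_eq_mul, RingHom.id_apply]
      rcases eq_or_ne r 0 with rfl | hr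
      · simp [h0]
      · rw [distRange_smul d hr]
        exact mul_le_mul_of_nonneg_right (le_abs_self r) (distRange_nonneg d c))
  have hN : ∀ x, distRange d x ≤ finNorm x := fun x => by simpa using distRange_le d x 0
  have hlc : Finsupp.linearCombination ℝ (fun a => g (Finsupp.single a 1)) = g := by
    ext a
    simp
  -- The distance is even, so the domination is two-sided. It yields both the sup bound, as the
  -- distance is at most the norm, and the vanishing on the image, where the distance is zero.
  have habs : ∀ x, |g x| ≤ distRange d x := fun x => by
    refine abs_le.2 ⟨?_, hg2 x⟩
    have h1 := hg2 (-x)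
    have h2 := distRange_smul d (show (-1 : ℝ) ≠ 0 by norm_num) x
    rw [neg_one_smul, abs_neg, abs_one, one_mul] at h2
    rw [map_neg, h2] at h1
    linarith
  refine ⟨fun a => g (Finsupp.single a 1), fun a => ?_, fun w => ?_, ?_⟩
  · exact (habs _).trans ((hN _).trans (by simp [finNorm_single]))
  · rw [hlc]
    refine abs_nonpos_iff.1 ((habs _).trans ?_)
    simpa using distRange_le d (d w) w
  · rw [hlc]
    have h1 := hg1 ⟨c, Submodule.mem_span_singleton_self c⟩
    rw [h1]
    exact (LinearPMap.mkSpanSingleton_apply ℝ ℝ (σ := RingHom.id ℝ) hc (distRange d c)).ge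

end DistRange

end FinNorm

/-! ## Acyclic spaces and the distance of chains to boundaries -/

section Acyclic

variable {Y : Type*} [TopologicalSpace Y]

/-- The boundary and the coboundary are adjoint under the pairing of bounded cochains with finite
chains. -/
theorem linearCombination_finBdry {n : ℕ} (f : BddCochain Y n) (c : Sing (n + 1) Y →₀ ℝ) :
    Finsupp.linearCombination ℝ f.1 (finBdry Y n c)
      = Finsupp.linearCombination ℝ (bddCobdry Y n f).1 c := by
  suffices h : (Finsupp.linearCombination ℝ f.1).comp (finBdry Y n)
      = Finsupp.linearCombination ℝ (bddCobdry Y n f).1 from LinearMap.congr_fun h c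
  refine Finsupp.lhom_ext fun s r => ?_
  simp only [LinearMap.comp_apply, finBdry_single, map_sum, map_smul,
    Finsupp.linearCombination_single, smul_eq_mul]
  change _ = r * ∑ i : Fin (n + 2), (-1 : ℝ) ^ (i : ℕ) * f.1 (face i s)
  rw [Finset.mul_sum]
  exact Finset.sum_congr rfl fun i _ => by ring

theorem sum_neg_one_pow_fin (n : ℕ) :
    ∑ i : Fin n, (-1 : ℝ) ^ (i : ℕ) = if Even n then 0 else 1 := by
  rw [Fin.sum_univ_eq_sum_range (fun i => (-1 : ℝ) ^ i), neg_one_geom_sum]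

theorem bddCobdry_unit_apply {n : ℕ} (f : BddCochain Unit n) (s : Sing (n + 1) Unit)
    (t : Sing n Unit) :
    (bddCobdry Unit n f).1 s = (if Even n then 0 else 1) * f.1 t := by
  change ∑ i : Fin (n + 2), (-1 : ℝ) ^ (i : ℕ) * f.1 (face i s) = _
  have h : ∀ i, face i s = t := fun i => Subsingleton.elim _ _
  simp only [h]
  rw [← Finset.sum_mul, sum_neg_one_pow_fin]
  simp [Nat.even_add]

/-- The constant bounded cochain. -/
def constCochain (Y : Type*) [TopologicalSpace Y] (n : ℕ) (r : ℝ) : BddCochain Y n :=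
  ⟨fun _ => r, |r|, fun _ => le_rfl⟩

theorem bddCochain_unit_ext {n : ℕ} {f g : BddCochain Unit n} (t : Sing n Unit)
    (h : f.1 t = g.1 t) : f = g := by
  ext s
  rw [Subsingleton.elim s t, h]

/-- On a point the cochain spaces are lines and the coboundary out of degree `n` is zero for even
`n` and the identity for odd `n`. -/
theorem subsingleton_bddCohomology_unit (n : ℕ) :
    Subsingleton (BddCohomology Unit (n + 1)) := by
  refine (subsingleton_cohomology_iff (bddCobdry Unit) n).2 fun f hf => ?_
  let t : Sing (n + 1) Unit := ⟨fun _ => (), continuous_const⟩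
  let u : Sing (n + 2) Unit := ⟨fun _ => (), continuous_const⟩
  let v : Sing n Unit := ⟨fun _ => (), continuous_const⟩
  have h1 := bddCobdry_unit_apply f u t
  rw [show bddCobdry Unit (n + 1) f = 0 from hf] at h1
  by_cases hn : Even n
  · refine ⟨0, bddCochain_unit_ext t ?_⟩
    rw [if_neg (by simpa [Nat.even_add_one] using hn), one_mul] at h1
    rw [map_zero]
    exact h1
  · refine ⟨constCochain Unit n (f.1 t), bddCochain_unit_ext t ?_⟩
    rw [bddCobdry_unit_apply _ t v, if_neg hn, one_mul]
    rfl

theorem finrank_bddCohomology_unit : Module.finrank ℝ (BddCohomology Unit 0) = 1 := by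
  let t : Sing 0 Unit := ⟨fun _ => (), continuous_const⟩
  let u : Sing 1 Unit := ⟨fun _ => (), continuous_const⟩
  have hk : LinearMap.ker (bddCobdry Unit 0) = ⊤ := by
    rw [eq_top_iff]
    rintro f -
    refine bddCochain_unit_ext u ?_
    rw [bddCobdry_unit_apply _ u t, if_pos Even.zero, zero_mul]
    rfl
  let e1 := cohomologyZeroEquiv (bddCobdry Unit)
  let e2 : LinearMap.ker (bddCobdry Unit 0) ≃ₗ[ℝ] BddCochain Unit 0 :=
    (LinearEquiv.ofEq _ _ hk).trans Submodule.topEquiv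
  let e3 : BddCochain Unit 0 ≃ₗ[ℝ] ℝ :=
    { toFun := fun f => f.1 t
      map_add' := fun _ _ => rfl
      map_smul' := fun _ _ => rfl
      invFun := constCochain Unit 0
      left_inv := fun f => bddCochain_unit_ext t rfl
      right_inv := fun r => rfl }
  rw [(e1.trans (e2.trans e3)).finrank_eq, Module.finrank_self]

theorem IsL1Acyclic.exists_primitive (hY : IsL1Acyclic Y) {n : ℕ} (f : BddCochain Y (n + 1))
    (hf : bddCobdry Y (n + 1) f = 0) : ∃ g, bddCobdry Y n g = f := by
  obtain ⟨e⟩ := hY (n + 1)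
  have := subsingleton_bddCohomology_unit n
  have h : Subsingleton (BddCohomology Y (n + 1)) := e.toEquiv.subsingleton
  exact (subsingleton_cohomology_iff (bddCobdry Y) n).1 h f hf

/-- The isomorphism with the cohomology of a point is abstract, so only a dimension can be read off
from it: degree zero cocycles form a line. The constant `1` is a non-zero element of this line,
because the space is non-empty. -/
theorem IsL1Acyclic.exists_eq_const (hY : IsL1Acyclic Y) [Nonempty Y] (f : BddCochain Y 0)
    (hf : bddCobdry Y 0 f = 0) : ∃ r, ∀ s, f.1 s = r := by
  obtain ⟨e⟩ := hY 0
  have h1 := ((cohomologyZeroEquiv (bddCobdry Y)).symm.trans e).finrank_eq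
  rw [finrank_bddCohomology_unit] at h1
  have hc : bddCobdry Y 0 (constCochain Y 0 1) = 0 := by
    ext s
    change ∑ i : Fin 2, (-1 : ℝ) ^ (i : ℕ) * 1 = 0
    simp [Fin.sum_univ_two]
  let y : Sing 0 Y := ⟨fun _ => Classical.arbitrary Y, continuous_const⟩
  have hne : (⟨constCochain Y 0 1, hc⟩ : LinearMap.ker (bddCobdry Y 0)) ≠ 0 := fun h => by
    have := congrArg (fun f : LinearMap.ker (bddCobdry Y 0) => f.1.1 y) h
    exact one_ne_zero this
  obtain ⟨r, hr⟩ := (finrank_eq_one_iff_of_nonzero' (V := LinearMap.ker (bddCobdry Y 0)) _ hne).1 h1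
    ⟨f, hf⟩
  refine ⟨r, fun s => ?_⟩
  have := congrArg (fun f : LinearMap.ker (bddCobdry Y 0) => f.1.1 s) hr
  change r * 1 = f.1 s at this
  rw [← this, mul_one]

/-! ### Primitives with norm control, by the open mapping theorem -/

/-- Bounded functions as elements of a Banach space. -/
abbrev BddFun (Y : Type*) [TopologicalSpace Y] (n : ℕ) : Type _ :=
  lp (fun _ : Sing n Y => ℝ) ⊤

/-- Elements of `BddFun` are bounded cochains. -/
def BddFun.toCochain {n : ℕ} (f : BddFun Y n) : BddCochain Y n :=
  ⟨fun s => f s, ‖f‖, fun s => lp.norm_apply_le_norm ENNReal.top_ne_zero f s⟩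

/-- Bounded cochains as elements of `BddFun`. -/
def bddFunOf {n : ℕ} (f : BddCochain Y n) : BddFun Y n :=
  ⟨f.1, memℓp_infty_iff.2 (by
    obtain ⟨K, hK⟩ := f.2
    exact ⟨K, by rintro _ ⟨s, rfl⟩; exact hK s⟩)⟩

theorem abs_bddCobdry_le {n : ℕ} {f : BddCochain Y n} {K : ℝ} (hf : ∀ s, |f.1 s| ≤ K)
    (s : Sing (n + 1) Y) : |(bddCobdry Y n f).1 s| ≤ (n + 2 : ℕ) * K := by
  change |∑ i : Fin (n + 2), (-1 : ℝ) ^ (i : ℕ) * f.1 (face i s)| ≤ _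
  refine (Finset.abs_sum_le_sum_abs _ _).trans ?_
  refine (Finset.sum_le_sum (g := fun _ => K) fun i _ => ?_).trans (by simp)
  rw [abs_mul, abs_pow, abs_neg, abs_one, one_pow, one_mul]
  exact hf _

/-- The coboundary as a continuous map of Banach spaces. -/
def bddFunD (Y : Type*) [TopologicalSpace Y] (n : ℕ) : BddFun Y n →L[ℝ] BddFun Y (n + 1) :=
  LinearMap.mkContinuous
    { toFun := fun f => bddFunOf (bddCobdry Y n f.toCochain)
      map_add' := fun f g => congrArg bddFunOf (map_add (bddCobdry Y n) f.toCochain g.toCochain)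
      map_smul' := fun r f => congrArg bddFunOf (map_smul (bddCobdry Y n) r f.toCochain) }
    (n + 2 : ℕ) fun f => lp.norm_le_of_forall_le (by positivity) fun s =>
      abs_bddCobdry_le (fun s => lp.norm_apply_le_norm ENNReal.top_ne_zero f s) s

theorem bddCobdry_bddCobdry {n : ℕ} (f : BddCochain Y n) :
    bddCobdry Y (n + 1) (bddCobdry Y n f) = 0 := by
  ext s
  have h := linearCombination_finBdry (bddCobdry Y n f) (Finsupp.single s 1)
  rw [← linearCombination_finBdry] at h
  simp only [finBdry_finBdry, map_zero, Finsupp.linearCombination_single, one_smul] at h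
  exact h.symm

/-- Bounded cocycles of acyclic spaces have primitives whose norms are controlled. -/
theorem IsL1Acyclic.exists_bounded_primitive (hY : IsL1Acyclic Y) (n : ℕ) :
    ∃ K > 0, ∀ f : BddCochain Y (n + 1), bddCobdry Y (n + 1) f = 0 → (∀ s, |f.1 s| ≤ 1) →
      ∃ g, bddCobdry Y n g = f ∧ ∀ s, |g.1 s| ≤ K := by
  have hmem : ∀ f, bddFunD Y n f ∈ LinearMap.ker (bddFunD Y (n + 1)).toLinearMap := fun f => by
    change bddFunOf (bddCobdry Y (n + 1) (bddCobdry Y n f.toCochain)) = 0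
    rw [bddCobdry_bddCobdry]
    rfl
  -- The open mapping theorem needs a Banach space as target. The coboundary is therefore
  -- corestricted to the closed subspace of cocycles, onto which it is surjective by acyclicity.
  have : CompleteSpace (LinearMap.ker (bddFunD Y (n + 1)).toLinearMap) :=
    (bddFunD Y (n + 1)).isClosed_ker.completeSpace_coe
  let D := (bddFunD Y n).codRestrict _ hmem
  obtain ⟨C, hC, h⟩ := D.exists_preimage_norm_le (by
    rintro ⟨f, hf⟩
    obtain ⟨g, hg⟩ := hY.exists_primitive f.toCochain
      (congrArg BddFun.toCochain (show bddFunD Y (n + 1) f = 0 from hf))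
    refine ⟨bddFunOf g, Subtype.ext ?_⟩
    change bddFunOf (bddCobdry Y n g) = f
    rw [hg]
    rfl)
  refine ⟨C, hC, fun f hf h1 => ?_⟩
  obtain ⟨g, hg, hn⟩ := h ⟨bddFunOf f, by
    change bddFunOf (bddCobdry Y (n + 1) f) = 0
    rw [hf]
    rfl⟩
  refine ⟨g.toCochain, congrArg BddFun.toCochain (congrArg Subtype.val hg), fun s => ?_⟩
  refine (lp.norm_apply_le_norm ENNReal.top_ne_zero g s).trans (hn.trans ?_)
  have : ‖bddFunOf f‖ ≤ 1 := lp.norm_le_of_forall_le zero_le_one h1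
  exact mul_le_of_le_one_right hC.le this

theorem cocycle_of_forall_linearCombination {n : ℕ} (f : BddCochain Y n)
    (h : ∀ w, Finsupp.linearCombination ℝ f.1 (finBdry Y n w) = 0) : bddCobdry Y n f = 0 := by
  ext s
  have := h (Finsupp.single s 1)
  rw [linearCombination_finBdry, Finsupp.linearCombination_single, one_smul] at this
  exact this

/-- In an acyclic space, chains with small boundary are close to boundaries. -/
theorem IsL1Acyclic.exists_approx (hY : IsL1Acyclic Y) (n : ℕ) :
    ∃ K > 0, ∀ c : Sing (n + 1) Y →₀ ℝ, ∀ η > 0,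
      ∃ w, finNorm (c - finBdry Y (n + 1) w) ≤ K * finNorm (finBdry Y n c) + η := by
  obtain ⟨K, hK, h⟩ := hY.exists_bounded_primitive n
  refine ⟨K, hK, fun c η hη => ?_⟩
  -- Vanishing on boundaries means that `f` is a cocycle, so `f = dg` with `g` bounded by `K`, and
  -- the distance is at most `f c = g (∂c)`.
  obtain ⟨f, hf1, hf2, hf3⟩ := exists_functional (finBdry Y (n + 1)) c
  obtain ⟨g, hg, hgK⟩ := h ⟨f, 1, hf1⟩ (cocycle_of_forall_linearCombination _ hf2) hf1
  have h1 : Finsupp.linearCombination ℝ f c ≤ K * finNorm (finBdry Y n c) := by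
    have : f = (bddCobdry Y n g).1 := by rw [hg]
    rw [this, ← linearCombination_finBdry]
    exact (le_abs_self _).trans (abs_linearCombination_le hgK _)
  -- The distance is an infimum which need not be attained; `η` pays for an actual `w`.
  obtain ⟨w, hw⟩ := exists_finNorm_lt (finBdry Y (n + 1)) (c := c)
    (r := K * finNorm (finBdry Y n c) + η) (by linarith)
  exact ⟨w, hw.le⟩

/-- In an acyclic space, `0`-chains with zero augmentation are close to boundaries. -/
theorem IsL1Acyclic.exists_approx_zero (hY : IsL1Acyclic Y) [Nonempty Y] (c : Sing 0 Y →₀ ℝ)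
    (hc : augmentation 0 Y c = 0) {η : ℝ} (hη : 0 < η) :
    ∃ w, finNorm (c - finBdry Y 0 w) ≤ η := by
  obtain ⟨f, hf1, hf2, hf3⟩ := exists_functional (finBdry Y 0) c
  -- A constant cocycle pairs with `c` through its augmentation, hence trivially, so the distance to
  -- boundaries is zero.
  obtain ⟨r, hr⟩ := hY.exists_eq_const ⟨f, 1, hf1⟩ (cocycle_of_forall_linearCombination _ hf2)
  have h1 : Finsupp.linearCombination ℝ f c = r * augmentation 0 Y c := by
    suffices h : Finsupp.linearCombination ℝ f = r • augmentation 0 Y from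
      LinearMap.congr_fun h c
    refine Finsupp.lhom_ext fun s x => ?_
    rw [Finsupp.linearCombination_single, LinearMap.smul_apply, augmentation_single,
      show f s = r from hr s, smul_eq_mul, smul_eq_mul, mul_comm]
  rw [h1, hc, mul_zero] at hf3
  obtain ⟨w, hw⟩ := exists_finNorm_lt (finBdry Y 0) (c := c) (r := η) (by linarith)
  exact ⟨w, hw.le⟩

end Acyclic

/-! ## Simplicial chains on finite sets of vertices -/

section Cone

variable {ι : Type*} [LinearOrder ι]

/-- The sign of the vertex `j` in the simplex obtained by adding `j` to `ρ`. -/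
def vertexSign (j : ι) (ρ : Finset ι) : ℝ := (-1) ^ (ρ.filter (· < j)).card

theorem vertexSign_mul_self (j : ι) (ρ : Finset ι) : vertexSign j ρ * vertexSign j ρ = 1 := by
  rw [vertexSign, ← mul_pow]
  norm_num

theorem vertexSign_insert_self (j : ι) (ρ : Finset ι) :
    vertexSign j (insert j ρ) = vertexSign j ρ := by
  rw [vertexSign, vertexSign, Finset.filter_insert, if_neg (lt_irrefl j)]

theorem vertexSign_insert_of_lt {j k : ι} {ρ : Finset ι} (hk : k ∉ ρ) (h : k < j) :
    vertexSign j (insert k ρ) = -vertexSign j ρ := by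
  rw [vertexSign, vertexSign, Finset.filter_insert, if_pos h, Finset.card_insert_of_notMem
    (by simp [hk]), pow_succ]
  ring

theorem vertexSign_insert_of_gt {j k : ι} {ρ : Finset ι} (h : j < k) :
    vertexSign j (insert k ρ) = vertexSign j ρ := by
  rw [vertexSign, vertexSign, Finset.filter_insert, if_neg h.not_gt]

/-- The smaller of the two vertices shifts the position of the larger one by one, and not
conversely. -/
theorem vertexSign_swap {j k : ι} {ρ : Finset ι} (hj : j ∉ ρ) (hk : k ∉ ρ) (hjk : j ≠ k) :
    vertexSign j ρ * vertexSign k (insert j ρ) = -(vertexSign k ρ * vertexSign j (insert k ρ)) := by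
  rcases lt_or_gt_of_ne hjk with h | h
  · rw [vertexSign_insert_of_lt hj h, vertexSign_insert_of_gt h]
    ring
  · rw [vertexSign_insert_of_gt h, vertexSign_insert_of_lt hk h]
    ring

/-- The boundary of a function on finite sets supported by the subsets of `S`, with the value at
the empty set being the augmentation. -/
def finsetBdry (S : Finset ι) (f : Finset ι → ℝ) (ρ : Finset ι) : ℝ :=
  ∑ j ∈ S, if j ∈ ρ then 0 else vertexSign j ρ * f (insert j ρ)

/-- The cone operator with the vertex `i`. -/
def finsetCone (i : ι) (f : Finset ι → ℝ) (σ : Finset ι) : ℝ :=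
  if i ∈ σ then vertexSign i σ * f (σ.erase i) else 0

/-- The double sum runs over pairs of added vertices and is antisymmetric in them, so it equals its
own negative. -/
theorem finsetBdry_finsetBdry (S : Finset ι) (f : Finset ι → ℝ) (ρ : Finset ι) :
    finsetBdry S (finsetBdry S f) ρ = 0 := by
  let a : ι → ι → ℝ := fun j k => if j ∈ ρ then 0 else vertexSign j ρ *
    (if k ∈ insert j ρ then 0 else vertexSign k (insert j ρ) * f (insert k (insert j ρ)))
  have ha : ∀ j k, a j k = -a k j := by
    intro j k
    simp only [a, Finset.mem_insert]
    by_cases hj : j ∈ ρ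
    · simp [hj]
    by_cases hk : k ∈ ρ
    · simp [hk]
    by_cases hjk : j = k
    · simp [hjk]
    rw [if_neg hj, if_neg hk, if_neg (by simp [hk, Ne.symm hjk]), if_neg (by simp [hj, hjk]),
      ← mul_assoc, vertexSign_swap hj hk hjk, ← mul_assoc, Finset.insert_comm]
    ring
  have h1 : finsetBdry S (finsetBdry S f) ρ = ∑ j ∈ S, ∑ k ∈ S, a j k := by
    refine Finset.sum_congr rfl fun j _ => ?_
    simp only [a]
    by_cases hj : j ∈ ρ
    · simp [hj]
    · simp only [if_neg hj, finsetBdry, Finset.mul_sum]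
  have h2 : ∑ j ∈ S, ∑ k ∈ S, a j k = -∑ j ∈ S, ∑ k ∈ S, a j k := by
    conv_lhs => rw [Finset.sum_comm]
    rw [← Finset.sum_neg_distrib]
    refine Finset.sum_congr rfl fun j _ => ?_
    rw [← Finset.sum_neg_distrib]
    exact Finset.sum_congr rfl fun k _ => ha k j
  rw [h1]
  linarith

/-- The cone contracts the augmented complex of a full simplex. If `i ∉ ρ`, only adding `i`
contributes. If `i ∈ ρ`, adding `i` back to `ρ.erase i` gives `f ρ`, and the terms for the other
vertices cancel by anticommutation of the signs. -/
theorem finsetBdry_finsetCone {S : Finset ι} {i : ι} (hi : i ∈ S) (f : Finset ι → ℝ)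
    (ρ : Finset ι) :
    finsetBdry S (finsetCone i f) ρ + finsetCone i (finsetBdry S f) ρ = f ρ := by
  by_cases h : i ∈ ρ
  · obtain ⟨ρ', hi', rfl⟩ : ∃ ρ', i ∉ ρ' ∧ ρ = insert i ρ' :=
      ⟨ρ.erase i, Finset.notMem_erase i ρ, (Finset.insert_erase h).symm⟩
    rw [finsetCone, if_pos h, Finset.erase_insert hi', vertexSign_insert_self, finsetBdry,
      finsetBdry, Finset.mul_sum, ← Finset.sum_add_distrib, Finset.sum_eq_single_of_mem i hi]
    · rw [if_pos h, if_neg hi', ← mul_assoc, vertexSign_mul_self]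
      ring
    · intro j _ hj
      by_cases hjρ : j ∈ ρ'
      · simp [hjρ]
      · rw [if_neg (by simp [hj, hjρ]), if_neg hjρ, finsetCone, if_pos (by simp),
          Finset.insert_comm, vertexSign_insert_self,
          Finset.erase_insert (by simp [hi', Ne.symm hj])]
        have h1 := vertexSign_swap hjρ hi' hj
        have h2 := vertexSign_mul_self i (insert j ρ')
        have h3 := vertexSign_mul_self i ρ'
        -- Anticommutation multiplied by signs whose squares are one.
        have h4 : vertexSign j (insert i ρ') * vertexSign i (insert j ρ')
            = -(vertexSign i ρ' * vertexSign j ρ') := by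
          linear_combination (vertexSign i ρ' * vertexSign i (insert j ρ')) * h1
            - vertexSign j ρ' * vertexSign i ρ' * h2
            - vertexSign j (insert i ρ') * vertexSign i (insert j ρ') * h3
        linear_combination f (insert j ρ') * h4
  · rw [finsetCone, if_neg h, add_zero, finsetBdry, Finset.sum_eq_single_of_mem i hi]
    · rw [if_neg h, finsetCone, if_pos (Finset.mem_insert_self i ρ), Finset.erase_insert h,
        vertexSign_insert_self, ← mul_assoc, vertexSign_mul_self, one_mul]
    · intro j _ hj
      rw [finsetCone, if_neg (c := i ∈ insert j ρ) (by simp [h, Ne.symm hj])]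
      simp

end Cone

/-! ## Chains of the nerve as functions on finite sets -/

section NerveExt

variable {X : Type*} [TopologicalSpace X] {ι : Type*} {U : ι → Set X}

/-- The simplex of the nerve with a given set of vertices. -/
def nerveMk {p : ℕ} (σ : Finset ι) (h : σ.card = p + 1 ∧ (⋂ i ∈ σ, U i).Nonempty) : Nerve U p :=
  ⟨σ, h⟩

@[simp]
theorem nerveMk_val {p : ℕ} (σ : Finset ι) (h : σ.card = p + 1 ∧ (⋂ i ∈ σ, U i).Nonempty) :
    (nerveMk σ h).1 = σ := rfl

/-- The extension by zero of a chain of the nerve to all finite sets of indices. -/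
def nerveExt {p : ℕ} (c : Nerve U p → ℝ) (σ : Finset ι) : ℝ :=
  open Classical in
  if h : σ.card = p + 1 ∧ (⋂ i ∈ σ, U i).Nonempty then c (nerveMk σ h) else 0

theorem nerveExt_val {p : ℕ} (c : Nerve U p → ℝ) (σ : Nerve U p) : nerveExt c σ.1 = c σ := by
  rw [nerveExt, dif_pos σ.2]
  rfl

theorem exists_of_nerveExt_ne_zero {p : ℕ} {c : Nerve U p → ℝ} {σ : Finset ι}
    (h : nerveExt c σ ≠ 0) : ∃ σ' : Nerve U p, σ'.1 = σ ∧ c σ' ≠ 0 := by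
  by_cases h' : σ.card = p + 1 ∧ (⋂ i ∈ σ, U i).Nonempty
  · rw [nerveExt, dif_pos h'] at h
    exact ⟨nerveMk σ h', rfl, h⟩
  · rw [nerveExt, dif_neg h'] at h
    exact absurd rfl h

theorem finsum_indicator_nerve [DecidableEq ι] {p : ℕ} (c : Nerve U p → ℝ) (σ : Finset ι) :
    ∑ᶠ τ : Nerve U p, (if τ.1 = σ then c τ else 0) = nerveExt c σ := by
  by_cases h : σ.card = p + 1 ∧ (⋂ i ∈ σ, U i).Nonempty
  · rw [nerveExt, dif_pos h, finsum_eq_single _ (nerveMk σ h)]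
    · exact if_pos rfl
    · intro τ hτ
      exact if_neg fun h' => hτ (Subtype.ext h')
  · rw [nerveExt, dif_neg h]
    refine (finsum_congr fun τ => if_neg ?_).trans finsum_zero
    rintro rfl
    exact h τ.2

variable [LinearOrder ι]

/-- Deleting a vertex of `τ` becomes adding a vertex to `ρ`. The index set `S` no longer depends on
`τ`, which allows the sum over `τ` to be exchanged with the sum over vertices. -/
theorem nerveInc_eq_sum {S τ : Finset ι} (hτ : τ ⊆ S) (ρ : Finset ι) :
    nerveInc τ ρ = ∑ j ∈ S, if j ∈ ρ then 0 else if τ = insert j ρ then vertexSign j ρ else 0 := by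
  rw [nerveInc, ← Finset.sum_subset hτ]
  · refine Finset.sum_congr rfl fun j hj => ?_
    by_cases h : τ.erase j = ρ
    · have hjρ : j ∉ ρ := h ▸ Finset.notMem_erase j τ
      have hτ : τ = insert j ρ := by rw [← h, Finset.insert_erase hj]
      rw [if_pos h, if_neg hjρ, if_pos hτ]
      conv_lhs => rw [hτ]
      exact vertexSign_insert_self j ρ
    · rw [if_neg h]
      split_ifs with h1 h2
      · rfl
      · exact absurd (by rw [h2, Finset.erase_insert h1]) h
      · rfl
  · intro j _ hj
    split_ifs with h1 h2
    · rfl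
    · exact absurd (by rw [h2]; exact Finset.mem_insert_self _ _) hj
    · rfl

variable (hU : IsStarFinite U)

theorem nerveBdry_eq_finsetBdry {p : ℕ} {c : Nerve U (p + 1) → ℝ} {S : Finset ι}
    (hS : ∀ τ, c τ ≠ 0 → τ.1 ⊆ S) (ρ : Nerve U p) :
    nerveBdry U hU ℝ p c ρ = finsetBdry S (nerveExt c) ρ.1 := by
  change ∑ᶠ τ : Nerve U (p + 1), nerveInc τ.1 ρ.1 • c τ = _
  have h1 : ∀ τ : Nerve U (p + 1), nerveInc τ.1 ρ.1 • c τ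
      = ∑ j ∈ S, if j ∈ ρ.1 then 0 else
        vertexSign j ρ.1 * (if τ.1 = insert j ρ.1 then c τ else 0) := fun τ => by
    by_cases hτ : c τ = 0
    · simp [hτ]
    · rw [nerveInc_eq_sum (hS τ hτ), smul_eq_mul, Finset.sum_mul]
      refine Finset.sum_congr rfl fun j _ => ?_
      split_ifs <;> simp
  rw [finsum_congr h1, finsum_sum_comm]
  · refine Finset.sum_congr rfl fun j _ => ?_
    split_ifs
    · exact finsum_zero
    · rw [← finsum_indicator_nerve, ← smul_eq_mul, smul_finsum]
      rfl
  · intro j _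
    refine Set.Finite.subset (s := {τ : Nerve U (p + 1) | τ.1 = insert j ρ.1})
      (Set.Subsingleton.finite fun a ha b hb => Subtype.ext (ha.trans hb.symm)) fun τ hτ => ?_
    by_contra h
    have h' : (if τ.1 = insert j ρ.1 then c τ else 0) = 0 := if_neg h
    refine hτ ?_
    beta_reduce
    rw [h', mul_zero, ite_self]

/-- There is something to check only where `ρ` is not a simplex of the right dimension: no `insert j
ρ` can then be a simplex either, since faces of simplices of the nerve are simplices. -/
theorem nerveExt_nerveBdry {p : ℕ} {c : Nerve U (p + 1) → ℝ} {S : Finset ι}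
    (hS : ∀ τ, c τ ≠ 0 → τ.1 ⊆ S) :
    nerveExt (nerveBdry U hU ℝ p c) = finsetBdry S (nerveExt c) := by
  funext ρ
  by_cases h : ρ.card = p + 1 ∧ (⋂ i ∈ ρ, U i).Nonempty
  · rw [nerveExt, dif_pos h, nerveBdry_eq_finsetBdry hU hS, nerveMk_val]
  · rw [nerveExt, dif_neg h, finsetBdry, Finset.sum_eq_zero]
    intro j _
    split_ifs with hj
    · rfl
    · by_contra hne
      obtain ⟨σ, hσ, -⟩ := exists_of_nerveExt_ne_zero (right_ne_zero_of_mul hne)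
      have h1 := σ.2.1
      rw [hσ, Finset.card_insert_of_notMem hj] at h1
      exact h ⟨by omega, σ.2.2.mono (Set.biInter_subset_biInter_left
        (by rw [hσ]; exact Finset.subset_insert _ _))⟩

/-- The value of the boundary at `∅` is the augmentation of the row. This is how the condition `τ x
= 0` enters the cone formula. -/
theorem finsum_nerve_zero_eq {c : Nerve U 0 → ℝ} {S : Finset ι}
    (hS : ∀ τ, c τ ≠ 0 → τ.1 ⊆ S) : ∑ᶠ σ, c σ = finsetBdry S (nerveExt c) ∅ := by
  have h1 : ∀ τ : Nerve U 0, c τ = ∑ j ∈ S, if τ.1 = {j} then c τ else 0 := fun τ => by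
    by_cases hτ : c τ = 0
    · simp [hτ]
    · obtain ⟨j, hj⟩ := Finset.card_eq_one.1 τ.2.1
      rw [Finset.sum_eq_single_of_mem j (hS τ hτ (by simp [hj])), if_pos hj]
      intro k _ hk
      exact if_neg fun h => hk (Finset.singleton_injective (h.symm.trans hj))
  rw [finsum_congr h1, finsum_sum_comm]
  · refine Finset.sum_congr rfl fun j _ => ?_
    rw [finsum_indicator_nerve, if_neg (Finset.notMem_empty j)]
    simp [vertexSign]
  · intro j _
    refine Set.Finite.subset (s := {τ : Nerve U 0 | τ.1 = {j}})
      (Set.Subsingleton.finite fun a ha b hb => Subtype.ext (ha.trans hb.symm)) fun τ hτ => ?_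
    by_contra h
    exact hτ (if_neg h)

theorem finite_indices (hU : IsStarFinite U) (y : X) : {i | y ∈ U i}.Finite := by
  by_cases h : ∃ i, y ∈ U i
  · obtain ⟨i, hi⟩ := h
    exact (hU i).subset fun j hj => ⟨y, hi, hj⟩
  · exact Set.finite_empty.subset fun i hi => h ⟨i, hi⟩

/-- Evaluated at a fixed singular simplex, an infinite family lives on finitely many vertices,
namely those whose members contain a chosen point of the image. Row identities thus reduce to the
combinatorics of a finite set. -/
theorem exists_vertex_finset (hU : IsStarFinite U) {n q : ℕ} {x : Bigraded U} (hx : x ∈ Tot U n)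
    (s : Sing q X) : ∃ S : Finset ι, (∀ i, Set.range s ⊆ U i → i ∈ S) ∧
      ∀ (p : ℕ) (σ : Nerve U p), x p q σ s ≠ 0 → σ.1 ⊆ S := by
  obtain ⟨y, hy⟩ := range_nonempty s
  refine ⟨(finite_indices hU y).toFinset, fun i hi => by simpa using hi hy, fun p σ h i hi => ?_⟩
  simpa using σ.subset_of_mem hi (hx.2 p q σ s h hy)

theorem nerveBdry_finsupp_apply {p : ℕ} {α : Type*} (c : Nerve U (p + 1) → (α →₀ ℝ))
    (ρ : Nerve U p) (s : α) :
    nerveBdry U hU _ p c ρ s = nerveBdry U hU ℝ p (fun σ => c σ s) ρ :=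
  map_nerveBdry hU (Finsupp.lapply s) c ρ

theorem nerveBdry_nerveBdry_of_mem_tot {n : ℕ} {x : Bigraded U} (hx : x ∈ Tot U n) (p q : ℕ) :
    nerveBdry U hU _ p (nerveBdry U hU _ (p + 1) (x (p + 2) q)) = 0 := by
  funext ρ
  ext s
  obtain ⟨S, -, hS⟩ := exists_vertex_finset hU hx s
  rw [nerveBdry_finsupp_apply]
  simp only [nerveBdry_finsupp_apply]
  have h2 := nerveExt_nerveBdry hU (fun τ => hS (p + 2) τ)
  rw [nerveBdry_eq_finsetBdry hU (S := S), h2, finsetBdry_finsetBdry]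
  · rfl
  · intro τ hτ
    rw [nerveBdry_eq_finsetBdry hU (fun τ => hS (p + 2) τ)] at hτ
    obtain ⟨j, -, hj⟩ := Finset.exists_ne_zero_of_sum_ne_zero hτ
    split_ifs at hj with h
    · exact absurd rfl hj
    · obtain ⟨σ, hσ, h'⟩ := exists_of_nerveExt_ne_zero (right_ne_zero_of_mul hj)
      exact (Finset.subset_insert _ _).trans (hσ ▸ hS _ σ h')

theorem bigradedD_apply (x : Bigraded U) (p q : ℕ) (σ : Nerve U p) :
    bigradedD U hU x p q σ
      = nerveBdry U hU _ p (x (p + 1) q) σ + (-1 : ℝ) ^ p • finBdry X q (x p (q + 1) σ) := rfl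

theorem nerveBdry_pi_eq {p : ℕ} {M M' : Type*} [AddCommGroup M] [Module ℝ M] [AddCommGroup M']
    [Module ℝ M'] (f : M →ₗ[ℝ] M') (c : Nerve U (p + 1) → M) :
    nerveBdry U hU M' p (fun σ => f (c σ)) = fun ρ => f (nerveBdry U hU M p c ρ) :=
  funext fun ρ => (map_nerveBdry hU f c ρ).symm

/-- The squares of the horizontal and vertical parts vanish, and the signs `(-1) ^ p` make the mixed
terms cancel. -/
theorem bigradedD_bigradedD {n : ℕ} {x : Bigraded U} (hx : x ∈ Tot U n) :
    bigradedD U hU (bigradedD U hU x) = 0 := by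
  funext p q σ
  rw [bigradedD_apply]
  have h1 : bigradedD U hU x (p + 1) q = nerveBdry U hU _ (p + 1) (x (p + 2) q)
      + (-1 : ℝ) ^ (p + 1) • fun σ => finBdry X q (x (p + 1) (q + 1) σ) := rfl
  rw [h1, map_add, map_smul, nerveBdry_pi_eq, nerveBdry_nerveBdry_of_mem_tot hU hx, bigradedD_apply,
    map_add, map_smul, finBdry_finBdry, smul_zero, add_zero, zero_add, Pi.smul_apply, ← add_smul,
    pow_succ]
  simp

end NerveExt

/-! ## The rows of the double complex are exact -/

section Rows

variable {X : Type*} [TopologicalSpace X] {ι : Type*} [LinearOrder ι] {U : ι → Set X}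

/-- A singular simplex is small if its image is contained in a member of the family. -/
def Small (U : ι → Set X) {q : ℕ} (s : Sing q X) : Prop := ∃ i, Set.range s ⊆ U i

/-- The face opposite to a vertex. -/
def nerveErase {p : ℕ} (σ : Nerve U (p + 1)) {i : ι} (hi : i ∈ σ.1) : Nerve U p :=
  nerveMk (σ.1.erase i) ⟨by rw [Finset.card_erase_of_mem hi, σ.2.1]; omega,
    σ.2.2.mono (Set.biInter_subset_biInter_left (Finset.erase_subset i σ.1))⟩

/-- The cone operator on families of chains of bidegree `(p, q)`, where `i s` is the vertex
assigned to the singular simplex `s`. -/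
def coneAux {q : ℕ} (i : Sing q X → ι) {p : ℕ} (x : Nerve U p → (Sing q X →₀ ℝ))
    (σ : Nerve U (p + 1)) : Sing q X →₀ ℝ :=
  open Classical in
  Finsupp.onFinset (σ.1.attach.biUnion fun j => (x (nerveErase σ j.2)).support)
    (fun s => if h : i s ∈ σ.1 then vertexSign (i s) σ.1 * x (nerveErase σ h) s else 0)
    fun s hs => by
      by_cases h : i s ∈ σ.1
      · rw [dif_pos h] at hs
        simp only [Finset.mem_biUnion, Finset.mem_attach, true_and, Finsupp.mem_support_iff]
        exact ⟨⟨i s, h⟩, right_ne_zero_of_mul hs⟩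
      · rw [dif_neg h] at hs
        exact absurd rfl hs

theorem coneAux_apply_of_mem {q : ℕ} {i : Sing q X → ι} {p : ℕ}
    (x : Nerve U p → (Sing q X →₀ ℝ)) {σ : Nerve U (p + 1)} {s : Sing q X} (h : i s ∈ σ.1) :
    coneAux i x σ s = vertexSign (i s) σ.1 * x (nerveErase σ h) s := dif_pos h

theorem coneAux_apply_of_notMem {q : ℕ} {i : Sing q X → ι} {p : ℕ}
    (x : Nerve U p → (Sing q X →₀ ℝ)) {σ : Nerve U (p + 1)} {s : Sing q X} (h : i s ∉ σ.1) :
    coneAux i x σ s = 0 := dif_neg h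

/-- The cone operator on all families of chains, raising `p` by one. -/
def bigradedCone (U : ι → Set X) (i : ∀ q, Sing q X → ι) : Bigraded U →ₗ[ℝ] Bigraded U where
  toFun x p q := match p with
    | 0 => 0
    | p + 1 => coneAux (i q) (x p q)
  map_add' x y := by
    funext p q
    cases p with
    | zero => exact (add_zero 0).symm
    | succ p =>
      funext σ
      ext s
      change coneAux (i q) (x p q + y p q) σ s = coneAux (i q) (x p q) σ s
        + coneAux (i q) (y p q) σ s
      by_cases h : i q s ∈ σ.1
      · simp only [coneAux_apply_of_mem _ h, Pi.add_apply, Finsupp.add_apply, mul_add]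
      · simp only [coneAux_apply_of_notMem _ h, add_zero]
  map_smul' r x := by
    funext p q
    cases p with
    | zero => exact (smul_zero r).symm
    | succ p =>
      funext σ
      ext s
      change coneAux (i q) (r • x p q) σ s = r * coneAux (i q) (x p q) σ s
      by_cases h : i q s ∈ σ.1
      · simp only [coneAux_apply_of_mem _ h, Pi.smul_apply, Finsupp.smul_apply, smul_eq_mul]
        ring
      · simp only [coneAux_apply_of_notMem _ h, mul_zero]

theorem bigradedCone_zero (i : ∀ q, Sing q X → ι) (x : Bigraded U) (q : ℕ) :
    bigradedCone U i x 0 q = 0 := rfl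

theorem bigradedCone_succ (i : ∀ q, Sing q X → ι) (x : Bigraded U) (p q : ℕ) :
    bigradedCone U i x (p + 1) q = coneAux (i q) (x p q) := rfl

theorem coneAux_zero {q : ℕ} (i : Sing q X → ι) {p : ℕ} :
    coneAux i (0 : Nerve U p → (Sing q X →₀ ℝ)) = 0 := by
  funext σ
  ext s
  by_cases h : i s ∈ σ.1
  · simp [coneAux_apply_of_mem _ h]
  · simp [coneAux_apply_of_notMem _ h]

/-- An assignment of a member of the family to every small singular simplex. -/
def IsAssignment (U : ι → Set X) (i : ∀ q, Sing q X → ι) : Prop :=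
  ∀ (q : ℕ) (s : Sing q X), Small U s → Set.range s ⊆ U (i q s)

theorem exists_assignment (hP : IsProperCovering U) : ∃ i, IsAssignment U i := by
  have h : ∀ (q : ℕ) (s : Sing q X), ∃ i, Small U s → Set.range s ⊆ U i := fun q s => by
    by_cases h : Small U s
    · exact h.imp fun i hi _ => hi
    · obtain ⟨y, -⟩ := range_nonempty s
      have hy : y ∈ ⋃ i, interior (U i) := by rw [hP.1]; trivial
      obtain ⟨i, -⟩ := Set.mem_iUnion.1 hy
      -- For a simplex which is not small any index serves; one exists because a point of the image
      -- is covered.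
      exact ⟨i, fun h' => absurd h' h⟩
  choose i hi using h
  exact ⟨i, hi⟩

theorem small_of_mem_tot {n : ℕ} {x : Bigraded U} (hx : x ∈ Tot U n) {p q : ℕ} {σ : Nerve U p}
    {s : Sing q X} (h : x p q σ s ≠ 0) : Small U s := by
  obtain ⟨i, hi⟩ := σ.nonempty
  exact ⟨i, (hx.2 p q σ s h).trans (σ.subset_of_mem hi)⟩

variable {i : ∀ q, Sing q X → ι} (hi : IsAssignment U i)
include hi

theorem range_subset_carrier_of_erase {q : ℕ} {s : Sing q X} (hs : Small U s)
    {σ : Finset ι} (h : Set.range s ⊆ ⋂ j ∈ σ.erase (i q s), U j) :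
    Set.range s ⊆ ⋂ j ∈ σ, U j := by
  refine Set.subset_iInter₂ fun j hj => ?_
  by_cases hji : j = i q s
  · rw [hji]
    exact hi q s hs
  · exact h.trans (Set.biInter_subset_of_mem (Finset.mem_coe.2 (Finset.mem_erase.2 ⟨hji, hj⟩)))

/-- The apex depends on the singular simplex precisely for this: adding a member which contains the
image of `s` to the vertices keeps this image inside the carrier. -/
theorem bigradedCone_mem {n : ℕ} {x : Bigraded U} (hx : x ∈ Tot U n) :
    bigradedCone U i x ∈ Tot U (n + 1) := by
  refine ⟨fun p q h => ?_, fun p q σ s h => ?_⟩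
  · cases p with
    | zero => rfl
    | succ p => rw [bigradedCone_succ, hx.1 p q (by omega), coneAux_zero]
  · cases p with
    | zero => exact absurd rfl h
    | succ p =>
      rw [bigradedCone_succ] at h
      by_cases hs : i q s ∈ σ.1
      · rw [coneAux_apply_of_mem _ hs] at h
        have h' := right_ne_zero_of_mul h
        exact range_subset_carrier_of_erase hi (small_of_mem_tot hx h')
          (hx.2 p q (nerveErase σ hs) s h')
      · exact absurd (coneAux_apply_of_notMem _ hs) h

/-- Extension by zero loses nothing: if `s` occurs over the face opposite to its apex, its image
lies in all members indexed by `σ`, so `σ` is a simplex of the nerve. -/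
theorem nerveExt_coneAux {n : ℕ} {x : Bigraded U} (hx : x ∈ Tot U n) (p q : ℕ) (s : Sing q X) :
    nerveExt (fun σ => coneAux (i q) (x p q) σ s)
      = finsetCone (i q s) (nerveExt fun σ => x p q σ s) := by
  funext σ
  by_cases h : σ.card = p + 1 + 1 ∧ (⋂ i ∈ σ, U i).Nonempty
  · rw [nerveExt, dif_pos h, finsetCone]
    split_ifs with h'
    · rw [coneAux_apply_of_mem _ (σ := nerveMk σ h) h', ← nerveExt_val fun σ => x p q σ s]
      rfl
    · exact coneAux_apply_of_notMem _ h'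
  · rw [nerveExt, dif_neg h, finsetCone]
    split_ifs with h'
    · by_contra hne
      obtain ⟨τ, hτ, hτ'⟩ := exists_of_nerveExt_ne_zero (right_ne_zero_of_mul (Ne.symm hne))
      have h1 := τ.2.1
      rw [hτ, Finset.card_erase_of_mem h'] at h1
      have h2 := hx.2 p q τ s hτ'
      rw [Nerve.carrier, hτ] at h2
      exact h ⟨by omega,
        (range_nonempty s).mono (range_subset_carrier_of_erase hi (small_of_mem_tot hx hτ') h2)⟩
    · rfl

/-- The horizontal part of the total differential. -/
def bigradedDelta (hU : IsStarFinite U) (x : Bigraded U) : Bigraded U :=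
  fun p q => nerveBdry U hU _ p (x (p + 1) q)

/-- The vertical part of the total differential. -/
def bigradedPartial (x : Bigraded U) : Bigraded U :=
  fun p q σ => (-1 : ℝ) ^ p • finBdry X q (x p (q + 1) σ)

omit hi in
theorem bigradedD_eq (hU : IsStarFinite U) (x : Bigraded U) :
    bigradedD U hU x = bigradedDelta hU x + bigradedPartial x := rfl

/-- The rows, augmented by `τ`, are contracted one singular simplex at a time by the cone formula
for finite sets. The hypothesis `hτ` removes the augmentation term which occurs for `p = 0`. -/
theorem bigradedDelta_cone (hU : IsStarFinite U) {n : ℕ} {x : Bigraded U} (hx : x ∈ Tot U n)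
    (hτ : ∀ q s, ∑ᶠ σ, x 0 q σ s = 0) :
    bigradedDelta hU (bigradedCone U i x) + bigradedCone U i (bigradedDelta hU x) = x := by
  funext p q σ
  ext s
  obtain ⟨S, hS1, hS2⟩ := exists_vertex_finset hU hx s
  obtain ⟨S', hS1', hS2'⟩ := exists_vertex_finset hU (bigradedCone_mem hi hx) s
  by_cases hs : Small U s
  · have hiS : i q s ∈ S := hS1 _ (hi q s hs)
    have hcone : ∀ τ : Nerve U (p + 1), coneAux (i q) (x p q) τ s ≠ 0 → τ.1 ⊆ S := fun τ h => by
      by_cases h' : i q s ∈ τ.1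
      · rw [coneAux_apply_of_mem _ h'] at h
        have := hS2 _ _ (right_ne_zero_of_mul h)
        rw [← Finset.insert_erase h']
        exact Finset.insert_subset hiS this
      · exact absurd (coneAux_apply_of_notMem _ h') h
    have key := finsetBdry_finsetCone hiS (nerveExt fun σ => x p q σ s) σ.1
    rw [nerveExt_val] at key
    rw [← key]
    change nerveBdry U hU _ p (coneAux (i q) (x p q)) σ s
      + bigradedCone U i (bigradedDelta hU x) p q σ s = _
    rw [nerveBdry_finsupp_apply, nerveBdry_eq_finsetBdry hU hcone, nerveExt_coneAux hi hx]
    congr 1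
    cases p with
    | zero =>
      rw [bigradedCone_zero, finsetCone]
      split_ifs with h
      -- Removing the only vertex leaves `∅`, where the boundary is the augmentation.
      · have h1 : σ.1.erase (i q s) = ∅ := by
          rw [← Finset.card_eq_zero, Finset.card_erase_of_mem h, σ.2.1]
        rw [h1, ← finsum_nerve_zero_eq (fun τ => hS2 0 τ), hτ, mul_zero]
        rfl
      · rfl
    | succ p =>
      rw [bigradedCone_succ, finsetCone]
      split_ifs with h
      · rw [coneAux_apply_of_mem _ h]
        change _ * nerveBdry U hU _ p (x (p + 1) q) _ s = _
        rw [nerveBdry_finsupp_apply, nerveBdry_eq_finsetBdry hU (fun τ => hS2 (p + 1) τ)]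
        rfl
      · exact coneAux_apply_of_notMem _ h
  -- A simplex which is not small occurs neither in `x` nor in its cone, so every term is zero,
  -- whatever apex was assigned to it.
  · have hx0 : ∀ (p : ℕ) (σ : Nerve U p), x p q σ s = 0 := fun p σ => by
      by_contra h
      exact hs (small_of_mem_tot hx h)
    have hc0 : ∀ (p : ℕ) (τ : Nerve U p), bigradedCone U i x p q τ s = 0 := fun p τ => by
      by_contra h
      exact hs (small_of_mem_tot (bigradedCone_mem hi hx) h)
    rw [hx0]
    change nerveBdry U hU _ p (bigradedCone U i x (p + 1) q) σ s
      + bigradedCone U i (bigradedDelta hU x) p q σ s = 0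
    rw [nerveBdry_finsupp_apply]
    simp only [hc0]
    rw [show (fun _ : Nerve U (p + 1) => (0 : ℝ)) = 0 from rfl, map_zero, Pi.zero_apply, zero_add]
    cases p with
    | zero => rfl
    | succ p =>
      rw [bigradedCone_succ]
      by_cases h : i q s ∈ σ.1
      · rw [coneAux_apply_of_mem _ h]
        change _ * nerveBdry U hU _ p (x (p + 1) q) _ s = _
        rw [nerveBdry_finsupp_apply]
        simp only [hx0]
        rw [show (fun _ : Nerve U (p + 1) => (0 : ℝ)) = 0 from rfl, map_zero, Pi.zero_apply,
          mul_zero]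
      · exact coneAux_apply_of_notMem _ h

omit hi in
theorem toCf_eq_zero_iff (hU : IsStarFinite U) (hP : IsProperCovering U) {n : ℕ} (x : Tot U n) :
    toCf U hU hP n x = 0 ↔ ∀ q s, ∑ᶠ σ, x.1 0 q σ s = 0 := by
  constructor
  · intro h q s
    by_cases hq : q = n
    · subst hq
      exact congrFun (congrArg Subtype.val h) s
    · rw [x.2.1 0 q (by omega)]
      exact finsum_zero
  · intro h
    ext s
    exact h n s

/-- Subtracting the total boundary of the cone lowers by one the bound on the singular degrees
occurring in `x`. Since `δx = -∂x`, the remainder involves only vertical boundaries, so its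
component in degree `q` comes from components of `x` in degree `q + 1`. -/
theorem exists_primitive_of_vanishing (hU : IsStarFinite U) (hP : IsProperCovering U) {n : ℕ}
    (m : ℕ) : ∀ x : Tot U n, bigradedD U hU x.1 = 0 → toCf U hU hP n x = 0 →
      (∀ p q, m ≤ q → x.1 p q = 0) →
      ∃ y : Tot U (n + 1), toCf U hU hP (n + 1) y = 0 ∧ totD U hU n y = x := by
  induction m with
  | zero =>
    intro x _ _ hx
    have : x = 0 := by
      ext p q
      rw [hx p q (Nat.zero_le q)]
      rfl
    exact ⟨0, map_zero _, by rw [this, map_zero]⟩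
  | succ m ih =>
    intro x hD hτ hx
    let y : Tot U (n + 1) := ⟨bigradedCone U i x.1, bigradedCone_mem hi x.2⟩
    have hy : toCf U hU hP (n + 1) y = 0 := (toCf_eq_zero_iff hU hP y).2 fun q s => by
      change ∑ᶠ σ, bigradedCone U i x.1 0 q σ s = 0
      rw [bigradedCone_zero]
      exact finsum_zero
    have h1 := bigradedDelta_cone hi hU x.2 ((toCf_eq_zero_iff hU hP x).1 hτ)
    have h2 : bigradedDelta hU x.1 = -bigradedPartial x.1 := by
      rw [bigradedD_eq] at hD
      exact eq_neg_of_add_eq_zero_left hD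
    have h3 : (x - totD U hU n y).1
        = -(bigradedPartial y.1 + bigradedCone U i (bigradedPartial x.1)) := by
      change x.1 - (bigradedDelta hU y.1 + bigradedPartial y.1) = _
      rw [h2, map_neg] at h1
      nth_rewrite 1 [← h1]
      abel
    obtain ⟨z, hz1, hz2⟩ := ih (x - totD U hU n y) (by
        change bigradedD U hU (x.1 - bigradedD U hU y.1) = 0
        rw [map_sub, hD, bigradedD_bigradedD hU y.2, sub_zero])
      (by
        refine (LinearMap.map_sub (toCf U hU hP n) x (totD U hU n y)).trans ?_
        rw [hτ, toCf_comm, hy, map_zero, sub_zero]) (by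
        intro p q hq
        have hp : ∀ p, bigradedPartial x.1 p q = 0 := fun p => by
          funext σ
          change (-1 : ℝ) ^ p • finBdry X q (x.1 p (q + 1) σ) = 0
          rw [hx p (q + 1) (by omega), Pi.zero_apply, map_zero, smul_zero]
        have hy' : y.1 p (q + 1) = 0 := by
          change bigradedCone U i x.1 p (q + 1) = 0
          cases p with
          | zero => rfl
          | succ p => rw [bigradedCone_succ, hx p (q + 1) (by omega), coneAux_zero]
        have hc : bigradedCone U i (bigradedPartial x.1) p q = 0 := by
          cases p with
          | zero => rfl
          | succ p => rw [bigradedCone_succ, hp, coneAux_zero]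
        have hb : bigradedPartial y.1 p q = 0 := by
          funext σ
          change (-1 : ℝ) ^ p • finBdry X q (y.1 p (q + 1) σ) = 0
          rw [hy', Pi.zero_apply, map_zero, smul_zero]
        rw [h3]
        change -(bigradedPartial y.1 p q + bigradedCone U i (bigradedPartial x.1) p q) = 0
        rw [hb, hc, add_zero, neg_zero])
    exact ⟨z + y, by rw [map_add, hz1, hy, add_zero], by
      rw [map_add, hz2]
      exact sub_add_cancel x _⟩

omit hi in
/-- The kernel of the chain map `τ` is acyclic. -/
theorem exists_primitive_of_toCf_eq_zero (hU : IsStarFinite U) (hP : IsProperCovering U) {n : ℕ}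
    (x : Tot U n) (hD : bigradedD U hU x.1 = 0) (hτ : toCf U hU hP n x = 0) :
    ∃ y : Tot U (n + 1), toCf U hU hP (n + 1) y = 0 ∧ totD U hU n y = x := by
  obtain ⟨i, hi⟩ := exists_assignment hP
  exact exists_primitive_of_vanishing hi hU hP (n + 1) x hD hτ
    fun p q h => x.2.1 p q (by omega)

omit hi in
theorem bigradedD_eq_zero_of_mem_cycles (hU : IsStarFinite U) :
    ∀ {n : ℕ} {x : Tot U n}, x ∈ cycles (C := fun n => Tot U n) (totD U hU) n →
      bigradedD U hU x.1 = 0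
  | 0, x, _ => by
    funext p q σ
    rw [bigradedD_apply, x.2.1 (p + 1) q (by omega), x.2.1 p (q + 1) (by omega)]
    simp
  | n + 1, x, hx => congrArg Subtype.val (show totD U hU n x = 0 from hx)

omit hi in
/-- Small compactly finite chains lift to the total complex. -/
theorem exists_toCf_eq (hU : IsStarFinite U) (hP : IsProperCovering U) {n : ℕ} (c : CfChain n X)
    (hc : ∀ s, c.1 s ≠ 0 → Small U s) : ∃ x : Tot U n, toCf U hU hP n x = c := by
  classical
  obtain ⟨i, hi⟩ := exists_assignment hP
  -- Compactness of the closures is used here: simplices inside `U j` meet the compact set `closure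
  -- (U j)`, so only finitely many of them occur in `c`, and each component of the lift is a finite
  -- chain.
  have hfin : ∀ j : ι, {s | c.1 s ≠ 0 ∧ Set.range s ⊆ U j}.Finite := fun j =>
    (c.2 _ (hP.2 j)).subset fun s ⟨h1, h2⟩ => ⟨h1, by
      obtain ⟨y, hy⟩ := range_nonempty s
      exact ⟨y, hy, subset_closure (h2 hy)⟩⟩
  have hfin' : ∀ σ : Nerve U 0, {s | c.1 s ≠ 0 ∧ σ.1 = {i n s}}.Finite := fun σ => by
    obtain ⟨j, hj⟩ := Finset.card_eq_one.1 σ.2.1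
    refine (hfin j).subset fun s ⟨h1, h2⟩ => ⟨h1, ?_⟩
    rw [hj] at h2
    rw [Finset.singleton_injective h2]
    exact hi n s (hc s h1)
  let f : Nerve U 0 → (Sing n X →₀ ℝ) := fun σ => Finsupp.onFinset (hfin' σ).toFinset
    (fun s => if σ.1 = {i n s} then c.1 s else 0) fun s hs => by
      have h : σ.1 = {i n s} := by
        by_contra h
        exact hs (if_neg h)
      rw [if_pos h] at hs
      simpa using ⟨hs, h⟩
  have hf : ∀ σ s, f σ s = if σ.1 = {i n s} then c.1 s else 0 := fun _ _ => rfl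
  let x : Bigraded U := fun p q => match p with
    | 0 => if h : q = n then h ▸ f else 0
    | _ + 1 => 0
  have hx : x 0 n = f := dif_pos rfl
  have hxm : x ∈ Tot U n := by
    refine ⟨fun p q h => ?_, fun p q σ s h => ?_⟩
    · cases p with
      | zero => exact dif_neg (by omega)
      | succ p => rfl
    · cases p with
      | zero =>
        by_cases hq : q = n
        · subst hq
          rw [hx, hf] at h
          have h1 : σ.1 = {i q s} := by
            by_contra h'
            exact h (if_neg h')
          rw [if_pos h1] at h
          have := hi q s (hc s h)
          rw [Nerve.carrier, h1]
          simpa using this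
        · rw [show x 0 q = 0 from dif_neg hq] at h
          exact absurd rfl h
      | succ p => exact absurd rfl h
  refine ⟨⟨x, hxm⟩, ?_⟩
  ext s
  change ∑ᶠ σ, x 0 n σ s = c.1 s
  rw [hx]
  simp only [hf]
  have h1 := finsum_indicator_nerve (fun _ : Nerve U 0 => c.1 s) {i n s}
  rw [h1]
  by_cases h : c.1 s = 0
  · rw [nerveExt]
    split_ifs
    · rfl
    · exact h.symm
  · rw [nerveExt, dif_pos ⟨Finset.card_singleton _, by
      simpa using (range_nonempty s).mono (hi n s (hc s h))⟩]

omit hi in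
theorem small_of_toCf_ne_zero (hU : IsStarFinite U) (hP : IsProperCovering U) {n : ℕ}
    (x : Tot U n) {s : Sing n X} (h : (toCf U hU hP n x).1 s ≠ 0) : Small U s := by
  obtain ⟨σ, hσ⟩ := exists_ne_zero_of_finsum h
  exact small_of_mem_tot x.2 hσ

end Rows

/-! ## Chains in acyclic subspaces -/

section Subspace

variable {X : Type*} [TopologicalSpace X] {A : Set X}

/-- A finite chain is supported in a subset if all its simplices have images in this subset. -/
def SupportedIn (A : Set X) {q : ℕ} (c : Sing q X →₀ ℝ) : Prop :=
  ∀ s, c s ≠ 0 → Set.range s ⊆ A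

/-- Singular simplices of a subspace as singular simplices of the space. -/
def inclSing (A : Set X) (q : ℕ) (s : Sing q A) : Sing q X :=
  (⟨Subtype.val, continuous_subtype_val⟩ : C(A, X)).comp s

theorem inclSing_injective (q : ℕ) : Function.Injective (inclSing A q) := fun s t h => by
  ext x
  exact congrFun (congrArg DFunLike.coe h) x

theorem range_inclSing {q : ℕ} (s : Sing q A) : Set.range (inclSing A q s) ⊆ A := by
  rintro _ ⟨x, rfl⟩
  exact (s x).2

theorem exists_inclSing_eq {q : ℕ} {s : Sing q X} (hs : Set.range s ⊆ A) :
    ∃ t, inclSing A q t = s :=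
  ⟨⟨fun x => ⟨s x, hs ⟨x, rfl⟩⟩, by fun_prop⟩, rfl⟩

theorem supportedIn_mapDomain {q : ℕ} (c : Sing q A →₀ ℝ) :
    SupportedIn A (c.mapDomain (inclSing A q)) := fun s hs => by
  classical
  have h := Finsupp.mapDomain_support (Finsupp.mem_support_iff.2 hs)
  obtain ⟨t, -, rfl⟩ := Finset.mem_image.1 h
  exact range_inclSing t

theorem SupportedIn.exists_mapDomain_eq {q : ℕ} {c : Sing q X →₀ ℝ} (hc : SupportedIn A c) :
    ∃ c' : Sing q A →₀ ℝ, c'.mapDomain (inclSing A q) = c :=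
  ⟨c.comapDomain _ (inclSing_injective q).injOn,
    Finsupp.mapDomain_comapDomain _ (inclSing_injective q) _ fun s hs =>
      exists_inclSing_eq (hc s (Finsupp.mem_support_iff.1 hs))⟩

theorem finBdry_mapDomain {q : ℕ} (c : Sing (q + 1) A →₀ ℝ) :
    finBdry X q (c.mapDomain (inclSing A (q + 1)))
      = (finBdry A q c).mapDomain (inclSing A q) := by
  suffices h : (finBdry X q).comp (Finsupp.lmapDomain ℝ ℝ (inclSing A (q + 1)))
      = (Finsupp.lmapDomain ℝ ℝ (inclSing A q)).comp (finBdry A q) from LinearMap.congr_fun h c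
  refine Finsupp.lhom_ext fun s r => ?_
  simp only [LinearMap.comp_apply, Finsupp.lmapDomain_apply, Finsupp.mapDomain_single,
    finBdry_single, Finsupp.mapDomain_finsetSum, Finsupp.mapDomain_smul]
  rfl

theorem augmentation_mapDomain {q : ℕ} (c : Sing q A →₀ ℝ) :
    augmentation q X (c.mapDomain (inclSing A q)) = augmentation q A c := by
  suffices h : (augmentation q X).comp (Finsupp.lmapDomain ℝ ℝ (inclSing A q))
      = augmentation q A from LinearMap.congr_fun h c
  refine Finsupp.lhom_ext fun s r => ?_
  simp only [LinearMap.comp_apply, Finsupp.lmapDomain_apply, Finsupp.mapDomain_single,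
    augmentation_single]

/-- Inclusion of the subspace is an isometry onto the chains supported in `A` and commutes with
boundaries. The constant depends on `A`. -/
theorem exists_approx_in (hA : IsL1Acyclic A) (n : ℕ) :
    ∃ K > 0, ∀ c : Sing (n + 1) X →₀ ℝ, SupportedIn A c → ∀ η > 0, ∃ w, SupportedIn A w ∧
      finNorm (c - finBdry X (n + 1) w) ≤ K * finNorm (finBdry X n c) + η := by
  obtain ⟨K, hK, h⟩ := hA.exists_approx n
  refine ⟨K, hK, fun c hc η hη => ?_⟩
  obtain ⟨c, rfl⟩ := hc.exists_mapDomain_eq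
  obtain ⟨w, hw⟩ := h c η hη
  refine ⟨_, supportedIn_mapDomain w, ?_⟩
  rwa [finBdry_mapDomain, finBdry_mapDomain, ← Finsupp.lmapDomain_apply ℝ ℝ,
    ← Finsupp.lmapDomain_apply ℝ ℝ, ← map_sub, Finsupp.lmapDomain_apply,
    finNorm_mapDomain (inclSing_injective _), finNorm_mapDomain (inclSing_injective _)]

theorem exists_approx_zero_in (hA : IsL1Acyclic A) (hne : A.Nonempty) {c : Sing 0 X →₀ ℝ}
    (hc : SupportedIn A c) (h0 : augmentation 0 X c = 0) {η : ℝ} (hη : 0 < η) :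
    ∃ w, SupportedIn A w ∧ finNorm (c - finBdry X 0 w) ≤ η := by
  have := hne.to_subtype
  obtain ⟨c, rfl⟩ := hc.exists_mapDomain_eq
  rw [augmentation_mapDomain] at h0
  obtain ⟨w, hw⟩ := hA.exists_approx_zero c h0 hη
  refine ⟨_, supportedIn_mapDomain w, ?_⟩
  rwa [finBdry_mapDomain, ← Finsupp.lmapDomain_apply ℝ ℝ, ← Finsupp.lmapDomain_apply ℝ ℝ,
    ← map_sub, Finsupp.lmapDomain_apply, finNorm_mapDomain (inclSing_injective _)]

end Subspace

/-! ## Making the components of cycles of the total complex small -/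

section Approx

variable {X : Type*} [TopologicalSpace X] {ι : Type*} [LinearOrder ι] {U : ι → Set X}

/-- The element of the total complex with a single non-zero component. -/
def totSingle {p q n : ℕ} (h : p + q = n) (f : Nerve U p → (Sing q X →₀ ℝ))
    (hf : ∀ σ, SupportedIn σ.carrier (f σ)) : Tot U n :=
  ⟨Pi.single p (Pi.single q f), by
    refine ⟨fun p' q' hpq => ?_, fun p' q' σ s hs => ?_⟩
    · by_cases hp : p' = p
      · subst hp
        rw [Pi.single_eq_same, Pi.single_eq_of_ne (by omega)]
      · rw [Pi.single_eq_of_ne hp]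
        rfl
    · by_cases hp : p' = p
      · subst hp
        rw [Pi.single_eq_same] at hs
        by_cases hq : q' = q
        · subst hq
          rw [Pi.single_eq_same] at hs
          exact hf σ s hs
        · rw [Pi.single_eq_of_ne hq] at hs
          exact absurd rfl hs
      · rw [Pi.single_eq_of_ne hp] at hs
        exact absurd rfl hs⟩

theorem totSingle_same {p q n : ℕ} (h : p + q = n) (f : Nerve U p → (Sing q X →₀ ℝ))
    (hf : ∀ σ, SupportedIn σ.carrier (f σ)) : (totSingle h f hf).1 p q = f := by
  change Pi.single (M := fun p => ∀ q : ℕ, Nerve U p → (Sing q X →₀ ℝ)) p (Pi.single q f) p q = f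
  rw [Pi.single_eq_same, Pi.single_eq_same]

theorem totSingle_of_ne {p q n : ℕ} (h : p + q = n) (f : Nerve U p → (Sing q X →₀ ℝ))
    (hf : ∀ σ, SupportedIn σ.carrier (f σ)) {p' : ℕ} (hp : p' ≠ p) (q' : ℕ) :
    (totSingle h f hf).1 p' q' = 0 := by
  change Pi.single (M := fun p => ∀ q : ℕ, Nerve U p → (Sing q X →₀ ℝ)) p (Pi.single q f) p' q' = 0
  rw [Pi.single_eq_of_ne hp]
  rfl

theorem exists_pos_le_of_finite {α : Type*} {s : Set α} (hs : s.Finite) {g : α → ℝ}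
    (hg : ∀ a, 0 < g a) : ∃ δ > 0, ∀ a ∈ s, δ ≤ g a := by
  induction s, hs using Set.Finite.induction_on with
  | empty => exact ⟨1, one_pos, fun a ha => absurd ha (Set.notMem_empty a)⟩
  | @insert a s _ _ ih =>
    obtain ⟨δ, hδ, h⟩ := ih
    refine ⟨min δ (g a), lt_min hδ (hg a), fun b hb => ?_⟩
    rcases hb with rfl | hb
    · exact min_le_right _ _
    · exact (min_le_left _ _).trans (h b hb)

theorem finite_faces {p q : ℕ} (τ : Nerve U p) : {ρ : Nerve U q | nerveInc τ.1 ρ.1 ≠ 0}.Finite := by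
  refine Set.Finite.of_finite_image (f := Subtype.val) ?_ Subtype.val_injective.injOn
  refine (τ.1.powerset.finite_toSet).subset ?_
  rintro _ ⟨ρ, hρ, rfl⟩
  exact Finset.mem_coe.2 (Finset.mem_powerset.2 (subset_of_nerveInc hρ))

/-- Take `v` concentrated in bidegree `(p, q + 1)` and equal to `(-1) ^ p • w` there, so that the
sign in the total differential cancels. Its horizontal boundary lands in another bidegree. -/
theorem exists_boundary_correction (hU : IsStarFinite U) {p q n : ℕ} (hpq : p + q = n)
    (x : Tot U n) {w : Nerve U p → (Sing (q + 1) X →₀ ℝ)}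
    (hw : ∀ σ, SupportedIn σ.carrier (w σ)) :
    ∃ v : Tot U (n + 1), ∀ σ,
      (x - totD U hU n v).1 p q σ = x.1 p q σ - finBdry X q (w σ) := by
  have hw' : ∀ σ, SupportedIn σ.carrier (((-1 : ℝ) ^ p • w) σ) := fun σ s hs =>
    hw σ s fun h => hs (by simp [h])
  have hn : p + (q + 1) = n + 1 := by omega
  let v : Tot U (n + 1) := totSingle hn _ hw'
  refine ⟨v, fun σ => ?_⟩
  change x.1 p q σ - (nerveBdry U hU _ p (v.1 (p + 1) q) σ
    + (-1 : ℝ) ^ p • finBdry X q (v.1 p (q + 1) σ)) = _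
  rw [totSingle_of_ne _ _ _ (by omega), totSingle_same, map_zero, Pi.zero_apply, zero_add,
    Pi.smul_apply, map_smul, smul_smul, ← mul_pow]
  simp

/-- Cycles of the total complex with zero image in the chains of the nerve can be replaced by
homologous ones with arbitrarily small components in a given bidegree. -/
theorem exists_small_component (hU : IsStarFinite U) (hA : IsL1AcyclicCovering U) {n : ℕ} (q : ℕ) :
    ∀ (p : ℕ), p + q = n → ∀ (ε : Nerve U p → ℝ), (∀ σ, 0 < ε σ) → ∀ x : Tot U n,
      bigradedD U hU x.1 = 0 → toNerve U n x = 0 →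
      ∃ w : Tot U (n + 1), ∀ σ, finNorm ((x - totD U hU n w).1 p q σ) ≤ ε σ := by
  have hA' : ∀ {p : ℕ} (σ : Nerve U p), IsL1Acyclic σ.carrier := fun σ =>
    hA σ.1 σ.nonempty σ.2.2
  induction q with
  | zero =>
    -- In bidegree `(n, 0)` the augmentations vanish because `λ x = 0`.
    rintro p rfl ε hε x hD hx
    choose w hw1 hw2 using fun σ : Nerve U p => exists_approx_zero_in (hA' σ) σ.2.2
      (c := x.1 p 0 σ) (x.2.2 p 0 σ) (congrFun hx σ) (hε σ)
    obtain ⟨v, hv⟩ := exists_boundary_correction hU (Nat.add_zero p) x hw1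
    exact ⟨v, fun σ => (congrArg finNorm (hv σ)).trans_le (hw2 σ)⟩
  | succ q ih =>
    intro p hpq ε hε x hD hx
    choose K hK h using fun σ : Nerve U p => exists_approx_in (hA' σ) q
    -- `M ρ` bounds how much errors on the cofaces of `ρ` are amplified; the `1` makes it positive.
    -- Half of `ε ρ` is reserved for these errors and half for the approximation itself.
    let M : Nerve U p → ℝ := fun ρ =>
      K ρ * ∑ τ ∈ (finite_nerveInc hU ρ).toFinset, |nerveInc τ.1 ρ.1| + 1
    have hM : ∀ ρ, 0 < M ρ := fun ρ => by
      have := mul_nonneg (hK ρ).le (Finset.sum_nonneg (s := (finite_nerveInc hU ρ).toFinset)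
        fun τ _ => abs_nonneg (nerveInc τ.1 ρ.1))
      change 0 < _ + 1
      linarith
    -- The tolerance at `τ` must serve all its faces at once, and there are only finitely many.
    choose ε' hε' hle using fun τ : Nerve U (p + 1) =>
      exists_pos_le_of_finite (finite_faces τ) (g := fun ρ : Nerve U p => ε ρ / 2 / M ρ)
        fun ρ => div_pos (half_pos (hε ρ)) (hM ρ)
    obtain ⟨w₁, hw₁⟩ := ih (p + 1) (by omega) ε' hε' x hD hx
    set x₁ := x - totD U hU n w₁ with hx₁
    have hD₁ : bigradedD U hU x₁.1 = 0 := by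
      change bigradedD U hU (x.1 - bigradedD U hU w₁.1) = 0
      rw [map_sub, hD, bigradedD_bigradedD hU w₁.2, sub_zero]
    have hbd : ∀ ρ : Nerve U p, K ρ * finNorm (finBdry X q (x₁.1 p (q + 1) ρ)) ≤ ε ρ / 2 := by
      intro ρ
      -- The cycle equation in bidegree `(p, q)`: up to sign, the vertical boundary is the
      -- horizontal boundary of the components already made small.
      have h1 : nerveBdry U hU _ p (x₁.1 (p + 1) q) ρ
          + (-1 : ℝ) ^ p • finBdry X q (x₁.1 p (q + 1) ρ) = 0 :=
        congrFun (congrFun (congrFun hD₁ p) q) ρ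
      have h2 : finNorm (finBdry X q (x₁.1 p (q + 1) ρ))
          = finNorm (nerveBdry U hU _ p (x₁.1 (p + 1) q) ρ) := by
        rw [eq_neg_of_add_eq_zero_left h1, finNorm_neg, finNorm_smul]
        simp
      have h3 : finNorm (nerveBdry U hU _ p (x₁.1 (p + 1) q) ρ)
          ≤ (∑ τ ∈ (finite_nerveInc hU ρ).toFinset, |nerveInc τ.1 ρ.1|) * (ε ρ / 2 / M ρ) := by
        rw [nerveBdry_apply, Finset.sum_mul]
        refine (finNorm_sum_le _ _).trans (Finset.sum_le_sum fun τ hτ => ?_)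
        rw [finNorm_smul]
        refine mul_le_mul_of_nonneg_left ((hw₁ τ).trans (hle τ ρ ?_)) (abs_nonneg _)
        simpa using hτ
      rw [h2]
      refine (mul_le_mul_of_nonneg_left h3 (hK ρ).le).trans ?_
      rw [← mul_assoc, mul_div_assoc', div_le_iff₀ (hM ρ), mul_comm]
      refine mul_le_mul_of_nonneg_left ?_ (half_pos (hε ρ)).le
      change _ ≤ _ + 1
      linarith
    choose w hw1 hw2 using fun ρ : Nerve U p =>
      h ρ (x₁.1 p (q + 1) ρ) (x₁.2.2 p (q + 1) ρ) (ε ρ / 2) (half_pos (hε ρ))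
    obtain ⟨v, hv⟩ := exists_boundary_correction hU hpq x₁ hw1
    refine ⟨w₁ + v, fun ρ => ?_⟩
    have h1 : x - totD U hU n (w₁ + v) = x₁ - totD U hU n v := by
      rw [hx₁, map_add]
      exact (sub_sub x _ _).symm
    rw [h1, hv]
    refine (hw2 ρ).trans ?_
    linarith [hbd ρ]

/-- Only the set of members is assumed countable, not the index set. By star finiteness a non-empty
member occurs for finitely many indices, and empty members are not vertices. -/
theorem countable_nerve_zero (hU : IsStarFinite U) (hc : (Set.range U).Countable) :
    Countable (Nerve U 0) := by
  rw [← Set.countable_univ_iff]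
  refine (hc.biUnion (t := fun A _ => {σ : Nerve U 0 | σ.carrier = A}) fun A _ => ?_).mono ?_
  · by_cases h : ∃ σ : Nerve U 0, σ.carrier = A
    · obtain ⟨σ, hσ⟩ := h
      obtain ⟨i, hi⟩ := σ.nonempty
      refine ((finite_meeting hU i 0).subset fun τ hτ => ?_).countable
      obtain ⟨y, hy⟩ := τ.2.2
      refine ⟨y, σ.subset_of_mem hi ?_, hy⟩
      rw [hσ, ← show τ.carrier = A from hτ]
      exact hy
    · refine (Set.countable_empty).mono fun τ hτ => h ⟨τ, hτ⟩
  · intro σ _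
    obtain ⟨i, hi⟩ := Finset.card_eq_one.1 σ.2.1
    refine Set.mem_biUnion (x := U i) ⟨i, rfl⟩ ?_
    change σ.carrier = U i
    rw [Nerve.carrier, hi]
    simp

theorem tsum_enorm_eq_finNorm {α : Type*} (c : α →₀ ℝ) :
    ∑' a, ‖c a‖ₑ = ENNReal.ofReal (finNorm c) := by
  rw [tsum_eq_sum (s := c.support) fun a ha => by simp [Finsupp.notMem_support_iff.1 ha], finNorm,
    ENNReal.ofReal_sum_of_nonneg fun _ _ => abs_nonneg _]
  exact Finset.sum_congr rfl fun a _ => by rw [← Real.norm_eq_abs, ofReal_norm]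

theorem l1Norm_toCf_le (hU : IsStarFinite U) (hP : IsProperCovering U) {n : ℕ} (x : Tot U n) :
    l1Norm (toCf U hU hP n x).1 ≤ ∑' σ, ENNReal.ofReal (finNorm (x.1 0 n σ)) := by
  simp only [← tsum_enorm_eq_finNorm]
  rw [ENNReal.tsum_comm]
  refine ENNReal.tsum_le_tsum fun s => ?_
  change ‖∑ᶠ σ, x.1 0 n σ s‖ₑ ≤ _
  rw [finsum_eq_sum _ (finite_vertices hU x 0 n s)]
  exact (enorm_sum_le _ _).trans (ENNReal.sum_le_tsum _)

/-- One point of each `|σ|`, weighted by `y σ`, has the prescribed augmentation. -/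
theorem exists_toNerve_eq {n : ℕ} (y : Nerve U n → ℝ) : ∃ x : Tot U n, toNerve U n x = y := by
  choose a ha using fun σ : Nerve U n => σ.2.2
  let s : Nerve U n → Sing 0 X := fun σ => ⟨fun _ => a σ, continuous_const⟩
  have hs : ∀ σ, SupportedIn σ.carrier (Finsupp.single (s σ) (y σ)) := fun σ t ht => by
    have : s σ = t := by
      by_contra h
      exact ht (Finsupp.single_eq_of_ne (Ne.symm h))
    rw [← this]
    exact Set.range_subset_iff.2 fun _ => ha σ
  refine ⟨totSingle (Nat.add_zero n) _ hs, funext fun σ => ?_⟩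
  change augmentation 0 X ((totSingle (Nat.add_zero n) _ hs).1 n 0 σ) = y σ
  rw [totSingle_same, augmentation_single]

/-- Cycles of the total complex with zero image in the homology of the nerve have images of zero
norm in the homology of compactly finite chains. -/
theorem exists_small_representative (hU : IsStarFinite U) (hP : IsProperCovering U)
    (hc : (Set.range U).Countable) (hA : IsL1AcyclicCovering U) {n : ℕ} (x : Tot U n)
    (hD : bigradedD U hU x.1 = 0) (y : Nerve U (n + 1) → ℝ)
    (hy : nerveBdry U hU ℝ n y = toNerve U n x) {ε : ENNReal} (hε : ε ≠ 0) :
    ∃ w : Tot U (n + 1), l1Norm (toCf U hU hP n (x - totD U hU n w)).1 ≤ ε := by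
  obtain ⟨v, rfl⟩ := exists_toNerve_eq y
  have := countable_nerve_zero hU hc
  -- Positive tolerances for the vertices with sum below `ε`.
  obtain ⟨δ, hδ, hsum⟩ := ENNReal.exists_pos_sum_of_countable hε (Nerve U 0)
  obtain ⟨w, hw⟩ := exists_small_component hU hA n 0 (Nat.zero_add n) (fun σ => (δ σ : ℝ))
    (fun σ => NNReal.coe_pos.2 (hδ σ)) (x - totD U hU n v) (by
      change bigradedD U hU (x.1 - bigradedD U hU v.1) = 0
      rw [map_sub, hD, bigradedD_bigradedD hU v.2, sub_zero]) (by
      refine (LinearMap.map_sub (toNerve U n) x (totD U hU n v)).trans ?_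
      rw [toNerve_comm, hy, sub_self])
  refine ⟨v + w, ?_⟩
  have h1 : x - totD U hU n (v + w) = x - totD U hU n v - totD U hU n w := by
    rw [map_add]
    exact (sub_sub x _ _).symm
  rw [h1]
  refine (l1Norm_toCf_le hU hP _).trans ((ENNReal.tsum_le_tsum fun σ => ?_).trans hsum.le)
  rw [← ENNReal.ofReal_coe_nnreal]
  exact ENNReal.ofReal_le_ofReal (hw σ)

end Approx

/-! ## Barycentric subdivision of tuples of points -/

section Tuples

theorem map_mem_of_mem_supported {α M : Type*} [AddCommGroup M] [Module ℝ M]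
    {F : (α →₀ ℝ) →ₗ[ℝ] M} {W : Submodule ℝ M} {Q : Set α}
    (h : ∀ a ∈ Q, F (Finsupp.single a 1) ∈ W) {c : α →₀ ℝ} (hc : c ∈ Finsupp.supported ℝ ℝ Q) :
    F c ∈ W := by
  rw [Finsupp.supported_eq_span_single] at hc
  have : Submodule.span ℝ ((fun i => Finsupp.single i (1 : ℝ)) '' Q) ≤ W.comap F :=
    Submodule.span_le.2 (by rintro _ ⟨a, ha, rfl⟩; exact h a ha)
  exact this hc

theorem mem_supported_iff_ne_zero {α : Type*} {Q : Set α} {c : α →₀ ℝ} :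
    c ∈ Finsupp.supported ℝ ℝ Q ↔ ∀ a, c a ≠ 0 → a ∈ Q := by
  rw [Finsupp.mem_supported']
  exact forall_congr' fun a => not_imp_comm

variable {P P' : Type*}

/-- Finite chains of tuples with `k + 1` entries. -/
abbrev TupleChain (k : ℕ) (P : Type*) : Type _ := (Fin (k + 1) → P) →₀ ℝ

/-- The boundary of chains of tuples. -/
def tupleBdry (k : ℕ) : TupleChain (k + 1) P →ₗ[ℝ] TupleChain k P :=
  Finsupp.linearCombination ℝ fun v =>
    ∑ i : Fin (k + 2), (-1 : ℝ) ^ (i : ℕ) • Finsupp.single (v ∘ i.succAbove) 1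

theorem tupleBdry_single (k : ℕ) (v : Fin (k + 2) → P) :
    tupleBdry k (Finsupp.single v 1)
      = ∑ i : Fin (k + 2), (-1 : ℝ) ^ (i : ℕ) • Finsupp.single (v ∘ i.succAbove) (1 : ℝ) := by
  rw [tupleBdry, Finsupp.linearCombination_single, one_smul]

theorem linearMap_ext_single {α M : Type*} [AddCommGroup M] [Module ℝ M]
    {F G : (α →₀ ℝ) →ₗ[ℝ] M} (h : ∀ a, F (Finsupp.single a 1) = G (Finsupp.single a 1)) : F = G :=
  Finsupp.lhom_ext' fun a => LinearMap.ext_ring (h a)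

theorem tupleBdry_tupleBdry (k : ℕ) (c : TupleChain (k + 2) P) :
    tupleBdry k (tupleBdry (k + 1) c) = 0 := by
  suffices h : (tupleBdry k).comp (tupleBdry (P := P) (k + 1)) = 0 from LinearMap.congr_fun h c
  refine linearMap_ext_single fun v => ?_
  simp only [LinearMap.comp_apply, tupleBdry_single, map_sum, map_smul, LinearMap.zero_apply,
    Finset.smul_sum, smul_smul]
  refine sum_alternating_eq_zero
    (fun i j => Finsupp.single ((v ∘ i.succAbove) ∘ j.succAbove) (1 : ℝ)) fun i j h => ?_
  rw [Function.comp_assoc, Function.comp_assoc, succAbove_comp_succAbove h]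

/-- The cone over a tuple. -/
def consTuple {k : ℕ} (x : P) (v : Fin (k + 1) → P) : Fin (k + 2) → P := Fin.cons x v

/-- The cone operator on chains of tuples. -/
def tupleCone (k : ℕ) (x : P) : TupleChain k P →ₗ[ℝ] TupleChain (k + 1) P :=
  Finsupp.lmapDomain ℝ ℝ (consTuple x)

theorem tupleCone_single {k : ℕ} (x : P) (v : Fin (k + 1) → P) :
    tupleCone k x (Finsupp.single v 1) = Finsupp.single (consTuple x v) 1 := by
  rw [tupleCone, Finsupp.lmapDomain_apply, Finsupp.mapDomain_single]

theorem consTuple_comp_zero {k : ℕ} (x : P) (v : Fin (k + 1) → P) :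
    consTuple x v ∘ Fin.succAbove 0 = v := by
  funext j
  simp [consTuple]

theorem consTuple_comp_succ {k : ℕ} (x : P) (v : Fin (k + 2) → P) (i : Fin (k + 2)) :
    consTuple x v ∘ Fin.succAbove i.succ = consTuple x (v ∘ i.succAbove) := by
  funext j
  refine Fin.cases ?_ (fun j => ?_) j
  · simp [consTuple]
  · simp [consTuple]

/-- Deleting the apex returns `c`; deleting another entry gives the cone over a face. In degree zero
an augmentation term would appear, so the homotopies below treat that degree separately. -/
theorem tupleBdry_tupleCone (k : ℕ) (x : P) (c : TupleChain (k + 1) P) :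
    tupleBdry (k + 1) (tupleCone (k + 1) x c) = c - tupleCone k x (tupleBdry k c) := by
  suffices h : (tupleBdry (k + 1)).comp (tupleCone (k + 1) x)
      = LinearMap.id - (tupleCone k x).comp (tupleBdry k) from LinearMap.congr_fun h c
  refine linearMap_ext_single fun v => ?_
  simp only [LinearMap.comp_apply, LinearMap.sub_apply, LinearMap.id_apply, tupleCone_single,
    tupleBdry_single, map_sum, map_smul]
  rw [Fin.sum_univ_succ, consTuple_comp_zero, sub_eq_add_neg, ← Finset.sum_neg_distrib]
  congr 1
  · simp
  · refine Finset.sum_congr rfl fun i _ => ?_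
    rw [consTuple_comp_succ, Fin.val_succ, pow_succ, mul_neg_one, neg_smul]

variable (b : ∀ k, (Fin (k + 1) → P) → P) (b' : ∀ k, (Fin (k + 1) → P') → P')

/-- The barycentric subdivision, with `b` assigning barycenters to tuples. -/
def subdiv : ∀ k, TupleChain k P →ₗ[ℝ] TupleChain k P
  | 0 => LinearMap.id
  | k + 1 => Finsupp.linearCombination ℝ fun v =>
      tupleCone k (b (k + 1) v) (subdiv k (tupleBdry k (Finsupp.single v 1)))

/-- The chain homotopy between the identity and the barycentric subdivision. -/
def subdivHtpy : ∀ k, TupleChain k P →ₗ[ℝ] TupleChain (k + 1) P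
  | 0 => 0
  | k + 1 => Finsupp.linearCombination ℝ fun v => tupleCone (k + 1) (b (k + 1) v)
      (Finsupp.single v 1 - subdivHtpy k (tupleBdry k (Finsupp.single v 1)))

theorem subdiv_succ_single (k : ℕ) (v : Fin (k + 2) → P) :
    subdiv b (k + 1) (Finsupp.single v 1)
      = tupleCone k (b (k + 1) v) (subdiv b k (tupleBdry k (Finsupp.single v 1))) := by
  rw [subdiv, Finsupp.linearCombination_single, one_smul]

theorem subdivHtpy_succ_single (k : ℕ) (v : Fin (k + 2) → P) :
    subdivHtpy b (k + 1) (Finsupp.single v 1) = tupleCone (k + 1) (b (k + 1) v)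
      (Finsupp.single v 1 - subdivHtpy b k (tupleBdry k (Finsupp.single v 1))) := by
  rw [subdivHtpy, Finsupp.linearCombination_single, one_smul]

theorem tupleBdry_subdivHtpy_zero (c : TupleChain 0 P) :
    tupleBdry 0 (subdivHtpy b 0 c) = c - subdiv b 0 c := by
  simp [subdivHtpy, subdiv]

/-- The cone formula in degree `k + 1` needs the homotopy formula in degree `k` only on boundaries,
where the term with `∂∂` drops out. -/
theorem tupleBdry_subdivHtpy (k : ℕ) : ∀ c : TupleChain (k + 1) P,
    tupleBdry (k + 1) (subdivHtpy b (k + 1) c) + subdivHtpy b k (tupleBdry k c)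
      = c - subdiv b (k + 1) c := by
  have main : ∀ k : ℕ, (∀ c : TupleChain (k + 1) P,
      tupleBdry k (subdivHtpy b k (tupleBdry k c)) = tupleBdry k c - subdiv b k (tupleBdry k c)) →
      ∀ c : TupleChain (k + 1) P,
      tupleBdry (k + 1) (subdivHtpy b (k + 1) c) + subdivHtpy b k (tupleBdry k c)
        = c - subdiv b (k + 1) c := by
    intro k hk c
    suffices h : (tupleBdry (k + 1)).comp (subdivHtpy b (k + 1))
        + (subdivHtpy b k).comp (tupleBdry k) = LinearMap.id - subdiv b (k + 1) from
      LinearMap.congr_fun h c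
    refine linearMap_ext_single fun v => ?_
    simp only [LinearMap.comp_apply, LinearMap.sub_apply, LinearMap.add_apply, LinearMap.id_apply]
    rw [subdivHtpy_succ_single, tupleBdry_tupleCone, map_sub, hk, sub_sub_cancel,
      subdiv_succ_single]
    abel
  induction k with
  | zero => exact main 0 fun c => tupleBdry_subdivHtpy_zero b _
  | succ k ih =>
    refine main (k + 1) fun c => ?_
    have h := ih (tupleBdry (k + 1) c)
    rwa [tupleBdry_tupleBdry, map_zero, add_zero] at h

/-- No separate induction is needed: apply the boundary to the homotopy formula for `c` and compare
with the homotopy formula for `∂c`. -/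
theorem tupleBdry_subdiv (k : ℕ) (c : TupleChain (k + 1) P) :
    tupleBdry k (subdiv b (k + 1) c) = subdiv b k (tupleBdry k c) := by
  have h1 := congrArg (tupleBdry k) (tupleBdry_subdivHtpy b k c)
  have h2 : tupleBdry k (subdivHtpy b k (tupleBdry k c))
      = tupleBdry k c - subdiv b k (tupleBdry k c) := by
    cases k with
    | zero => exact tupleBdry_subdivHtpy_zero b _
    | succ k =>
      have h := tupleBdry_subdivHtpy b k (tupleBdry (k + 1) c)
      rwa [tupleBdry_tupleBdry, map_zero, add_zero] at h
  rw [map_add, tupleBdry_tupleBdry, zero_add, h2, map_sub] at h1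
  exact (sub_right_injective h1).symm

/-- The iterated subdivision. -/
def iterSubdiv (k : ℕ) : ℕ → TupleChain k P →ₗ[ℝ] TupleChain k P
  | 0 => LinearMap.id
  | m + 1 => (iterSubdiv k m).comp (subdiv b k)

/-- The chain homotopy between the identity and the iterated subdivision. -/
def iterHtpy (k : ℕ) : ℕ → TupleChain k P →ₗ[ℝ] TupleChain (k + 1) P
  | 0 => 0
  | m + 1 => subdivHtpy b k + (iterHtpy k m).comp (subdiv b k)

theorem tupleBdry_iterHtpy (k m : ℕ) (c : TupleChain (k + 1) P) :
    tupleBdry (k + 1) (iterHtpy b (k + 1) m c) + iterHtpy b k m (tupleBdry k c)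
      = c - iterSubdiv b (k + 1) m c := by
  induction m generalizing c with
  | zero => simp [iterHtpy, iterSubdiv]
  | succ m ih =>
    have h1 := ih (subdiv b (k + 1) c)
    have h2 := tupleBdry_subdivHtpy b k c
    simp only [iterHtpy, iterSubdiv, LinearMap.add_apply, LinearMap.comp_apply, map_add]
    rw [← tupleBdry_subdiv]
    rw [show c - iterSubdiv b (k + 1) m (subdiv b (k + 1) c) = (c - subdiv b (k + 1) c)
      + (subdiv b (k + 1) c - iterSubdiv b (k + 1) m (subdiv b (k + 1) c)) by abel, ← h1, ← h2]
    abel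

/-- The map of chains of tuples induced by a map of points. -/
def pushTuple (f : P → P') (k : ℕ) : TupleChain k P →ₗ[ℝ] TupleChain k P' :=
  Finsupp.lmapDomain ℝ ℝ fun v => f ∘ v

theorem pushTuple_single (f : P → P') {k : ℕ} (v : Fin (k + 1) → P) :
    pushTuple f k (Finsupp.single v 1) = Finsupp.single (f ∘ v) 1 := by
  rw [pushTuple, Finsupp.lmapDomain_apply, Finsupp.mapDomain_single]

theorem tupleBdry_pushTuple (f : P → P') (k : ℕ) (c : TupleChain (k + 1) P) :
    tupleBdry k (pushTuple f (k + 1) c) = pushTuple f k (tupleBdry k c) := by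
  suffices h : (tupleBdry k).comp (pushTuple f (k + 1)) = (pushTuple f k).comp (tupleBdry k) from
    LinearMap.congr_fun h c
  refine linearMap_ext_single fun v => ?_
  simp only [LinearMap.comp_apply, pushTuple_single, tupleBdry_single, map_sum, map_smul]
  rfl

theorem tupleCone_pushTuple (f : P → P') (k : ℕ) (x : P) (c : TupleChain k P) :
    tupleCone k (f x) (pushTuple f k c) = pushTuple f (k + 1) (tupleCone k x c) := by
  suffices h : (tupleCone k (f x)).comp (pushTuple f k)
      = (pushTuple f (k + 1)).comp (tupleCone k x) from LinearMap.congr_fun h c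
  refine linearMap_ext_single fun v => ?_
  simp only [LinearMap.comp_apply, pushTuple_single, tupleCone_single]
  congr 1
  funext j
  refine Fin.cases ?_ (fun j => ?_) j
  · simp [consTuple]
  · simp [consTuple]

variable {b b'} {f : P → P'} (hf : ∀ k v, f (b k v) = b' k (f ∘ v))
include hf

/-- Naturality holds for maps preserving the chosen barycenters. It is used for face inclusions of
standard simplices, which are affine. -/
theorem subdiv_pushTuple (k : ℕ) (c : TupleChain k P) :
    subdiv b' k (pushTuple f k c) = pushTuple f k (subdiv b k c) := by
  induction k with
  | zero => rfl
  | succ k ih =>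
    suffices h : (subdiv b' (k + 1)).comp (pushTuple f (k + 1))
        = (pushTuple f (k + 1)).comp (subdiv b (k + 1)) from LinearMap.congr_fun h c
    refine linearMap_ext_single fun v => ?_
    simp only [LinearMap.comp_apply]
    rw [pushTuple_single, subdiv_succ_single, subdiv_succ_single, ← tupleCone_pushTuple, ← ih,
      ← tupleBdry_pushTuple, pushTuple_single, hf]

theorem subdivHtpy_pushTuple (k : ℕ) (c : TupleChain k P) :
    subdivHtpy b' k (pushTuple f k c) = pushTuple f (k + 1) (subdivHtpy b k c) := by
  induction k with
  | zero => simp [subdivHtpy]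
  | succ k ih =>
    suffices h : (subdivHtpy b' (k + 1)).comp (pushTuple f (k + 1))
        = (pushTuple f (k + 2)).comp (subdivHtpy b (k + 1)) from LinearMap.congr_fun h c
    refine linearMap_ext_single fun v => ?_
    simp only [LinearMap.comp_apply]
    rw [pushTuple_single, subdivHtpy_succ_single, subdivHtpy_succ_single, ← tupleCone_pushTuple,
      map_sub (pushTuple f (k + 1)), ← ih, ← tupleBdry_pushTuple, pushTuple_single, hf]

theorem iterHtpy_pushTuple (k m : ℕ) (c : TupleChain k P) :
    iterHtpy b' k m (pushTuple f k c) = pushTuple f (k + 1) (iterHtpy b k m c) := by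
  induction m generalizing c with
  | zero => simp [iterHtpy]
  | succ m ih =>
    simp only [iterHtpy, LinearMap.add_apply, LinearMap.comp_apply, map_add]
    rw [subdivHtpy_pushTuple hf, subdiv_pushTuple hf, ih]

end Tuples

/-! ## Affine simplices in standard simplices -/

section Affine

/-- The points of the standard `n`-simplex. -/
abbrev SimplexPt (n : ℕ) : Type := stdSimplex ℝ (Fin (n + 1))

/-- The affine combination of a tuple of points of a standard simplex. -/
def affineComb {k n : ℕ} (v : Fin (k + 1) → SimplexPt n) (t : SimplexPt k) : SimplexPt n :=
  ⟨∑ i, t i • (v i).1, (convex_stdSimplex ℝ (Fin (n + 1))).sum_mem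
    (fun i _ => stdSimplex.zero_le t i) (stdSimplex.sum_eq_one t) fun i _ => (v i).2⟩

theorem affineComb_apply {k n : ℕ} (v : Fin (k + 1) → SimplexPt n) (t : SimplexPt k)
    (j : Fin (n + 1)) : affineComb v t j = ∑ i, t i * v i j := by
  change (∑ i, t i • (v i).1) j = _
  rw [Finset.sum_apply]
  rfl

theorem continuous_coord {n : ℕ} (i : Fin (n + 1)) : Continuous fun t : SimplexPt n => t i :=
  (continuous_apply i).comp continuous_subtype_val

theorem continuous_affineComb {k n : ℕ} (v : Fin (k + 1) → SimplexPt n) :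
    Continuous (affineComb v) :=
  Continuous.subtype_mk (continuous_finsetSum _ fun i _ =>
    (continuous_coord i).smul continuous_const) _

theorem sum_map_mul {k n : ℕ} (f : Fin (k + 1) → Fin (n + 1)) (t : SimplexPt k)
    (g : Fin (n + 1) → ℝ) : ∑ i, stdSimplex.map f t i * g i = ∑ a, t a * g (f a) := by
  simp only [stdSimplex.map_coe, FunOnFinite.linearMap_apply_apply, Finset.sum_mul]
  rw [← Finset.sum_fiberwise Finset.univ f fun a => t a * g (f a)]
  refine Finset.sum_congr rfl fun i _ => Finset.sum_congr rfl fun a ha => ?_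
  rw [(Finset.mem_filter.1 ha).2]

theorem affineComb_map {k l n : ℕ} (v : Fin (k + 1) → SimplexPt n) (f : Fin (l + 1) → Fin (k + 1))
    (t : SimplexPt l) : affineComb v (stdSimplex.map f t) = affineComb (v ∘ f) t := by
  ext j
  rw [affineComb_apply, affineComb_apply]
  exact sum_map_mul f t fun i => v i j

theorem affineComb_vertex {n : ℕ} (t : SimplexPt n) : affineComb stdSimplex.vertex t = t := by
  ext j
  rw [affineComb_apply, Finset.sum_eq_single_of_mem j (Finset.mem_univ j)]
  · simp
  · intro i _ hi
    simp [Pi.single_eq_of_ne (Ne.symm hi)]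

theorem map_affineComb {k l n : ℕ} (f : Fin (n + 1) → Fin (l + 1))
    (v : Fin (k + 1) → SimplexPt n) (t : SimplexPt k) :
    stdSimplex.map f (affineComb v t) = affineComb (stdSimplex.map f ∘ v) t := by
  ext j
  rw [affineComb_apply]
  simp only [Function.comp_apply, stdSimplex.map_coe, FunOnFinite.linearMap_apply_apply,
    affineComb_apply, Finset.mul_sum]
  rw [Finset.sum_comm]

/-- The barycenter of a tuple of points of a standard simplex. -/
def tupleBary (n : ℕ) (k : ℕ) (v : Fin (k + 1) → SimplexPt n) : SimplexPt n :=
  affineComb v stdSimplex.barycenter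

/-- Convexity of the distance, checked coordinatewise because the metric is the sup metric. -/
theorem dist_affineComb_le {k n : ℕ} {v : Fin (k + 1) → SimplexPt n} {x : SimplexPt n}
    {r : Fin (k + 1) → ℝ} (h : ∀ i, dist (v i) x ≤ r i) (t : SimplexPt k) :
    dist (affineComb v t) x ≤ ∑ i, t i * r i := by
  have hr : ∀ i, 0 ≤ r i := fun i => dist_nonneg.trans (h i)
  rw [Subtype.dist_eq, dist_pi_le_iff (Finset.sum_nonneg fun i _ =>
    mul_nonneg (stdSimplex.zero_le t i) (hr i))]
  intro j
  rw [Real.dist_eq]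
  have h1 : (affineComb v t).1 j - x.1 j = ∑ i, t i * ((v i).1 j - x.1 j) := by
    simp only [mul_sub, Finset.sum_sub_distrib, ← Finset.sum_mul, stdSimplex.sum_eq_one, one_mul]
    exact congrArg (· - x.1 j) (affineComb_apply v t j)
  rw [h1]
  refine (Finset.abs_sum_le_sum_abs _ _).trans (Finset.sum_le_sum fun i _ => ?_)
  rw [abs_mul, abs_of_nonneg (stdSimplex.zero_le t i)]
  refine mul_le_mul_of_nonneg_left ?_ (stdSimplex.zero_le t i)
  exact (dist_le_pi_dist (v i).1 x.1 j).trans (h i)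

theorem dist_affineComb_le_const {k n : ℕ} {v : Fin (k + 1) → SimplexPt n} {x : SimplexPt n}
    {r : ℝ} (h : ∀ i, dist (v i) x ≤ r) (t : SimplexPt k) : dist (affineComb v t) x ≤ r := by
  refine (dist_affineComb_le h t).trans_eq ?_
  rw [← Finset.sum_mul, stdSimplex.sum_eq_one, one_mul]

/-- Of the `k + 1` equally weighted entries, `v j` itself contributes zero, which leaves the factor
`k / (k + 1)`. -/
theorem dist_tupleBary_le {k n : ℕ} {v : Fin (k + 1) → SimplexPt n} {d : ℝ}
    (h : ∀ i j, dist (v i) (v j) ≤ d) (j : Fin (k + 1)) :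
    dist (tupleBary n k v) (v j) ≤ k / (k + 1) * d := by
  classical
  have h1 := dist_affineComb_le (v := v) (x := v j) (r := fun i => if i = j then 0 else d)
    (fun i => by
      by_cases hi : i = j
      · simp [hi]
      · rw [if_neg hi]
        exact h i j) stdSimplex.barycenter
  refine h1.trans_eq ?_
  have h2 : ∀ i : Fin (k + 1), (stdSimplex.barycenter : SimplexPt k) i = ((k : ℝ) + 1)⁻¹ :=
    fun i => by
      change ((Fintype.card (Fin (k + 1)) : ℝ))⁻¹ = _
      simp
  simp only [h2]
  rw [← Finset.mul_sum, Finset.sum_ite, Finset.sum_const_zero, zero_add, Finset.sum_const,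
    Finset.filter_ne', Finset.card_erase_of_mem (Finset.mem_univ j), Finset.card_univ,
    Fintype.card_fin, Nat.add_sub_cancel, nsmul_eq_mul]
  ring

/-- The tuples all of whose points have distance at most `r` from `x`. -/
def tuplesNear {n : ℕ} (k : ℕ) (x : SimplexPt n) (r : ℝ) : Set (Fin (k + 1) → SimplexPt n) :=
  {v | ∀ i, dist (v i) x ≤ r}

/-- The tuples of diameter at most `d`. -/
def tuplesDiam (n k : ℕ) (d : ℝ) : Set (Fin (k + 1) → SimplexPt n) :=
  {v | ∀ i j, dist (v i) (v j) ≤ d}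

theorem tupleBdry_mem_supported {n k : ℕ} {Q : Set (Fin (k + 1) → SimplexPt n)}
    {v : Fin (k + 2) → SimplexPt n} (h : ∀ i : Fin (k + 2), v ∘ i.succAbove ∈ Q) :
    tupleBdry k (Finsupp.single v 1) ∈ Finsupp.supported ℝ ℝ Q := by
  rw [tupleBdry_single]
  exact Submodule.sum_mem _ fun i _ => Submodule.smul_mem _ _ (Finsupp.single_mem_supported ℝ 1 (h i))

/-- Balls are convex and subdivision adds only barycenters. -/
theorem subdiv_mem_tuplesNear {n : ℕ} (k : ℕ) {x : SimplexPt n} {r : ℝ} :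
    ∀ c ∈ Finsupp.supported ℝ ℝ (tuplesNear k x r),
      subdiv (tupleBary n) k c ∈ Finsupp.supported ℝ ℝ (tuplesNear k x r) := by
  induction k with
  | zero => exact fun c hc => hc
  | succ k ih =>
    intro c hc
    refine map_mem_of_mem_supported (fun v hv => ?_) hc
    rw [subdiv_succ_single]
    refine map_mem_of_mem_supported (fun w hw => ?_)
      (ih _ (tupleBdry_mem_supported fun i j => hv (i.succAbove j)))
    rw [tupleCone_single]
    refine Finsupp.single_mem_supported ℝ 1 fun i => ?_
    refine Fin.cases ?_ (fun j => ?_) i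
    · exact dist_affineComb_le_const hv _
    · exact hw j

/-- A tuple of the subdivision is the barycenter followed by a tuple of a subdivided face. Distances
inside the latter are bounded by induction. Its distances to the barycenter are bounded because all
entries of `v` lie in a ball around the barycenter, which subdivision does not leave. -/
theorem subdiv_mem_tuplesDiam {n : ℕ} (k : ℕ) {d : ℝ} (hd : 0 ≤ d) :
    ∀ c ∈ Finsupp.supported ℝ ℝ (tuplesDiam n k d), subdiv (tupleBary n) k c ∈
      Finsupp.supported ℝ ℝ (tuplesDiam n k (k / (k + 1) * d)) := by
  induction k with
  | zero =>
    intro c hc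
    refine map_mem_of_mem_supported (fun v hv => ?_) hc
    refine Finsupp.single_mem_supported ℝ 1 fun i j => ?_
    rw [Subsingleton.elim (α := Fin 1) i j, dist_self]
    simp
  | succ k ih =>
    intro c hc
    refine map_mem_of_mem_supported (fun v hv => ?_) hc
    rw [subdiv_succ_single]
    have h1 : subdiv (tupleBary n) k (tupleBdry k (Finsupp.single v 1)) ∈
        Finsupp.supported ℝ ℝ (tuplesDiam n k (k / (k + 1) * d) ∩
          tuplesNear k (tupleBary n (k + 1) v) ((k + 1 : ℕ) / ((k + 1 : ℕ) + 1) * d)) := by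
      rw [Finsupp.supported_inter]
      refine ⟨ih _ (tupleBdry_mem_supported fun i a b => hv _ _),
        subdiv_mem_tuplesNear k _ (tupleBdry_mem_supported fun i a => ?_)⟩
      rw [dist_comm]
      exact dist_tupleBary_le hv _
    refine map_mem_of_mem_supported (fun w hw => ?_) h1
    rw [tupleCone_single]
    have hle : (k : ℝ) / (k + 1) * d ≤ (k + 1 : ℕ) / ((k + 1 : ℕ) + 1) * d := by
      refine mul_le_mul_of_nonneg_right ?_ hd
      rw [div_le_div_iff₀ (by positivity) (by positivity)]
      push_cast
      nlinarith
    refine Finsupp.single_mem_supported ℝ 1 fun i j => ?_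
    refine Fin.cases ?_ (fun i => ?_) i <;> refine Fin.cases ?_ (fun j => ?_) j
    · rw [dist_self]
      positivity
    · rw [dist_comm]
      exact hw.2 j
    · exact hw.2 i
    · exact (hw.1 i j).trans hle

theorem iterSubdiv_mem_tuplesDiam {n k m : ℕ} {d : ℝ} (hd : 0 ≤ d) :
    ∀ c ∈ Finsupp.supported ℝ ℝ (tuplesDiam n k d), iterSubdiv (tupleBary n) k m c ∈
      Finsupp.supported ℝ ℝ (tuplesDiam n k (((k : ℝ) / (k + 1)) ^ m * d)) := by
  induction m generalizing d with
  | zero =>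
    intro c hc
    rwa [pow_zero, one_mul]
  | succ m ih =>
    intro c hc
    rw [pow_succ, mul_assoc]
    exact ih (by positivity) _ (subdiv_mem_tuplesDiam k hd c hc)

theorem dist_simplexPt_le {n : ℕ} (x y : SimplexPt n) : dist x y ≤ 1 := by
  rw [Subtype.dist_eq, dist_pi_le_iff zero_le_one]
  intro j
  rw [Real.dist_eq, abs_sub_le_iff]
  have h1 := stdSimplex.zero_le x j
  have h2 := stdSimplex.zero_le y j
  have h3 := stdSimplex.le_one x j
  have h4 := stdSimplex.le_one y j
  change x j - y j ≤ 1 ∧ y j - x j ≤ 1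
  constructor <;> linarith

end Affine

/-! ## Subdivision of singular chains -/

section SingularSubdivision

variable {X : Type*} [TopologicalSpace X]

/-- The singular simplex obtained by restricting `s` to the affine simplex spanned by a tuple. -/
def affineRestrict {n k : ℕ} (s : Sing n X) (v : Fin (k + 1) → SimplexPt n) : Sing k X :=
  s.comp ⟨affineComb v, continuous_affineComb v⟩

theorem range_affineRestrict {n k : ℕ} (s : Sing n X) (v : Fin (k + 1) → SimplexPt n) :
    Set.range (affineRestrict s v) ⊆ Set.range s := by
  rintro _ ⟨t, rfl⟩
  exact ⟨_, rfl⟩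

theorem face_affineRestrict {n k : ℕ} (s : Sing n X) (v : Fin (k + 2) → SimplexPt n)
    (i : Fin (k + 2)) : face i (affineRestrict s v) = affineRestrict s (v ∘ i.succAbove) := by
  ext t
  exact congrArg s (affineComb_map v i.succAbove t)

theorem affineRestrict_vertex {n : ℕ} (s : Sing n X) :
    affineRestrict s stdSimplex.vertex = s := by
  ext t
  exact congrArg s (affineComb_vertex t)

theorem affineRestrict_face {n k : ℕ} (s : Sing (n + 1) X) (i : Fin (n + 2))
    (v : Fin (k + 1) → SimplexPt n) :
    affineRestrict (face i s) v = affineRestrict s (stdSimplex.map i.succAbove ∘ v) := by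
  ext t
  exact congrArg s (map_affineComb i.succAbove v t)

/-- The map from chains of tuples to singular chains given by a singular simplex. -/
def realize {n : ℕ} (s : Sing n X) (k : ℕ) : TupleChain k (SimplexPt n) →ₗ[ℝ] (Sing k X →₀ ℝ) :=
  Finsupp.lmapDomain ℝ ℝ (affineRestrict s)

theorem realize_single {n k : ℕ} (s : Sing n X) (v : Fin (k + 1) → SimplexPt n) :
    realize s k (Finsupp.single v 1) = Finsupp.single (affineRestrict s v) 1 := by
  rw [realize, Finsupp.lmapDomain_apply, Finsupp.mapDomain_single]

theorem finBdry_realize {n k : ℕ} (s : Sing n X) (c : TupleChain (k + 1) (SimplexPt n)) :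
    finBdry X k (realize s (k + 1) c) = realize s k (tupleBdry k c) := by
  suffices h : (finBdry X k).comp (realize s (k + 1)) = (realize s k).comp (tupleBdry k) from
    LinearMap.congr_fun h c
  refine linearMap_ext_single fun v => ?_
  simp only [LinearMap.comp_apply, realize_single, finBdry_single, tupleBdry_single, map_sum,
    map_smul, face_affineRestrict]

theorem realize_face {n k : ℕ} (s : Sing (n + 1) X) (i : Fin (n + 2))
    (c : TupleChain k (SimplexPt n)) :
    realize (face i s) k c = realize s k (pushTuple (stdSimplex.map i.succAbove) k c) := by
  suffices h : realize (face i s) k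
      = (realize s k).comp (pushTuple (stdSimplex.map i.succAbove) k) from LinearMap.congr_fun h c
  refine linearMap_ext_single fun v => ?_
  rw [LinearMap.comp_apply, pushTuple_single, realize_single, realize_single, affineRestrict_face]

/-- The tuple of vertices of the standard simplex, as a chain. -/
def vertexChain (n : ℕ) : TupleChain n (SimplexPt n) :=
  Finsupp.single stdSimplex.vertex 1

theorem realize_vertexChain {n : ℕ} (s : Sing n X) :
    realize s n (vertexChain n) = Finsupp.single s 1 := by
  rw [vertexChain, realize_single, affineRestrict_vertex]

theorem tupleBdry_vertexChain (n : ℕ) : tupleBdry n (vertexChain (n + 1))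
    = ∑ i : Fin (n + 2), (-1 : ℝ) ^ (i : ℕ) •
      pushTuple (stdSimplex.map i.succAbove) n (vertexChain n) := by
  rw [vertexChain, tupleBdry_single]
  refine Finset.sum_congr rfl fun i _ => ?_
  rw [vertexChain, pushTuple_single]
  congr 2
  funext a
  exact (stdSimplex.map_vertex _ _).symm

theorem tupleBary_map (n k : ℕ) (i : Fin (n + 2)) (v : Fin (k + 1) → SimplexPt n) :
    stdSimplex.map i.succAbove (tupleBary n k v)
      = tupleBary (n + 1) k (stdSimplex.map i.succAbove ∘ v) :=
  map_affineComb _ _ _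

/-- The operator on singular chains given by a chain of tuples in the standard simplex. -/
def singOp {n k : ℕ} (X : Type*) [TopologicalSpace X] (θ : TupleChain k (SimplexPt n)) :
    (Sing n X →₀ ℝ) →ₗ[ℝ] (Sing k X →₀ ℝ) :=
  Finsupp.linearCombination ℝ fun s => realize s k θ

theorem singOp_single {n k : ℕ} (θ : TupleChain k (SimplexPt n)) (s : Sing n X) :
    singOp X θ (Finsupp.single s 1) = realize s k θ := by
  rw [singOp, Finsupp.linearCombination_single, one_smul]

theorem carried_iff {n m : ℕ} {F : (Sing n X →₀ ℝ) →ₗ[ℝ] (Sing m X →₀ ℝ)} :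
    Carried F ↔ ∀ s : Sing n X, F (Finsupp.single s 1) ∈
      Finsupp.supported ℝ ℝ {t : Sing m X | Set.range t ⊆ Set.range s} := by
  simp only [mem_supported_iff_ne_zero]
  rfl

theorem carried_singOp {n k : ℕ} (θ : TupleChain k (SimplexPt n)) : Carried (singOp X θ) := by
  refine carried_iff.2 fun s => ?_
  rw [singOp_single]
  refine map_mem_of_mem_supported (Q := Set.univ) (fun v _ => ?_) (by simp)
  rw [realize_single]
  exact Finsupp.single_mem_supported ℝ 1 (range_affineRestrict s v)

/-- The iterated barycentric subdivision is chain homotopic to the identity. -/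
theorem finBdry_singOp_iterHtpy (n m : ℕ) (c : Sing (n + 1) X →₀ ℝ) :
    finBdry X (n + 1) (singOp X (iterHtpy (tupleBary (n + 1)) (n + 1) m (vertexChain (n + 1))) c)
      + singOp X (iterHtpy (tupleBary n) n m (vertexChain n)) (finBdry X n c)
      = c - singOp X (iterSubdiv (tupleBary (n + 1)) (n + 1) m (vertexChain (n + 1))) c := by
  suffices h : (finBdry X (n + 1)).comp
      (singOp X (iterHtpy (tupleBary (n + 1)) (n + 1) m (vertexChain (n + 1))))
      + (singOp X (iterHtpy (tupleBary n) n m (vertexChain n))).comp (finBdry X n)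
      = LinearMap.id - singOp X (iterSubdiv (tupleBary (n + 1)) (n + 1) m (vertexChain (n + 1))) from
    LinearMap.congr_fun h c
  refine linearMap_ext_single fun s => ?_
  simp only [LinearMap.comp_apply, LinearMap.sub_apply, LinearMap.add_apply, LinearMap.id_apply,
    singOp_single, finBdry_realize, finBdry_single, map_sum, map_smul, realize_face]
  rw [← realize_vertexChain s, ← map_sub, ← tupleBdry_iterHtpy, map_add, tupleBdry_vertexChain,
    map_sum, map_sum]
  congr 1
  refine Finset.sum_congr rfl fun i _ => ?_
  rw [map_smul, map_smul, iterHtpy_pushTuple (tupleBary_map n · i)]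

variable {ι : Type*} {U : ι → Set X}

/-- The finite chains of small simplices. -/
abbrev smallChains (U : ι → Set X) (n : ℕ) : Submodule ℝ (Sing n X →₀ ℝ) :=
  Finsupp.supported ℝ ℝ {s | Small U s}

theorem Carried.mem_supported_small {n m : ℕ} {F : (Sing n X →₀ ℝ) →ₗ[ℝ] (Sing m X →₀ ℝ)}
    (hF : Carried F) {c : Sing n X →₀ ℝ} (hc : c ∈ smallChains U n) :
    F c ∈ smallChains U m :=
  map_mem_of_mem_supported (fun s hs => Finsupp.supported_mono
    (fun _ ht => hs.imp fun _ hi => Set.Subset.trans ht hi) (carried_iff.1 hF s)) hc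

/-- By the Lebesgue number lemma on the standard simplex, tuples of small diameter have small image,
and the diameters tend to zero. The form "eventually" allows finitely many simplices to share one
`m`. -/
theorem eventually_iterSubdiv_small (hP : IsProperCovering U) {n : ℕ} (s : Sing n X) :
    ∀ᶠ m in Filter.atTop, realize s n (iterSubdiv (tupleBary n) n m (vertexChain n)) ∈
      smallChains U n := by
  obtain ⟨δ, hδ, h⟩ := lebesgue_number_lemma_of_metric (s := Set.univ) isCompact_univ
    (c := fun i => s ⁻¹' interior (U i)) (fun i => isOpen_interior.preimage s.continuous) (by
      rw [← Set.preimage_iUnion, hP.1]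
      exact Set.subset_univ _)
  have hlim : Filter.Tendsto (fun m : ℕ => ((n : ℝ) / (n + 1)) ^ m) Filter.atTop (nhds 0) :=
    tendsto_pow_atTop_nhds_zero_of_lt_one (by positivity)
      ((div_lt_one (by positivity)).2 (lt_add_one _))
  filter_upwards [hlim.eventually_lt_const hδ] with m hm
  have h1 := iterSubdiv_mem_tuplesDiam (m := m) zero_le_one (vertexChain n)
    (Finsupp.single_mem_supported ℝ (1 : ℝ) fun i j => dist_simplexPt_le _ _)
  refine map_mem_of_mem_supported (fun v hv => ?_) h1
  rw [realize_single]
  refine Finsupp.single_mem_supported ℝ 1 ?_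
  obtain ⟨i, hi⟩ := h (v 0) trivial
  refine ⟨i, ?_⟩
  rintro _ ⟨t, rfl⟩
  refine interior_subset (@hi (affineComb v t) ?_)
  refine Metric.mem_ball.2 ((dist_affineComb_le_const (fun j => hv j 0) t).trans_lt ?_)
  rwa [mul_one]

/-- A finite chain whose boundary is small becomes small after subtracting a boundary. -/
theorem exists_sub_finBdry_small (hP : IsProperCovering U) {n : ℕ} (z : Sing (n + 1) X →₀ ℝ)
    (hz : finBdry X n z ∈ smallChains U n) :
    ∃ F : (Sing (n + 1) X →₀ ℝ) →ₗ[ℝ] (Sing (n + 2) X →₀ ℝ), Carried F ∧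
      z - finBdry X (n + 1) (F z) ∈ smallChains U (n + 1) := by
  -- With `T` the homotopy, `z - ∂Tz` is the sum of `T∂z`, small because `T` is carried, and of the
  -- `m`-fold subdivision of `z`, small for large `m`.
  obtain ⟨m, hm⟩ := ((Finset.eventually_all z.support).2
    fun s _ => eventually_iterSubdiv_small hP s).exists
  refine ⟨_, carried_singOp (iterHtpy (tupleBary (n + 1)) (n + 1) m (vertexChain (n + 1))), ?_⟩
  have h1 := finBdry_singOp_iterHtpy n m z
  rw [eq_sub_iff_add_eq, add_assoc, ← eq_sub_iff_add_eq'] at h1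
  rw [← h1]
  refine Submodule.add_mem _ ((carried_singOp _).mem_supported_small hz)
    (map_mem_of_mem_supported (fun s hs => ?_) (Finsupp.mem_supported_support ℝ z))
  rw [singOp_single]
  exact hm s hs

/-- Operators making chains small, in a fixed degree. -/
structure SmallOp (U : ι → Set X) (n : ℕ) where
  /-- The underlying operator. -/
  toFun : (Sing n X →₀ ℝ) →ₗ[ℝ] (Sing (n + 1) X →₀ ℝ)
  carried : Carried toFun
  small_eq_zero : ∀ s, Small U s → toFun (Finsupp.single s 1) = 0
  cycle : ∀ z, z ∈ cycles (C := fun n => Sing n X →₀ ℝ) (finBdry X) n →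
    z - finBdry X n (toFun z) ∈ smallChains U n

theorem SmallOp.eq_zero {n : ℕ} (H : SmallOp U n) {c : Sing n X →₀ ℝ}
    (hc : c ∈ smallChains U n) : H.toFun c = 0 :=
  (Submodule.mem_bot ℝ).1 (map_mem_of_mem_supported (W := ⊥)
    (fun s hs => (Submodule.mem_bot ℝ).2 (H.small_eq_zero s hs)) hc)

theorem small_zero (hP : IsProperCovering U) (s : Sing 0 X) : Small U s := by
  obtain ⟨i, hi⟩ := Set.mem_iUnion.1 (show s (stdSimplex.vertex 0) ∈ ⋃ i, interior (U i) by
    rw [hP.1]; trivial)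
  refine ⟨i, ?_⟩
  rintro _ ⟨t, rfl⟩
  have : t = stdSimplex.vertex 0 := Subsingleton.elim (α := stdSimplex ℝ (Fin 1)) _ _
  rw [this]
  exact interior_subset hi

/-- The operator in degree zero. -/
def smallOpZero (hP : IsProperCovering U) : SmallOp U 0 where
  toFun := 0
  carried := fun _ _ h => absurd rfl h
  small_eq_zero _ _ := rfl
  cycle _ _ := mem_supported_iff_ne_zero.2 fun s _ => small_zero hP s

theorem single_small_face {n : ℕ} {s : Sing (n + 1) X} (hs : Small U s) :
    finBdry X n (Finsupp.single s 1) ∈ smallChains U n :=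
  carried_finBdry.mem_supported_small (Finsupp.single_mem_supported ℝ 1 hs)

/-- The operator is chosen simplex by simplex, with as many subdivisions as each one needs. Only the
values on boundaries of the operator one degree lower enter. -/
theorem SmallOp.exists_succ (hP : IsProperCovering U) {n : ℕ} (H : SmallOp U n) :
    ∃ H' : SmallOp U (n + 1), ∀ c, c - finBdry X (n + 1) (H'.toFun c) - H.toFun (finBdry X n c) ∈
      smallChains U (n + 1) := by
  classical
  have key : ∀ s : Sing (n + 1) X, ∃ w : Sing (n + 2) X →₀ ℝ,
      (w ∈ Finsupp.supported ℝ ℝ {t : Sing (n + 2) X | Set.range t ⊆ Set.range s}) ∧ (Small U s → w = 0) ∧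
      Finsupp.single s 1 - H.toFun (finBdry X n (Finsupp.single s 1)) - finBdry X (n + 1) w ∈
        smallChains U (n + 1) := by
    intro s
    by_cases hs : Small U s
    · refine ⟨0, Submodule.zero_mem _, fun _ => rfl, ?_⟩
      rw [H.eq_zero (single_small_face hs), map_zero, sub_zero, sub_zero]
      exact Finsupp.single_mem_supported ℝ 1 hs
    -- The corrected chain `s - H ∂s` has boundary `∂s - ∂H∂s`, which is small by the property of
    -- `H` on cycles.
    · obtain ⟨F, hF, h⟩ := exists_sub_finBdry_small hP
        (Finsupp.single s 1 - H.toFun (finBdry X n (Finsupp.single s 1))) (by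
          rw [map_sub]
          exact H.cycle _ (boundary_mem_cycles (C := fun n => Sing n X →₀ ℝ) (d := finBdry X)
            (fun _ _ => finBdry_finBdry _) n _))
      refine ⟨_, map_mem_of_mem_supported (Q := {t : Sing (n + 1) X | Set.range t ⊆ Set.range s})
        (fun t ht => ?_) ?_, fun h' => absurd h' hs, h⟩
      · exact Finsupp.supported_mono (fun u hu => Set.Subset.trans hu ht) (carried_iff.1 hF t)
      · refine Submodule.sub_mem _ (Finsupp.single_mem_supported ℝ 1 (Set.Subset.refl _)) ?_
        exact carried_iff.1 (H.carried.comp carried_finBdry) s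
  choose w hw1 hw2 hw3 using key
  let G : (Sing (n + 1) X →₀ ℝ) →ₗ[ℝ] (Sing (n + 2) X →₀ ℝ) := Finsupp.linearCombination ℝ w
  have hG : ∀ s, G (Finsupp.single s 1) = w s := fun s => by
    simp only [G, Finsupp.linearCombination_single, one_smul]
  have hGs : ∀ c, c - finBdry X (n + 1) (G c) - H.toFun (finBdry X n c) ∈
      smallChains U (n + 1) := fun c => by
    refine map_mem_of_mem_supported (Q := Set.univ) (c := c)
      (F := LinearMap.id - (finBdry X (n + 1)).comp G - H.toFun.comp (finBdry X n))
      (fun s _ => ?_) (by simp)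
    simp only [LinearMap.sub_apply, LinearMap.comp_apply, LinearMap.id_apply, hG]
    rw [sub_right_comm]
    exact hw3 s
  refine ⟨⟨G, carried_iff.2 fun s => ?_, fun s hs => ?_, fun z hz => ?_⟩, hGs⟩
  · rw [hG]
    exact hw1 s
  · rw [hG]
    exact hw2 s hs
  · have := hGs z
    rwa [show finBdry X n z = 0 from hz, map_zero, sub_zero] at this

/-- There is a chain homotopy which makes all chains small and vanishes on small chains. -/
theorem exists_smallOps (hP : IsProperCovering U) : ∃ H : ∀ n, SmallOp U n, ∀ n c,
    c - finBdry X (n + 1) ((H (n + 1)).toFun c) - (H n).toFun (finBdry X n c) ∈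
      smallChains U (n + 1) := by
  choose next hnext using fun n (H : SmallOp U n) => H.exists_succ hP
  let H : ∀ n, SmallOp U n := fun n => Nat.rec (smallOpZero hP) next n
  have hH : ∀ n, H (n + 1) = next n (H n) := fun _ => rfl
  refine ⟨H, fun n c => ?_⟩
  rw [hH]
  exact hnext n (H n) c

end SingularSubdivision

/-! ## The comparison map is an isomorphism -/

section Bijective

variable {X : Type*} [TopologicalSpace X] {ι : Type*} [LinearOrder ι] {U : ι → Set X}

theorem cfExt_eq_zero_of_small {n : ℕ} (H : SmallOp U n) {c : CfChain n X}
    (hc : ∀ s, c.1 s ≠ 0 → Small U s) : cfExt H.toFun H.carried c = 0 := by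
  ext t
  change H.toFun (cfRestrict c _) t = 0
  rw [H.eq_zero, Finsupp.zero_apply]
  refine mem_supported_iff_ne_zero.2 fun s hs => ?_
  by_cases h : (Set.range s ∩ Set.range t).Nonempty
  · rw [cfRestrict_apply _ _ h] at hs
    exact hc s hs
  · exact absurd (cfRestrict_eq_zero _ _ h) hs

/-- Compactly finite chains become small after subtracting homotopy terms. -/
theorem exists_cf_htpy (hP : IsProperCovering U) :
    ∃ K : ∀ n, CfChain n X →ₗ[ℝ] CfChain (n + 1) X,
      (∀ n c, (∀ s, c.1 s ≠ 0 → Small U s) → K n c = 0) ∧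
      ∀ n c s, (c - cfBdry X (n + 1) (K (n + 1) c) - K n (cfBdry X n c)).1 s ≠ 0 → Small U s := by
  obtain ⟨H, hH⟩ := exists_smallOps hP
  refine ⟨fun n => cfExt (H n).toFun (H n).carried, fun n c hc => cfExt_eq_zero_of_small (H n) hc,
    fun n c s hs => ?_⟩
  refine mem_supported_iff_ne_zero.1 (hH n (cfRestrict c (isCompact_range_sing s))) s ?_
  rw [← cfExt_finBdry, ← cfExt_finBdry, ← cfExt_comp, ← cfExt_comp] at hs
  have h1 := cfRestrict_apply c (isCompact_range_sing s) (range_inter_range_nonempty s)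
  change c.1 s - _ - _ ≠ 0 at hs
  rw [← h1] at hs
  exact hs

/-- A lift `x` of `c` need not be a cycle, but its differential is a cycle killed by `τ`, hence the
differential of some `y` with `τ y = 0`; then `x - y` is a cycle lifting `c`. -/
theorem exists_tot_cycle (hU : IsStarFinite U) (hP : IsProperCovering U) {n : ℕ} {c : CfChain n X}
    (hc : ∀ s, c.1 s ≠ 0 → Small U s) (hcyc : c ∈ cycles (C := fun n => CfChain n X) (cfBdry X) n) :
    ∃ x ∈ cycles (C := fun n => Tot U n) (totD U hU) n, toCf U hU hP n x = c := by
  obtain ⟨x, rfl⟩ := exists_toCf_eq hU hP c hc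
  cases n with
  | zero => exact ⟨x, Submodule.mem_top, rfl⟩
  | succ n =>
    obtain ⟨y, hy1, hy2⟩ := exists_primitive_of_toCf_eq_zero hU hP (totD U hU n x)
      (bigradedD_bigradedD hU x.2) (by
        rw [toCf_comm]
        exact hcyc)
    refine ⟨x - y, ?_, ?_⟩
    · change totD U hU n (x - y) = 0
      refine (map_sub (totD U hU n) x y).trans ?_
      rw [hy2]
      exact sub_self _
    · refine (LinearMap.map_sub (toCf U hU hP (n + 1)) x y).trans ?_
      rw [hy1, sub_zero]

theorem exists_small_homologous (hP : IsProperCovering U) {n : ℕ} {c : CfChain n X}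
    (hc : c ∈ cycles (C := fun n => CfChain n X) (cfBdry X) n) :
    ∃ w, ∀ s, (c - cfBdry X n w).1 s ≠ 0 → Small U s := by
  cases n with
  | zero => exact ⟨0, fun s _ => small_zero hP s⟩
  | succ n =>
    obtain ⟨K, -, hK⟩ := exists_cf_htpy hP
    refine ⟨K (n + 1) c, fun s hs => hK n c s ?_⟩
    rwa [show cfBdry X n c = 0 from hc, map_zero, sub_zero]

/-- The map `τ` induces isomorphisms in homology. -/
theorem bijective_homologyMap_toCf (hU : IsStarFinite U) (hP : IsProperCovering U) (n : ℕ) :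
    Function.Bijective (homologyMap (C := fun n => Tot U n) (C' := fun n => CfChain n X)
      (toCf U hU hP) (toCf_comm U hU hP) n) := by
  apply homologyMap_bijective (C := fun n => Tot U n) (C' := fun n => CfChain n X)
    (toCf U hU hP) (toCf_comm U hU hP) (n := n)
  · intro x hx c hc
    obtain ⟨K, hK1, hK2⟩ := exists_cf_htpy (X := X) hP
    -- The boundary of `c` is `τ x`, hence small, and the homotopy vanishes on small chains. So `c -
    -- ∂Kc` is small and still bounds `τ x`.
    have h0 : K n (cfBdry X n c) = 0 := hK1 n _ fun s hs => by
      rw [hc] at hs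
      exact small_of_toCf_ne_zero hU hP x hs
    have hsm := hK2 n c
    rw [h0, sub_zero] at hsm
    obtain ⟨y, hy⟩ := exists_toCf_eq hU hP _ hsm
    -- After lifting `c - ∂Kc` to `y`, the cycle `x - Dy` lies in the acyclic kernel of `τ`.
    obtain ⟨z, -, hz⟩ := exists_primitive_of_toCf_eq_zero hU hP (x - totD U hU n y) (by
      change bigradedD U hU (x.1 - bigradedD U hU y.1) = 0
      rw [map_sub, bigradedD_eq_zero_of_mem_cycles hU hx, bigradedD_bigradedD hU y.2, sub_zero]) (by
      refine (LinearMap.map_sub (toCf U hU hP n) x (totD U hU n y)).trans ?_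
      rw [toCf_comm, hy, map_sub, cfBdry_cfBdry, sub_zero, hc, sub_self])
    refine ⟨z + y, ?_⟩
    rw [map_add, hz]
    exact sub_add_cancel x _
  · intro c hc
    obtain ⟨w, hw⟩ := exists_small_homologous hP hc
    obtain ⟨x, hx, hxc⟩ := exists_tot_cycle hU hP hw (sub_boundary_mem_cycles
      (C := fun n => CfChain n X) (d := cfBdry X) (fun _ _ => cfBdry_cfBdry _) hc w)
    refine ⟨x, hx, -w, ?_⟩
    rw [hxc, map_neg]
    abel

/-- A class in the kernel of the Leray homomorphism is represented by `τ x` for a cycle `x` of the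
total complex such that `λ x` is a boundary. -/
theorem exists_representative_of_mem_ker_leray (hU : IsStarFinite U) (hP : IsProperCovering U)
    {n : ℕ} {h : CfHomology X n} (hker : h ∈ LinearMap.ker (leray U hU hP n)) :
    ∃ x : cycles (C := fun n => Tot U n) (totD U hU) n,
      (∃ y, nerveBdry U hU ℝ n y = toNerve U n x.1) ∧
      ∀ z : cycles (C := fun n => CfChain n X) (cfBdry X) n,
        (∃ w, cfBdry X n w = toCf U hU hP n x.1 - z.1) → Submodule.Quotient.mk z = h := by
  have key := exists_cycle_of_linearInverse_eq_zero (C := fun n => Tot U n)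
    (C' := fun n => CfChain n X) (C'' := fun n => Nerve U n → ℝ)
    (toCf U hU hP) (toCf_comm U hU hP) (toNerve U) (toNerve_comm U hU) (n := n) (h := h)
  have key' := key (bijective_homologyMap_toCf hU hP n)
  exact key' hker

theorem sub_totD_mem_cycles (hU : IsStarFinite U) {n : ℕ} {x : Tot U n}
    (hx : x ∈ cycles (C := fun n => Tot U n) (totD U hU) n) (w : Tot U (n + 1)) :
    x - totD U hU n w ∈ cycles (C := fun n => Tot U n) (totD U hU) n := by
  have h0 := sub_boundary_mem_cycles (C := fun n => Tot U n) (d := totD U hU) (n := n) (x := x)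
    (fun _ v => Subtype.ext (bigradedD_bigradedD hU v.2))
  exact h0 hx w

theorem toCf_mem_cycles (hU : IsStarFinite U) (hP : IsProperCovering U) {n : ℕ} {x : Tot U n}
    (hx : x ∈ cycles (C := fun n => Tot U n) (totD U hU) n) :
    toCf U hU hP n x ∈ cycles (C := fun n => CfChain n X) (cfBdry X) n := by
  have h1 := map_mem_cycles (C := fun n => Tot U n) (C' := fun n => CfChain n X) (toCf U hU hP)
      (toCf_comm U hU hP) n x
  exact h1 hx

theorem exists_cfBdry_eq_toCf_sub (hU : IsStarFinite U) (hP : IsProperCovering U) {n : ℕ} {x : Tot U n}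
    (w : Tot U (n + 1)) :
    ∃ w', cfBdry X n w' = toCf U hU hP n x - toCf U hU hP n (x - totD U hU n w) := by
  refine ⟨toCf U hU hP (n + 1) w, ?_⟩
  rw [← toCf_comm, LinearMap.map_sub (toCf U hU hP n) x (totD U hU n w)]
  exact (sub_sub_cancel _ _).symm

/-- Classes in the kernel of the Leray homomorphism have zero norm. -/
theorem cfNorm_eq_zero_of_mem_ker_leray (hcount : (Set.range U).Countable)
    (hstar : IsStarFinite U) (hproper : IsProperCovering U) (hacyclic : IsL1AcyclicCovering U)
    {n : ℕ} {h : CfHomology X n} (hker : h ∈ LinearMap.ker (leray U hstar hproper n)) :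
    cfNorm h = 0 := by
  obtain ⟨x, ⟨y, hy⟩, hx⟩ := exists_representative_of_mem_ker_leray hstar hproper hker
  refine le_antisymm (ENNReal.le_of_forall_pos_le_add fun ε hε _ => ?_) bot_le
  obtain ⟨w, hw⟩ := exists_small_representative hstar hproper hcount hacyclic x.1
    (bigradedD_eq_zero_of_mem_cycles hstar x.2) y hy (ε := ε) (by simpa using hε.ne')
  rw [zero_add, cfNorm]
  have h1 := hx ⟨_, toCf_mem_cycles hstar hproper (sub_totD_mem_cycles hstar x.2 w)⟩ (exists_cfBdry_eq_toCf_sub hstar hproper w)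
  exact le_trans (iInf_le_of_le _ (iInf_le_of_le h1 le_rfl)) hw

end Bijective

end LerayCF

end

theorem mainTheorem8 {X : Type*} [TopologicalSpace X] {ι : Type*} [LinearOrder ι]
    (U : ι → Set X) (hcount : (Set.range U).Countable)
    (hstar : LerayCF.IsStarFinite U) (hproper : LerayCF.IsProperCovering U)
    (hacyclic : LerayCF.IsL1AcyclicCovering U)
    (n : ℕ) (h : LerayCF.CfHomology X n)
    (hker : h ∈ LinearMap.ker (LerayCF.leray U hstar hproper n)) :
    LerayCF.cfNorm h = 0 :=
  LerayCF.cfNorm_eq_zero_of_mem_ker_leray hcount hstar hproper hacyclic hker
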